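/- **Theorem 2.1 (well-posedness).** Let $0<\alpha<1$ and $T>0$. There is a constant $C>0$ depending only on $\alpha$ and $T$ such that the following holds. Let $\Omega\subset\mathbb R^2$ be a nonempty bounded open set (for instance a bounded polygonal domain with Lipschitz boundary). Write $(\cdot,\cdot)$ and $\|\cdot\|$ for the scalar product and norm of $L^2(\Omega)$. Let $V=H^2_0(\Omega)$ be the closure of $C_c^\infty(\Omega)$ in $H^2(\Omega)$, with the norm of $H^2(\Omega)$, let $V^*$ be its dual with the dual norm, with $V\subset L^2(\Omega)\subset V^*$ through $\langle g,v\rangle=(g,v)$, and let $a(v,w)=\int_\Omega D^2v:D^2w\,dx$ on $V\times V$. All functions are real-valued. (i) There are $\phi_j\in V$ and $\mu_j\in\mathbb R$ ($j\ge 1$) such that $(\phi_j)$ is an orthonormal basis of $L^2(\Omega)$, $a(\phi_j,v)=\mu_j(\phi_j,v)$ for all $v\in V$ (that is, $\Delta^2\phi_j=\mu_j\phi_j$ with clamped boundary conditions), $0<\mu_1\le\mu_2\le\dots$ and $\mu_j\to\infty$. For any such family, with $E_{\alpha,\beta}(z)=\sum_{k\ge0}z^k/\Gamma(k\alpha+\beta)$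 and $0<t\le T$, the series $$E(t)g=\sum_j (g,\phi_j)E_{\alpha,1}(-\mu_jt^\alpha)\phi_j,\qquad F(t)h=\sum_j\langle h,\phi_j\rangle t^{\alpha-1}E_{\alpha,\alpha}(-\mu_jt^\alpha)\phi_j$$ converge in $L^2(\Omega)$ for $g\in L^2(\Omega)$ and in $V^*$ for $h\in V^*$, respectively, and define bounded operators $E(t)$ on $L^2(\Omega)$ and $F(t)$ on $V^*$. (ii) Let $u_0\in L^2(\Omega)$ and $f\in W^{1,1}(0,T;V^*)$. A weak solution of $\partial_t^\alpha u+\Delta^2u=f$, $u(0)=u_0$, with clamped boundary conditions, is a function $u\in L^1(0,T;V)\cap W^{1,1}(0,T;V^*)$ such that for every $v\in V$ $$\frac1{\Gamma(1-\alpha)}\int_0^t(t-s)^{-\alpha}\langle u'(s),v\rangle\,ds+a(u(t),v)=\langle f(t),v\rangle\quad\text{for almost every }t\in(0,T),$$ and such that $\|u(t)-u_0\|_{V^*}\to0$ as $t\to0^+$ for the continuous representative of $u:(0,T)\to V^*$. There is one and (up to null sets) only one weak solution. It has a representative that takes values in $V$ and satisfies, for every $t\in(0,T]$, $$u(t)=E(t)u_0+\int_0^tF(t-s)f(s)\,ds,$$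 the integral being a Bochner integral in $V^*$. (iii) The weak solution satisfies $$\|u\|_{L^1(0,T;V)}+\|u'\|_{L^1(0,T;V^*)}\le C\big(\|u_0\|+\|f\|_{W^{1,1}(0,T;V^*)}\big),\qquad \|f\|_{W^{1,1}(0,T;V^*)}=\|f\|_{L^1(0,T;V^*)}+\|f'\|_{L^1(0,T;V^*)}.$$ -/

import Mathlib

open MeasureTheory Set Filter Topology
open scoped ContDiff

noncomputable section

namespace FracBiharmonic

/-- The Euclidean plane. -/
abbrev Plane : Type := EuclideanSpace ℝ (Fin 2)

/-- The real Hilbert space `L²(Ω)`. -/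
abbrev L2 (Ω : Set Plane) : Type := Lp ℝ 2 (volume.restrict Ω)

/-! ### The space `V = H²₀(Ω)` -/

/-- The classical partial derivative `∂ᵢφ`. -/
def pderiv (i : Fin 2) (φ : Plane → ℝ) (x : Plane) : ℝ :=
  fderiv ℝ φ x (EuclideanSpace.single i 1)

/-- Labels of the derivatives of order at most two: one label for the function itself, labels `i`
for `∂ᵢ` and labels `(i, j)` for `∂ᵢ∂ⱼ`. -/
abbrev JetIndex : Type := Unit ⊕ Fin 2 ⊕ (Fin 2 × Fin 2)

/-- The derivative of `φ` with a given label. -/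
def jetFun (φ : Plane → ℝ) : JetIndex → Plane → ℝ
  | Sum.inl _ => φ
  | Sum.inr (Sum.inl i) => pderiv i φ
  | Sum.inr (Sum.inr ij) => pderiv ij.1 (pderiv ij.2 φ)

/-- The Hilbert space of families `(w, (wᵢ), (wᵢⱼ))` of `L²(Ω)` functions. Through
`v ↦ (v, (∂ᵢv), (∂ᵢ∂ⱼv))` (weak derivatives) the Sobolev space `H²(Ω)` is a closed subspace of it,
and the norm induced on `H²(Ω)` is the usual one,
`‖v‖² + ∑ᵢ ‖∂ᵢv‖² + ∑ᵢⱼ ‖∂ᵢ∂ⱼv‖²` under a square root. -/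
abbrev Jet (Ω : Set Plane) : Type := PiLp 2 (fun _ : JetIndex => L2 Ω)

/-- `φ ∈ D(Ω)`: smooth with compact support contained in `Ω`. -/
structure IsTest (Ω : Set Plane) (φ : Plane → ℝ) : Prop where
  smooth : ContDiff ℝ ∞ φ
  compact : HasCompactSupport φ
  supp : tsupport φ ⊆ Ω

theorem IsTest.zero (Ω : Set Plane) : IsTest Ω (fun _ => 0) :=
  ⟨contDiff_const, HasCompactSupport.zero, by
    have h : tsupport (fun _ : Plane => (0 : ℝ)) = ∅ := tsupport_eq_empty_iff.2 rfl
    rw [h]; exact empty_subset _⟩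

theorem IsTest.add {Ω : Set Plane} {φ ψ : Plane → ℝ} (hφ : IsTest Ω φ) (hψ : IsTest Ω ψ) :
    IsTest Ω (fun x => φ x + ψ x) :=
  ⟨hφ.smooth.add hψ.smooth, hφ.compact.add hψ.compact,
    (tsupport_add φ ψ).trans (union_subset hφ.supp hψ.supp)⟩

theorem IsTest.smul {Ω : Set Plane} {φ : Plane → ℝ} (c : ℝ) (hφ : IsTest Ω φ) :
    IsTest Ω (fun x => c * φ x) :=
  ⟨contDiff_const.mul hφ.smooth, hφ.compact.mul_left,
    (tsupport_mul_subset_right (f := fun _ => c) (g := φ)).trans hφ.supp⟩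

theorem pderiv_smooth {φ : Plane → ℝ} (h : ContDiff ℝ ∞ φ) (i : Fin 2) :
    ContDiff ℝ ∞ (pderiv i φ) :=
  (h.fderiv_right (m := ∞) (by simp)).clm_apply contDiff_const

theorem pderiv_add {φ ψ : Plane → ℝ} (hφ : ContDiff ℝ ∞ φ) (hψ : ContDiff ℝ ∞ ψ) (i : Fin 2) :
    pderiv i (fun x => φ x + ψ x) = fun x => pderiv i φ x + pderiv i ψ x := by
  funext x
  have h1 : DifferentiableAt ℝ φ x := (hφ.differentiable (by simp)) x
  have h2 : DifferentiableAt ℝ ψ x := (hψ.differentiable (by simp)) x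
  simp [pderiv, fderiv_fun_add h1 h2]

theorem pderiv_smul {φ : Plane → ℝ} (hφ : ContDiff ℝ ∞ φ) (c : ℝ) (i : Fin 2) :
    pderiv i (fun x => c * φ x) = fun x => c * pderiv i φ x := by
  funext x
  have h1 : DifferentiableAt ℝ φ x := (hφ.differentiable (by simp)) x
  simp [pderiv, fderiv_const_mul h1 c]

theorem pderiv_zero (i : Fin 2) : pderiv i (fun _ => 0) = fun _ => 0 := by
  funext x
  simp [pderiv]

theorem jetFun_zero (m : JetIndex) : jetFun (fun _ => 0) m = fun _ => 0 := by
  rcases m with _ | i | ij <;> simp [jetFun, pderiv_zero]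

theorem jetFun_add {φ ψ : Plane → ℝ} (hφ : ContDiff ℝ ∞ φ) (hψ : ContDiff ℝ ∞ ψ) (m : JetIndex) :
    jetFun (fun x => φ x + ψ x) m = fun x => jetFun φ m x + jetFun ψ m x := by
  rcases m with _ | i | ij
  · rfl
  · exact pderiv_add hφ hψ i
  · simp only [jetFun]
    rw [pderiv_add hφ hψ, pderiv_add (pderiv_smooth hφ _) (pderiv_smooth hψ _)]

theorem jetFun_smul {φ : Plane → ℝ} (hφ : ContDiff ℝ ∞ φ) (c : ℝ) (m : JetIndex) :
    jetFun (fun x => c * φ x) m = fun x => c * jetFun φ m x := by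
  rcases m with _ | i | ij
  · rfl
  · exact pderiv_smul hφ c i
  · simp only [jetFun]
    rw [pderiv_smul hφ, pderiv_smul (pderiv_smooth hφ _)]

/-- The copy of `D(Ω)` inside the space of families: `φ` is sent to the classes of
`φ, ∂ᵢφ, ∂ᵢ∂ⱼφ`. -/
def testJets (Ω : Set Plane) : Submodule ℝ (Jet Ω) where
  carrier := {w | ∃ φ : Plane → ℝ, IsTest Ω φ ∧
    ∀ m : JetIndex, (w m : Plane → ℝ) =ᵐ[volume.restrict Ω] jetFun φ m}
  zero_mem' := by
    refine ⟨fun _ => 0, IsTest.zero Ω, fun m => ?_⟩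
    rw [jetFun_zero]
    exact Lp.coeFn_zero ℝ 2 _
  add_mem' := by
    rintro v w ⟨φ, hφ, hv⟩ ⟨ψ, hψ, hw⟩
    refine ⟨_, hφ.add hψ, fun m => ?_⟩
    rw [jetFun_add hφ.smooth hψ.smooth]
    filter_upwards [Lp.coeFn_add (v m) (w m), hv m, hw m] with x h1 h2 h3
    rw [PiLp.add_apply, h1, Pi.add_apply, h2, h3]
  smul_mem' := by
    rintro c v ⟨φ, hφ, hv⟩
    refine ⟨_, hφ.smul c, fun m => ?_⟩
    rw [jetFun_smul hφ.smooth]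
    filter_upwards [Lp.coeFn_smul c (v m), hv m] with x h1 h2
    rw [PiLp.smul_apply, h1, Pi.smul_apply, h2, smul_eq_mul]

/-- `H²₀(Ω)`, the closure of `D(Ω)` in `H²(Ω)`, as a closed subspace of the space of families. -/
def H20 (Ω : Set Plane) : Submodule ℝ (Jet Ω) := (testJets Ω).topologicalClosure

/-- `V = H²₀(Ω)` with the norm (and inner product) of `H²(Ω)`. -/
def V (Ω : Set Plane) : Type := H20 Ω

instance (Ω : Set Plane) : NormedAddCommGroup (V Ω) := inferInstanceAs (NormedAddCommGroup (H20 Ω))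

instance (Ω : Set Plane) : InnerProductSpace ℝ (V Ω) :=
  inferInstanceAs (InnerProductSpace ℝ (H20 Ω))

/-- The isometric inclusion `V ⊂ H²(Ω)`, `v ↦ (v, (∂ᵢv), (∂ᵢ∂ⱼv))`. -/
def toJet (Ω : Set Plane) : V Ω →L[ℝ] Jet Ω := (H20 Ω).subtypeL

/-- The dual `V* = H⁻²(Ω)` with the dual norm. -/
abbrev VDual (Ω : Set Plane) : Type := StrongDual ℝ (V Ω)

/-- The inclusion `V ⊂ L²(Ω)`. -/
def toL2 (Ω : Set Plane) : V Ω →L[ℝ] L2 Ω :=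
  (PiLp.proj (𝕜 := ℝ) 2 (fun _ : JetIndex => L2 Ω) (Sum.inl ())).comp (toJet Ω)

/-- The inclusion `L²(Ω) ⊂ V*`, `⟨g, v⟩ = (g, v)`. -/
def toDual {Ω : Set Plane} (g : L2 Ω) : VDual Ω := (innerSL ℝ g).comp (toL2 Ω)

/-- The inclusion `V ⊂ L²(Ω) ⊂ V*`. -/
def vToDual {Ω : Set Plane} (v : V Ω) : VDual Ω := toDual (toL2 Ω v)

/-- The weak second derivative `∂ᵢ∂ⱼv ∈ L²(Ω)` of `v ∈ V`. -/
def hess {Ω : Set Plane} (v : V Ω) (i j : Fin 2) : L2 Ω :=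
  toJet Ω v (Sum.inr (Sum.inr (i, j)))

/-- The bilinear form `a(v, w) = ∫_Ω D²v : D²w`. -/
def bform {Ω : Set Plane} (v w : V Ω) : ℝ :=
  ∑ i : Fin 2, ∑ j : Fin 2, inner ℝ (hess v i j) (hess w i j)

/-- A family of eigenpairs of the clamped biharmonic operator `A`: the `φⱼ ∈ V` form an orthonormal
basis of `L²(Ω)`, `Δ²φⱼ = μⱼφⱼ` in the sense that `a(φⱼ, v) = μⱼ (φⱼ, v)` for all `v ∈ V`, and
`0 < μ₁ ≤ μ₂ ≤ … → ∞` (indices start at `0` here). -/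
structure IsEigenbasis (Ω : Set Plane) (μ : ℕ → ℝ) (φ : ℕ → V Ω) : Prop where
  orthonormal : Orthonormal ℝ (fun j => toL2 Ω (φ j))
  complete : (Submodule.span ℝ (range fun j => toL2 Ω (φ j))).topologicalClosure = ⊤
  eigen : ∀ (j : ℕ) (v : V Ω), bform (φ j) v = μ j * inner ℝ (toL2 Ω (φ j)) (toL2 Ω v)
  pos : ∀ j, 0 < μ j
  mono : Monotone μ
  tendsto : Tendsto μ atTop atTop

/-! ### Functions of time -/

/-- The Bochner function `g : (0,T) → X` has weak derivative `g'`. -/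
def HasWeakDeriv {X : Type*} [NormedAddCommGroup X] [NormedSpace ℝ X] (T : ℝ) (g g' : ℝ → X) :
    Prop :=
  ∀ ψ : ℝ → ℝ, ContDiff ℝ ∞ ψ → HasCompactSupport ψ → tsupport ψ ⊆ Ioo 0 T →
    ∫ t in Ioo 0 T, deriv ψ t • g t = - ∫ t in Ioo 0 T, ψ t • g' t

/-- `g ∈ W^{1,1}(0,T;X)` with derivative `g'` (which is unique up to null sets). -/
structure IsW11 {X : Type*} [NormedAddCommGroup X] [NormedSpace ℝ X] (T : ℝ) (g g' : ℝ → X) :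
    Prop where
  integrable : IntegrableOn g (Ioo 0 T)
  integrable_deriv : IntegrableOn g' (Ioo 0 T)
  weak : HasWeakDeriv T g g'

/-- The norm of `L¹(0,T;X)`. -/
def L1norm {X : Type*} [NormedAddCommGroup X] (T : ℝ) (g : ℝ → X) : ℝ :=
  ∫ t in Ioo 0 T, ‖g t‖

/-- The Riemann-Liouville integral
`(I^β g)(t) = ∫₀ᵗ κ_β(t-s) g(s) ds`, `κ_β(t) = t^(β-1) / Γ(β)`. For `g ∈ L¹(0,T)` and `β > 0` the
integrand is integrable for almost every `t ∈ (0,T)` and `I^β g ∈ L¹(0,T)`. The Caputo derivative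
of `g ∈ W^{1,1}(0,T)` of order `α ∈ (0,1)` is `I^(1-α) g'`. -/
def rlIntegral (β : ℝ) (g : ℝ → ℝ) (t : ℝ) : ℝ :=
  ∫ s in (0 : ℝ)..t, (t - s) ^ (β - 1) / Real.Gamma β * g s

/-- Weak solutions `u ∈ L¹(0,T;V) ∩ W^{1,1}(0,T;V*)` of `∂ₜ^α u + A u = f`, `u(0) = u₀`. Here `u'`
is the derivative of `u` in `L¹(0,T;V*)`, so that `⟨u'(·), v⟩` is the derivative of the absolutely
continuous function `⟨u(·), v⟩`. The notion does not depend on the values of `u` and `f` on null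
sets; the initial condition is about the continuous representative `U` of `u : (0,T) → V*`. -/
def IsWeakSolution {Ω : Set Plane} (α T : ℝ) (u₀ : L2 Ω) (f : ℝ → VDual Ω) (u : ℝ → V Ω) : Prop :=
  IntegrableOn u (Ioo 0 T) ∧
  (∃ u' : ℝ → VDual Ω, IsW11 T (fun t => vToDual (u t)) u' ∧
    ∀ v : V Ω, ∀ᵐ t ∂(volume.restrict (Ioo 0 T)),
      rlIntegral (1 - α) (fun s => u' s v) t + bform (u t) v = f t v) ∧
  ∃ U : ℝ → VDual Ω, ContinuousOn U (Ioo 0 T) ∧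
    U =ᵐ[volume.restrict (Ioo 0 T)] (fun t => vToDual (u t)) ∧
    Tendsto (fun t => ‖U t - toDual u₀‖) (𝓝[>] 0) (𝓝 0)

/-- The Mittag-Leffler function `E_{α,β}(z) = ∑ⱼ zʲ / Γ(jα + β)` at real arguments; the series
converges absolutely for `α > 0`. -/
def mittagLeffler (α β z : ℝ) : ℝ := ∑' j : ℕ, z ^ j / Real.Gamma (j * α + β)

end FracBiharmonic

end

/-!
# Well-posedness of the time-fractional clamped biharmonic equation

On a bounded open set `Ω` of the plane, test functions satisfy `φ(x) = ∬ ∂₀∂₁φ` over a quadrant, so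
`H²₀(Ω)` embeds into `L^∞(Ω)` with `‖v‖_∞ ≤ M a(v,v)^{1/2}` (`exists_forall_ae_abs_le`). Hence the
form `a` is coercive and the solution operator of the clamped plate problem is Hilbert–Schmidt
(`sum_norm_sq_le_of_ae_abs_le`, `isCompactOperator_of_sum_sq_le`). The spectral theorem then yields
the eigenfunctions (`exists_isEigenbasis`).

In an eigenbasis the equation decouples into relaxation equations `∂ₜ^α y + μ y = h`, `y(0) = c`,
solved with the kernels `f(t) = t^(α-1) E_{α,α}(-μ t^α)`, `e(t) = E_{α,1}(-μ t^α)` and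
`g(t) = t^α E_{α,α+1}(-μ t^α)`. They satisfy `κ_{1-α} * f = e`, `∫₀ᵗ f = g` and `e + μ g = 1`, where
`κ_β(t) = t^(β-1) / Γ(β)`; these identities come from the series and the semigroup property of `κ_β`.
All estimates rest on the positivity of `f` (`relaxKernel_nonneg`), proved at a first zero of `f`.
It gives `0 ≤ e ≤ 1`, `0 ≤ f ≤ κ_α` and `0 ≤ μ g ≤ 1`, the decay `μ e κ_{α+1} ≤ 1`
(`mul_relaxKernel_one_le`) and `μ t f ≤ α` (`mul_mul_relaxKernel_le`).

Let `λ = 1 + μ`. With `√λ`-weighted coefficients, `V` and `V*` become `ℓ²` up to constants that do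
not depend on `Ω`, since `‖v‖² ≤ 2 (‖v‖²_{L²} + a(v,v))` (`norm_sq_le`). Writing `f = f₀ + ∫₀ᵗ f'`
for the source and integrating by parts in Duhamel's formula,
`u_j = e c_j + g f₀_j + g * f'_j` and `u_j' = f (f₀_j - μ c_j) + f * f'_j`. The multipliers needed for
`u` in `L¹(0,T;V)` and `u'` in `L¹(0,T;V*)` are `√λ e`, `λ g`, `μ f / √λ` and `f`. They have majorants
of order `1 + t^(-α/2)`, `1`, `t^(α/2-1)` and `t^(α-1)`, uniformly in `μ` and integrable on `(0, T)`;
Young's inequality for convolutions (`lconv_young`) then gives existence and the estimate.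
For uniqueness, the coefficients `d` of a difference of weak solutions satisfy `κ_{1-α} * d' + μ d = 0`,
and convolving with `f` gives `d = (e + μ g) * d' = 0` (`ae_eq_zero_of_relaxation`).
-/

namespace FracBiharmonic

/-! ### Mittag-Leffler functions and their kernels -/

/-- Restrict Euler's integral for `Γ(y)` to `(R, ∞)`, where `x^(y-1) ≥ R^(y-1)`. -/
theorem rpow_mul_exp_neg_le_Gamma {R y : ℝ} (hR : 0 < R) (hy : 1 ≤ y) :
    R ^ (y - 1) * Real.exp (-R) ≤ Real.Gamma y := by
  have hy0 : 0 < y := by linarith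
  have hint : IntegrableOn (fun x : ℝ => Real.exp (-x) * x ^ (y - 1)) (Ioi 0) :=
    Real.GammaIntegral_convergent hy0
  rw [Real.Gamma_eq_integral hy0]
  have h2 : ∫ x in Ioi R, Real.exp (-x) * R ^ (y - 1) = R ^ (y - 1) * Real.exp (-R) := by
    rw [integral_mul_const, integral_exp_neg_Ioi, mul_comm]
  rw [← h2]
  refine le_trans (setIntegral_mono_on ?_ (hint.mono_set (Ioi_subset_Ioi hR.le))
    measurableSet_Ioi ?_) (setIntegral_mono_set hint ?_ ?_)
  · exact (integrableOn_exp_neg_Ioi R).mul_const _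
  · intro x hx
    have : R ≤ x := le_of_lt hx
    gcongr
  · filter_upwards [ae_restrict_mem measurableSet_Ioi] with x hx
    have : 0 < x := hx
    simp only [Pi.zero_apply]; positivity
  · exact (Ioi_subset_Ioi hR.le).eventuallyLE

theorem summable_mittagLeffler {α β : ℝ} (hα : 0 < α) (hβ : 0 < β) (x : ℝ) :
    Summable fun n : ℕ => x ^ n / Real.Gamma (n * α + β) := by
  -- `Γ(y) ≥ R^(y-1) e^(-R)` with `R ^ α = 2 (|x| + 1)` gives a geometric majorant
  set R : ℝ := (2 * (|x| + 1)) ^ α⁻¹ with hRdef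
  have hb : 0 < 2 * (|x| + 1) := by positivity
  have hR : 0 < R := Real.rpow_pos_of_pos hb _
  have hRα : R ^ α = 2 * (|x| + 1) := by
    rw [hRdef, ← Real.rpow_mul hb.le, inv_mul_cancel₀ hα.ne', Real.rpow_one]
  obtain ⟨N, hN⟩ := exists_nat_gt (1 / α)
  have hmaj : Summable fun n : ℕ => (Real.exp R * R ^ (1 - β)) * (1 / 2 : ℝ) ^ n :=
    (summable_geometric_of_lt_one (by norm_num) (by norm_num)).mul_left _
  refine Summable.of_norm_bounded_eventually_nat hmaj ?_
  filter_upwards [eventually_ge_atTop N] with n hn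
  have hnα : 1 ≤ n * α := by
    have h1 : (N : ℝ) ≤ n := by exact_mod_cast hn
    have h2 : 1 / α < n := lt_of_lt_of_le hN h1
    rw [div_lt_iff₀ hα] at h2
    exact h2.le
  have hy : 1 ≤ n * α + β := by linarith
  have hG := rpow_mul_exp_neg_le_Gamma hR hy
  have hGpos : 0 < Real.Gamma (n * α + β) := Real.Gamma_pos_of_pos (by linarith)
  rw [norm_div, norm_pow, Real.norm_eq_abs, Real.norm_eq_abs, abs_of_pos hGpos,
    div_le_iff₀ hGpos]
  have hsplit : R ^ (n * α + β - 1) = (2 * (|x| + 1)) ^ n * R ^ (β - 1) := by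
    rw [← hRα, ← Real.rpow_natCast (R ^ α) n, ← Real.rpow_mul hR.le, ← Real.rpow_add hR]
    congr 1; ring
  have hinv : R ^ (1 - β) * R ^ (β - 1) = 1 := by
    rw [← Real.rpow_add hR]; simp
  have hexp : Real.exp R * Real.exp (-R) = 1 := by rw [← Real.exp_add]; simp
  calc |x| ^ n ≤ (|x| + 1) ^ n := by gcongr; linarith
    _ = (Real.exp R * Real.exp (-R)) * (R ^ (1 - β) * R ^ (β - 1)) * (|x| + 1) ^ n := by
        rw [hexp, hinv]; ring
    _ = Real.exp R * R ^ (1 - β) * (1 / 2) ^ n * (R ^ (n * α + β - 1) * Real.exp (-R)) := by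
        rw [hsplit, mul_pow]
        have : (1 / 2 : ℝ) ^ n * 2 ^ n = 1 := by rw [← mul_pow]; norm_num
        linear_combination (-(Real.exp R * Real.exp (-R)) * (R ^ (1 - β) * R ^ (β - 1)) * (|x| + 1) ^ n) * this
    _ ≤ _ := by gcongr

/-- The Mittag-Leffler function is the sum of a power series of infinite radius. -/
theorem contDiff_mittagLeffler {α β : ℝ} (hα : 0 < α) (hβ : 0 < β) :
    ContDiff ℝ ω (mittagLeffler α β) := by
  set c : ℕ → ℝ := fun n => (Real.Gamma (n * α + β))⁻¹
  set p := FormalMultilinearSeries.ofScalars ℝ c with hp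
  have hrad : p.radius = ⊤ := by
    refine FormalMultilinearSeries.radius_eq_top_of_summable_norm _ fun r => ?_
    have h := summable_mittagLeffler hα hβ (r : ℝ)
    refine h.congr fun n => ?_
    rw [hp, FormalMultilinearSeries.ofScalars_norm, Real.norm_of_nonneg, div_eq_inv_mul]
    exact inv_nonneg.2 (Real.Gamma_pos_of_pos (by positivity)).le
  have hps := p.hasFPowerSeriesOnBall (by rw [hrad]; exact ENNReal.zero_lt_top)
  have hsum : p.sum = mittagLeffler α β := by
    have := FormalMultilinearSeries.ofScalarsSum_eq_tsum (E := ℝ) c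
    rw [FormalMultilinearSeries.ofScalarsSum] at this
    rw [hp, this]
    funext x
    simp only [mittagLeffler, smul_eq_mul, c]
    exact tsum_congr fun n => by rw [div_eq_inv_mul]
  rw [← hsum]
  have := hps.analyticOnNhd
  rw [hrad, Metric.eball_top] at this
  exact contDiff_iff_contDiffAt.2 fun x => (this x (mem_univ x)).contDiffAt

/-- The Riemann–Liouville kernel `t^(β-1) / Γ(β)`, extended by zero to `t ≤ 0`. -/
noncomputable def rlKernel (β t : ℝ) : ℝ := if 0 < t then t ^ (β - 1) / Real.Gamma β else 0

/-- The relaxation kernel `t^(β-1) E_{α,β}(-μ t^α)`, extended by zero to `t ≤ 0`. -/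
noncomputable def relaxKernel (α μ β t : ℝ) : ℝ :=
  if 0 < t then t ^ (β - 1) * mittagLeffler α β (-(μ * t ^ α)) else 0

theorem rlKernel_of_pos {β t : ℝ} (ht : 0 < t) : rlKernel β t = t ^ (β - 1) / Real.Gamma β :=
  if_pos ht

theorem rlKernel_of_nonpos {β t : ℝ} (ht : t ≤ 0) : rlKernel β t = 0 := if_neg ht.not_gt

theorem relaxKernel_of_pos {α μ β t : ℝ} (ht : 0 < t) :
    relaxKernel α μ β t = t ^ (β - 1) * mittagLeffler α β (-(μ * t ^ α)) := if_pos ht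

theorem relaxKernel_of_nonpos {α μ β t : ℝ} (ht : t ≤ 0) : relaxKernel α μ β t = 0 :=
  if_neg ht.not_gt

theorem rlKernel_nonneg {β : ℝ} (hβ : 0 < β) (t : ℝ) : 0 ≤ rlKernel β t := by
  unfold rlKernel
  split_ifs with h
  · have := Real.Gamma_pos_of_pos hβ; positivity
  · exact le_rfl

theorem rlKernel_pos {β t : ℝ} (hβ : 0 < β) (ht : 0 < t) : 0 < rlKernel β t := by
  rw [rlKernel_of_pos ht]
  have := Real.Gamma_pos_of_pos hβ; positivity

theorem rlKernel_one {t : ℝ} (ht : 0 < t) : rlKernel 1 t = 1 := by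
  rw [rlKernel_of_pos ht]; simp

theorem mul_rlKernel {β : ℝ} (hβ : 0 < β) (t : ℝ) : t * rlKernel β t = β * rlKernel (β + 1) t := by
  rcases lt_or_ge 0 t with ht | ht
  · rw [rlKernel_of_pos ht, rlKernel_of_pos ht, Real.Gamma_add_one hβ.ne', add_sub_cancel_right]
    have := (Real.Gamma_pos_of_pos hβ).ne'
    rw [Real.rpow_sub_one ht.ne']
    field_simp
  · simp [rlKernel_of_nonpos ht]

theorem measurable_rlKernel (β : ℝ) : Measurable (rlKernel β) :=
  Measurable.ite measurableSet_Ioi ((measurable_id.pow_const _).div_const _) measurable_const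

theorem measurable_relaxKernel {α β : ℝ} (hα : 0 < α) (hβ : 0 < β) (μ : ℝ) :
    Measurable (relaxKernel α μ β) :=
  Measurable.ite measurableSet_Ioi ((measurable_id.pow_const _).mul
    ((contDiff_mittagLeffler hα hβ).continuous.measurable.comp
      ((measurable_id.pow_const _).const_mul _).neg)) measurable_const

theorem integrableOn_rlKernel {β : ℝ} (hβ : 0 < β) (T : ℝ) : IntegrableOn (rlKernel β) (Ioo 0 T) := by
  rcases lt_or_ge 0 T with hT | hT
  · have h : IntegrableOn (fun t : ℝ => t ^ (β - 1) / Real.Gamma β) (Ioo 0 T) := by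
      have := (intervalIntegral.intervalIntegrable_rpow' (a := 0) (b := T) (r := β - 1)
        (by linarith)).div_const (Real.Gamma β)
      rw [intervalIntegrable_iff_integrableOn_Ioo_of_le hT.le] at this
      exact this
    exact h.congr_fun (fun t ht => (rlKernel_of_pos ht.1).symm) measurableSet_Ioo
  · simp [Ioo_eq_empty (not_lt.2 hT)]

/-- The relaxation kernel as the series `∑ (-μ)ⁿ κ_{nα+β}` of Riemann–Liouville kernels. -/
theorem hasSum_relaxKernel {α β : ℝ} (hα : 0 < α) (hβ : 0 < β) (μ t : ℝ) :
    HasSum (fun n : ℕ => (-μ) ^ n * rlKernel (n * α + β) t) (relaxKernel α μ β t) := by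
  rcases lt_or_ge 0 t with ht | ht
  · rw [relaxKernel_of_pos ht]
    have h := ((summable_mittagLeffler hα hβ (-(μ * t ^ α))).hasSum).mul_left (t ^ (β - 1))
    refine h.congr_fun fun n => ?_
    rw [rlKernel_of_pos ht, ← neg_mul, mul_pow, ← Real.rpow_natCast (t ^ α) n, ← Real.rpow_mul ht.le,
      show (n * α + β - 1 : ℝ) = α * n + (β - 1) by ring, Real.rpow_add ht]
    ring
  · simp [relaxKernel_of_nonpos ht, rlKernel_of_nonpos ht, hasSum_zero]

theorem summable_abs_relaxKernel {α β : ℝ} (hα : 0 < α) (hβ : 0 < β) (μ t : ℝ) :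
    Summable (fun n : ℕ => |μ| ^ n * rlKernel (n * α + β) t) := by
  simpa using (hasSum_relaxKernel hα hβ (-|μ|) t).summable

/-- Convolution on `(0, t)` of functions given on the positive half line. -/
noncomputable def cconv (k h : ℝ → ℝ) (t : ℝ) : ℝ := ∫ s in (0 : ℝ)..t, k (t - s) * h s

theorem cconv_comm (k h : ℝ → ℝ) (t : ℝ) : cconv k h t = cconv h k t := by
  unfold cconv
  have := intervalIntegral.integral_comp_sub_left (a := 0) (b := t) (fun s => k (t - s) * h s) t
  simp only [sub_sub_cancel, sub_self, sub_zero] at this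
  rw [← this]
  exact intervalIntegral.integral_congr fun s _ => mul_comm _ _

/-- The semigroup property `κ_β * κ_γ = κ_{β+γ}`, which is Euler's Beta integral. -/
theorem cconv_rlKernel_rlKernel {β γ t : ℝ} (hβ : 0 < β) (hγ : 0 < γ) (ht : 0 < t) :
    cconv (rlKernel β) (rlKernel γ) t = rlKernel (γ + β) t := by
  have hc := Complex.betaIntegral_scaled (γ : ℂ) (β : ℂ) ht
  have hre : ∫ s in (0 : ℝ)..t, s ^ (γ - 1) * (t - s) ^ (β - 1) =
      t ^ (γ + β - 1) * ProbabilityTheory.beta γ β := by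
    rw [ProbabilityTheory.beta_eq_betaIntegralReal _ _ hγ hβ]
    have h1 : ∫ s in (0 : ℝ)..t, (s : ℂ) ^ ((γ : ℂ) - 1) * ((t : ℂ) - s) ^ ((β : ℂ) - 1) =
        ((∫ s in (0 : ℝ)..t, s ^ (γ - 1) * (t - s) ^ (β - 1) : ℝ) : ℂ) := by
      rw [← intervalIntegral.integral_ofReal]
      refine intervalIntegral.integral_congr fun s hs => ?_
      rw [uIcc_of_le ht.le] at hs
      have h2 : 0 ≤ t - s := by linarith [hs.2]
      simp only [Complex.ofReal_mul]
      rw [Complex.ofReal_cpow hs.1, Complex.ofReal_cpow h2]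
      push_cast; rfl
    rw [h1] at hc
    have h3 : ((t : ℂ) ^ ((γ : ℂ) + β - 1)) = ((t ^ (γ + β - 1) : ℝ) : ℂ) := by
      rw [Complex.ofReal_cpow ht.le]; push_cast; rfl
    rw [h3] at hc
    have := congrArg Complex.re hc
    simpa using this
  have hG1 := (Real.Gamma_pos_of_pos hβ).ne'
  have hG2 := (Real.Gamma_pos_of_pos hγ).ne'
  have hG3 := (Real.Gamma_pos_of_pos (add_pos hγ hβ)).ne'
  have h4 : cconv (rlKernel β) (rlKernel γ) t =
      ∫ s in (0 : ℝ)..t, (s ^ (γ - 1) * (t - s) ^ (β - 1)) * (1 / (Real.Gamma β * Real.Gamma γ)) := by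
    unfold cconv
    rw [intervalIntegral.integral_of_le ht.le, intervalIntegral.integral_of_le ht.le,
      integral_Ioc_eq_integral_Ioo, integral_Ioc_eq_integral_Ioo]
    refine setIntegral_congr_fun measurableSet_Ioo fun s hs => ?_
    have h2 : 0 < t - s := by linarith [hs.2]
    simp only [rlKernel_of_pos h2, rlKernel_of_pos hs.1]
    field_simp
  rw [h4, intervalIntegral.integral_mul_const, hre, ProbabilityTheory.beta, rlKernel_of_pos ht]
  field_simp

theorem integrableOn_rlKernel_mul {β γ t : ℝ} (hβ : 0 < β) (hγ : 0 < γ) (ht : 0 < t) :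
    IntegrableOn (fun s => rlKernel β (t - s) * rlKernel γ s) (Ioc 0 t) := by
  -- a non-integrable function would have integral zero
  by_contra h
  have h0 : cconv (rlKernel β) (rlKernel γ) t = 0 := by
    unfold cconv
    rw [intervalIntegral.integral_of_le ht.le]
    exact integral_undef h
  rw [cconv_rlKernel_rlKernel hβ hγ ht] at h0
  exact (rlKernel_pos (add_pos hγ hβ) ht).ne' h0

/-- Convolving a relaxation kernel with a Riemann–Liouville kernel adds the orders. -/
theorem cconv_rlKernel_relaxKernel {α β γ : ℝ} (hα : 0 < α) (hβ : 0 < β) (hγ : 0 < γ) (μ : ℝ)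
    {t : ℝ} (ht : 0 < t) :
    IntegrableOn (fun s => rlKernel γ (t - s) * relaxKernel α μ β s) (Ioc 0 t) ∧
    cconv (rlKernel γ) (relaxKernel α μ β) t = relaxKernel α μ (β + γ) t := by
  have hpos : ∀ n : ℕ, 0 < n * α + β := fun n => by positivity
  set F : ℕ → ℝ → ℝ := fun n s => (-μ) ^ n * (rlKernel γ (t - s) * rlKernel (n * α + β) s)
  have hFi : ∀ n, Integrable (F n) (volume.restrict (Ioc 0 t)) := fun n =>
    (integrableOn_rlKernel_mul hγ (hpos n) ht).const_mul _
  have hFv : ∀ n : ℕ, ∫ s in Ioc 0 t, rlKernel γ (t - s) * rlKernel (n * α + β) s =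
      rlKernel (n * α + (β + γ)) t := fun n => by
    rw [← add_assoc, ← cconv_rlKernel_rlKernel hγ (hpos n) ht, cconv,
      intervalIntegral.integral_of_le ht.le]
  have hFn : ∀ n : ℕ, ∫ s in Ioc 0 t, ‖F n s‖ = |μ| ^ n * rlKernel (n * α + (β + γ)) t := fun n => by
    rw [← hFv n, ← integral_const_mul]
    refine integral_congr_ae (ae_of_all _ fun s => ?_)
    simp only [F, norm_mul, norm_pow, norm_neg, Real.norm_eq_abs]
    rw [abs_of_nonneg (rlKernel_nonneg hγ _), abs_of_nonneg (rlKernel_nonneg (hpos n) _)]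
  have hsn : Summable fun n => ∫ s in Ioc 0 t, ‖F n s‖ := by
    simp_rw [hFn]
    exact summable_abs_relaxKernel hα (add_pos hβ hγ) μ t
  have htsum : ∀ s, ∑' n, F n s = rlKernel γ (t - s) * relaxKernel α μ β s := fun s => by
    rw [← ((hasSum_relaxKernel hα hβ μ s).mul_left (rlKernel γ (t - s))).tsum_eq]
    exact tsum_congr fun n => by simp only [F]; ring
  have h1 := hasSum_integral_of_summable_integral_norm hFi hsn
  simp_rw [htsum] at h1
  refine ⟨?_, ?_⟩
  · have hmeas : AEStronglyMeasurable (fun s => rlKernel γ (t - s) * relaxKernel α μ β s)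
        (volume.restrict (Ioc 0 t)) :=
      (((measurable_rlKernel γ).comp (measurable_const.sub measurable_id)).mul
        (measurable_relaxKernel hα hβ μ)).aestronglyMeasurable
    -- the majorant is the same product with `μ` replaced by `-|μ|`
    refine ⟨hmeas, ?_⟩
    have hle : ∀ s, ‖rlKernel γ (t - s) * relaxKernel α μ β s‖ₑ ≤ ∑' n, ‖F n s‖ₑ := fun s => by
      rw [← htsum s]
      exact enorm_tsum_le_tsum_enorm
    unfold HasFiniteIntegral
    calc ∫⁻ s in Ioc 0 t, ‖rlKernel γ (t - s) * relaxKernel α μ β s‖ₑ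
        ≤ ∫⁻ s in Ioc 0 t, ∑' n, ‖F n s‖ₑ := lintegral_mono hle
      _ = ∑' n, ∫⁻ s in Ioc 0 t, ‖F n s‖ₑ := lintegral_tsum fun n => (hFi n).1.enorm
      _ = ∑' n, ENNReal.ofReal (∫ s in Ioc 0 t, ‖F n s‖) := by
          refine tsum_congr fun n => ?_
          rw [ofReal_integral_norm_eq_lintegral_enorm (hFi n)]
      _ < ⊤ := by
          rw [← ENNReal.ofReal_tsum_of_nonneg (fun n => integral_nonneg fun s => norm_nonneg _) hsn]
          exact ENNReal.ofReal_lt_top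
  · unfold cconv
    rw [intervalIntegral.integral_of_le ht.le]
    refine h1.unique ?_
    refine (hasSum_relaxKernel hα (add_pos hβ hγ) μ t).congr_fun fun n => ?_
    simp only [F]
    rw [integral_const_mul, hFv]

/-! ### Positivity and bounds of the relaxation kernels -/

/-- The recursion obtained by splitting off the first term of the series. -/
theorem relaxKernel_eq_sub {α β : ℝ} (hα : 0 < α) (hβ : 0 < β) (μ t : ℝ) :
    relaxKernel α μ β t = rlKernel β t - μ * relaxKernel α μ (β + α) t := by
  have h1 := hasSum_relaxKernel hα hβ μ t
  have h2 := (hasSum_relaxKernel hα (add_pos hβ hα) μ t).mul_left (-μ)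
  rw [← h1.tsum_eq, h1.summable.tsum_eq_zero_add, sub_eq_add_neg,
    neg_mul_eq_neg_mul, ← h2.tsum_eq]
  congr 1
  · simp
  · refine tsum_congr fun n => ?_
    push_cast
    rw [show ((n + 1 : ℝ) * α + β) = n * α + (β + α) by ring]
    ring

theorem contDiffAt_relaxKernel {α β : ℝ} (hα : 0 < α) (hβ : 0 < β) (μ : ℝ) {t : ℝ} (ht : 0 < t) :
    ContDiffAt ℝ 1 (relaxKernel α μ β) t := by
  have h : ContDiffAt ℝ 1 (fun t : ℝ => t ^ (β - 1) * mittagLeffler α β (-(μ * t ^ α))) t := by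
    refine (Real.contDiffAt_rpow_const_of_ne ht.ne').mul ?_
    refine ((contDiff_mittagLeffler hα hβ).of_le (by simp)).contDiffAt.comp t ?_
    exact (contDiffAt_const.mul (Real.contDiffAt_rpow_const_of_ne ht.ne')).neg
  refine h.congr_of_eventuallyEq ?_
  filter_upwards [lt_mem_nhds ht] with s hs using relaxKernel_of_pos hs

theorem continuousAt_relaxKernel {α β : ℝ} (hα : 0 < α) (hβ : 0 < β) (μ : ℝ) {t : ℝ} (ht : 0 < t) :
    ContinuousAt (relaxKernel α μ β) t := (contDiffAt_relaxKernel hα hβ μ ht).continuousAt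

theorem integrableOn_relaxKernel {α β : ℝ} (hα : 0 < α) (hβ : 0 < β) (μ t : ℝ) :
    IntegrableOn (relaxKernel α μ β) (Ioc 0 t) := by
  rcases lt_or_ge 0 t with ht | ht
  · have h := (cconv_rlKernel_relaxKernel hα hβ one_pos μ ht).1
    rw [integrableOn_Ioc_iff_integrableOn_Ioo] at h ⊢
    refine h.congr_fun (fun s hs => ?_) measurableSet_Ioo
    have : 0 < t - s := by linarith [hs.2]
    simp [rlKernel_one this]
  · simp [Ioc_eq_empty (not_lt.2 ht)]

theorem integral_relaxKernel {α β : ℝ} (hα : 0 < α) (hβ : 0 < β) (μ : ℝ) {t : ℝ} (ht : 0 < t) :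
    ∫ s in (0 : ℝ)..t, relaxKernel α μ β s = relaxKernel α μ (β + 1) t := by
  rw [← (cconv_rlKernel_relaxKernel hα hβ one_pos μ ht).2, cconv,
    intervalIntegral.integral_of_le ht.le, intervalIntegral.integral_of_le ht.le,
    integral_Ioc_eq_integral_Ioo, integral_Ioc_eq_integral_Ioo]
  refine setIntegral_congr_fun measurableSet_Ioo fun s hs => ?_
  have : 0 < t - s := by linarith [hs.2]
  simp [rlKernel_one this]

theorem hasDerivAt_relaxKernel_add_one {α β : ℝ} (hα : 0 < α) (hβ : 0 < β) (μ : ℝ) {t : ℝ}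
    (ht : 0 < t) : HasDerivAt (relaxKernel α μ (β + 1)) (relaxKernel α μ β t) t := by
  have h := intervalIntegral.integral_hasDerivAt_right (f := relaxKernel α μ β) (a := 0) (b := t)
    ((intervalIntegrable_iff_integrableOn_Ioc_of_le ht.le).2 (integrableOn_relaxKernel hα hβ μ t))
    ((measurable_relaxKernel hα hβ μ).stronglyMeasurable.stronglyMeasurableAtFilter)
    (continuousAt_relaxKernel hα hβ μ ht)
  refine h.congr_of_eventuallyEq ?_
  filter_upwards [lt_mem_nhds ht] with s hs using (integral_relaxKernel hα hβ μ hs).symm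

section bounds

variable {α μ : ℝ}

/-- `E_{α,1}(-μ t^α) = 1 - μ t^α E_{α,α+1}(-μ t^α)`. -/
theorem relaxKernel_one_add (hα : 0 < α) (μ : ℝ) {t : ℝ} (ht : 0 < t) :
    relaxKernel α μ 1 t + μ * relaxKernel α μ (α + 1) t = 1 := by
  rw [relaxKernel_eq_sub hα one_pos, rlKernel_one ht, add_comm 1 α]; ring

theorem hasDerivAt_relaxKernel_one (hα : 0 < α) (μ : ℝ) {t : ℝ} (ht : 0 < t) :
    HasDerivAt (relaxKernel α μ 1) (-(μ * relaxKernel α μ α t)) t := by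
  have h := ((hasDerivAt_relaxKernel_add_one hα hα μ ht).const_mul μ).const_sub 1
  refine h.congr_of_eventuallyEq ?_
  filter_upwards [lt_mem_nhds ht] with s hs
  linarith [relaxKernel_one_add hα μ hs]

/-- The kernel `t^(α-1) E_{α,α}(-μ t^α)` is positive for small times. -/
theorem eventually_relaxKernel_pos (hα : 0 < α) (μ : ℝ) :
    ∀ᶠ t in 𝓝[>] (0 : ℝ), 0 < relaxKernel α μ α t := by
  have h0 : 0 < mittagLeffler α α 0 := by
    have : mittagLeffler α α 0 = 1 / Real.Gamma α := by
      unfold mittagLeffler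
      rw [tsum_eq_single 0]
      · simp
      · intro n hn; simp [hn]
    rw [this]
    exact one_div_pos.2 (Real.Gamma_pos_of_pos hα)
  have hc : ContinuousAt (fun t : ℝ => mittagLeffler α α (-(μ * t ^ α))) 0 := by
    refine (contDiff_mittagLeffler hα hα).continuous.continuousAt.comp ?_
    exact (continuousAt_const.mul (Real.continuousAt_rpow_const _ _ (Or.inr hα.le))).neg
  have hev : ∀ᶠ t in 𝓝 (0 : ℝ), 0 < mittagLeffler α α (-(μ * t ^ α)) := by
    refine hc.eventually (lt_mem_nhds ?_)
    simpa [Real.zero_rpow hα.ne'] using h0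
  filter_upwards [nhdsWithin_le_nhds hev, self_mem_nhdsWithin] with t h1 h2
  rw [relaxKernel_of_pos h2]
  exact mul_pos (Real.rpow_pos_of_pos h2 _) h1

/-- The mean value theorem for `x ↦ x^(-α)`, with the derivative bounded below on `(0, c]`. -/
theorem rpow_neg_sub_le {α a h c : ℝ} (hα : 0 < α) (ha : 0 < a) (hh : 0 ≤ h) (hc : a + h ≤ c) :
    α * c ^ (-α - 1) * h ≤ a ^ (-α) - (a + h) ^ (-α) := by
  rcases hh.eq_or_lt with rfl | hh
  · simp
  have hderiv : ∀ x ∈ Ioo a (a + h), HasDerivAt (fun x : ℝ => x ^ (-α)) (-α * x ^ (-α - 1)) x :=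
    fun x hx => Real.hasDerivAt_rpow_const (Or.inl (by linarith [hx.1]))
  obtain ⟨x, hx, hx'⟩ := exists_hasDerivAt_eq_slope (fun x : ℝ => x ^ (-α)) _
    (show a < a + h by linarith)
    (fun x hx => (Real.continuousAt_rpow_const x _ (Or.inl (by linarith [hx.1]))).continuousWithinAt)
    hderiv
  rw [eq_div_iff (by linarith)] at hx'
  have hx0 : 0 < x := by linarith [hx.1]
  have : c ^ (-α - 1) ≤ x ^ (-α - 1) :=
    Real.rpow_le_rpow_of_nonpos hx0 (by linarith [hx.2]) (by linarith)
  have h2 : α * c ^ (-α - 1) * h ≤ α * x ^ (-α - 1) * h := by gcongr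
  have h3 : α * x ^ (-α - 1) * h = -(-α * x ^ (-α - 1) * (a + h - a)) := by ring
  linarith

/-- The kernel `f(t) = t^(α-1) E_{α,α}(-μ t^α)` is nonnegative. At a first zero `t₀` the function
`e = κ_{1-α} * f` would satisfy `e(t₀ - h) - e(t₀) ≥ c h - O(h^(2-α))` with `c > 0`, since `κ_{1-α}`
is strictly decreasing and `f > 0` before `t₀`; but `e'(t₀) = -μ f(t₀) = 0`. -/
theorem relaxKernel_nonneg (hα : 0 < α) (hα1 : α < 1) (μ : ℝ) (t : ℝ) :
    0 ≤ relaxKernel α μ α t := by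
  by_contra! hneg
  set f := relaxKernel α μ α with hf
  have ht : 0 < t := by
    by_contra! h
    rw [hf, relaxKernel_of_nonpos h] at hneg
    exact lt_irrefl _ hneg
  obtain ⟨δ, hδ, hδpos⟩ : ∃ δ > 0, ∀ s, 0 < s → s < δ → 0 < f s := by
    have := eventually_relaxKernel_pos hα μ
    rw [eventually_nhdsWithin_iff, Metric.eventually_nhds_iff] at this
    obtain ⟨δ, hδ, h⟩ := this
    refine ⟨δ, hδ, fun s hs hsδ => h (y := s) ?_ hs⟩
    rwa [Real.dist_eq, sub_zero, abs_of_pos hs]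
  have hcont : ∀ s, 0 < s → ContinuousAt f s := fun s hs => continuousAt_relaxKernel hα hα μ hs
  -- the first zero
  obtain ⟨t0, ht0, hft0, hpos⟩ : ∃ t0, 0 < t0 ∧ f t0 = 0 ∧ ∀ s, 0 < s → s < t0 → 0 < f s := by
    set S := {s | s ∈ Icc δ t ∧ f s ≤ 0} with hS
    have hδt : δ ≤ t := by
      by_contra! h
      exact absurd (hδpos t ht h) (not_lt.2 hneg.le)
    have hclosed : IsClosed S := by
      have : ContinuousOn f (Icc δ t) := fun s hs =>
        (hcont s (lt_of_lt_of_le hδ hs.1)).continuousWithinAt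
      exact this.preimage_isClosed_of_isClosed isClosed_Icc isClosed_Iic
    have hcomp : IsCompact S := isCompact_Icc.of_isClosed_subset hclosed fun s hs => hs.1
    obtain ⟨t0, ht0, hmin⟩ := hcomp.exists_isLeast ⟨t, ⟨hδt, le_rfl⟩, hneg.le⟩
    have ht0pos : 0 < t0 := lt_of_lt_of_le hδ ht0.1.1
    have hpos : ∀ s, 0 < s → s < t0 → 0 < f s := by
      intro s hs hst
      by_contra! h
      rcases lt_or_ge s δ with h1 | h1
      · exact absurd (hδpos s hs h1) (not_lt.2 h)
      · exact absurd (hmin ⟨⟨h1, hst.le.trans ht0.1.2⟩, h⟩) (not_le.2 hst)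
    refine ⟨t0, ht0pos, le_antisymm ht0.2 ?_, hpos⟩
    refine ge_of_tendsto ((hcont t0 ht0pos).tendsto.mono_left nhdsWithin_le_nhds :
      Tendsto f (𝓝[<] t0) _) ?_
    filter_upwards [Ioo_mem_nhdsLT ht0pos] with s hs using (hpos s hs.1 hs.2).le
  -- `f` is Lipschitz near `t0`
  obtain ⟨M, r, hr, hM⟩ : ∃ M r : ℝ, 0 < r ∧ ∀ s, t0 - r < s → s < t0 → f s ≤ M * (t0 - s) := by
    have hd := ((contDiffAt_relaxKernel hα hα μ ht0).differentiableAt one_ne_zero).hasDerivAt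
    have := hd.isBigO_sub
    obtain ⟨M, hM⟩ := this.bound
    rw [Metric.eventually_nhds_iff] at hM
    obtain ⟨r, hr, h⟩ := hM
    refine ⟨M, r, hr, fun s h1 h2 => ?_⟩
    have h3 := h (y := s) (by rw [Real.dist_eq, abs_lt]; constructor <;> linarith)
    rw [← hf, hft0, sub_zero, Real.norm_eq_abs, Real.norm_eq_abs, abs_of_neg (sub_neg.2 h2),
      neg_sub] at h3
    exact (le_abs_self _).trans h3
  set e := relaxKernel α μ 1 with he
  set G := Real.Gamma (1 - α) with hG
  have hGpos : 0 < G := Real.Gamma_pos_of_pos (by linarith)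
  have heconv : ∀ s, 0 < s → cconv (rlKernel (1 - α)) f s = e s := fun s hs => by
    have := (cconv_rlKernel_relaxKernel hα hα (γ := 1 - α) (by linarith) μ hs).2
    rwa [add_sub_cancel] at this
  have hint : ∀ s, 0 < s → IntervalIntegrable (fun x => rlKernel (1 - α) (s - x) * f x) volume 0 s :=
    fun s hs => (intervalIntegrable_iff_integrableOn_Ioc_of_le hs.le).2
      (cconv_rlKernel_relaxKernel hα hα (γ := 1 - α) (by linarith) μ hs).1
  have hfi : ∀ s, 0 < s → IntervalIntegrable f volume 0 s := fun s hs =>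
    (intervalIntegrable_iff_integrableOn_Ioc_of_le hs.le).2 (integrableOn_relaxKernel hα hα μ s)
  set I := ∫ s in (0 : ℝ)..(t0 / 2), f s with hI
  have hIpos : 0 < I := by
    refine intervalIntegral.intervalIntegral_pos_of_pos_on (hfi _ (by linarith)) (fun s hs => ?_)
      (by linarith)
    exact hpos s hs.1 (by linarith [hs.2])
  set c := α * t0 ^ (-α - 1) / G * I with hc
  have hcpos : 0 < c := by
    have := Real.rpow_pos_of_pos ht0 (-α - 1)
    positivity
  -- split `e(t0 - h) - e(t0)` into the gain on `(0, t0 - h)`, where the kernel decreases, and the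
  -- contribution of `(t0 - h, t0)`, where `f` is small
  have hkey : ∀ h, 0 < h → h < r → h < t0 / 2 →
      c * h - M * h ^ (1 - α) / G * h ≤ e (t0 - h) - e t0 := by
    intro h hh hhr hht
    have hth : 0 < t0 - h := by linarith
    have i1 := hint t0 ht0
    have i1a : IntervalIntegrable (fun x => rlKernel (1 - α) (t0 - x) * f x) volume 0 (t0 - h) :=
      i1.mono_set (by rw [uIcc_of_le hth.le, uIcc_of_le ht0.le]; exact Icc_subset_Icc_right (by linarith))
    have i1b : IntervalIntegrable (fun x => rlKernel (1 - α) (t0 - x) * f x) volume (t0 - h) t0 :=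
      i1.mono_set (by
        rw [uIcc_of_le (by linarith), uIcc_of_le ht0.le]; exact Icc_subset_Icc_left hth.le)
    have i2 := hint (t0 - h) hth
    have hsplit : e (t0 - h) - e t0 =
        (∫ s in (0 : ℝ)..(t0 - h), (rlKernel (1 - α) (t0 - h - s) * f s -
          rlKernel (1 - α) (t0 - s) * f s)) -
        ∫ s in (t0 - h)..t0, rlKernel (1 - α) (t0 - s) * f s := by
      rw [intervalIntegral.integral_sub i2 i1a, ← heconv _ hth, ← heconv _ ht0, cconv, cconv,
        ← intervalIntegral.integral_add_adjacent_intervals i1a i1b]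
      ring
    have hpt : ∀ s, 0 < s → s < t0 - h → α * t0 ^ (-α - 1) / G * h * f s ≤
        rlKernel (1 - α) (t0 - h - s) * f s - rlKernel (1 - α) (t0 - s) * f s := by
      intro s hs hs'
      have h1 : 0 < t0 - h - s := by linarith
      have h2 : 0 < t0 - s := by linarith
      rw [rlKernel_of_pos h1, rlKernel_of_pos h2, ← sub_mul]
      refine mul_le_mul_of_nonneg_right ?_ (hpos s hs (by linarith)).le
      have := rpow_neg_sub_le hα h1 hh.le (c := t0) (by linarith)
      rw [show t0 - h - s + h = t0 - s by ring] at this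
      rw [show 1 - α - 1 = -α by ring, ← sub_div, div_mul_eq_mul_div]
      gcongr
    have hA : c * h ≤ ∫ s in (0 : ℝ)..(t0 - h), (rlKernel (1 - α) (t0 - h - s) * f s -
          rlKernel (1 - α) (t0 - s) * f s) := by
      have hm : c * h = ∫ s in (0 : ℝ)..(t0 / 2), α * t0 ^ (-α - 1) / G * h * f s := by
        rw [intervalIntegral.integral_const_mul, hc]; ring
      have hmono : ∫ s in (0 : ℝ)..(t0 / 2), α * t0 ^ (-α - 1) / G * h * f s ≤
          ∫ s in (0 : ℝ)..(t0 - h), α * t0 ^ (-α - 1) / G * h * f s := by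
        refine intervalIntegral.integral_mono_interval le_rfl (by linarith) (by linarith) ?_
          ((hfi _ hth).const_mul _)
        filter_upwards [ae_restrict_mem measurableSet_Ioc] with s hs
        have h1 := Real.rpow_pos_of_pos ht0 (-α - 1)
        have h2 := hpos s hs.1 (by linarith [hs.2])
        simp only [Pi.zero_apply]
        positivity
      rw [hm]
      refine hmono.trans ?_
      refine intervalIntegral.integral_mono_on_of_le_Ioo hth.le ((hfi _ hth).const_mul _)
        (i2.sub i1a) fun s hs => hpt s hs.1 hs.2
    have hB : ∫ s in (t0 - h)..t0, rlKernel (1 - α) (t0 - s) * f s ≤ M * h ^ (1 - α) / G * h := by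
      have hle : ∫ s in (t0 - h)..t0, rlKernel (1 - α) (t0 - s) * f s ≤
          ∫ s in (t0 - h)..t0, M * h ^ (1 - α) / G := by
        refine intervalIntegral.integral_mono_on_of_le_Ioo (by linarith) i1b (by simp) ?_
        intro s hs
        have h1 : 0 < t0 - s := by linarith [hs.2]
        have h2 : f s ≤ M * (t0 - s) := hM s (by linarith [hs.1]) hs.2
        have h3 := hpos s (by linarith [hs.1]) hs.2
        have hM0 : 0 ≤ M := by
          by_contra! hneg'
          nlinarith
        rw [rlKernel_of_pos h1, show 1 - α - 1 = -α by ring]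
        have h4 : (t0 - s) ^ (-α) * (t0 - s) = (t0 - s) ^ (1 - α) := by
          rw [← Real.rpow_add_one h1.ne']; congr 1; ring
        have h5 : (t0 - s) ^ (1 - α) ≤ h ^ (1 - α) :=
          Real.rpow_le_rpow h1.le (by linarith [hs.1]) (by linarith)
        calc (t0 - s) ^ (-α) / G * f s ≤ (t0 - s) ^ (-α) / G * (M * (t0 - s)) := by gcongr
          _ = M * (t0 - s) ^ (1 - α) / G := by rw [← h4]; ring
          _ ≤ _ := by gcongr
      refine hle.trans (le_of_eq ?_)
      rw [intervalIntegral.integral_const, smul_eq_mul]; ring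
    rw [hsplit]
    linarith
  -- the left difference quotients of `e` at `t0` tend to `0`
  have hder : HasDerivAt e 0 t0 := by
    have := hasDerivAt_relaxKernel_one hα μ ht0
    rwa [← hf, hft0, mul_zero, neg_zero] at this
  have hcomp : HasDerivAt (fun h => e (t0 - h)) 0 0 := by
    have h1 : HasDerivAt (fun h : ℝ => t0 - h) (-1) 0 := by
      simpa using (hasDerivAt_id (0 : ℝ)).const_sub t0
    have h2 : HasDerivAt e 0 (t0 - 0) := by simpa using hder
    have h3 := h2.scomp (0 : ℝ) h1
    rw [smul_zero] at h3
    exact h3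
  have hlim : Tendsto (fun h : ℝ => h⁻¹ * (e (t0 - h) - e t0)) (𝓝[>] 0) (𝓝 0) := by
    have := hcomp.tendsto_slope_zero_right
    simpa using this
  have hlim2 : Tendsto (fun h : ℝ => c - M * h ^ (1 - α) / G) (𝓝[>] 0) (𝓝 c) := by
    have h1 : ContinuousAt (fun h : ℝ => c - M * h ^ (1 - α) / G) 0 :=
      continuousAt_const.sub ((continuousAt_const.mul
        (Real.continuousAt_rpow_const _ _ (Or.inr (by linarith)))).div_const _)
    have h2 := h1.tendsto
    simp only [Real.zero_rpow (show 1 - α ≠ 0 by linarith), mul_zero, zero_div, sub_zero] at h2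
    exact h2.mono_left nhdsWithin_le_nhds
  have hle : c ≤ 0 := by
    refine le_of_tendsto_of_tendsto hlim2 hlim ?_
    have hb : 0 < min r (t0 / 2) := lt_min hr (by linarith)
    filter_upwards [Ioo_mem_nhdsGT hb] with h hh
    have := hkey h hh.1 (hh.2.trans_le (min_le_left _ _)) (hh.2.trans_le (min_le_right _ _))
    have hh0 := hh.1
    rw [inv_mul_eq_div, le_div_iff₀ hh0]
    linarith
  exact absurd hcpos (not_lt.2 hle)

/-- Kernels of higher order are convolutions `κ_γ * f` of nonnegative functions. -/
theorem relaxKernel_add_nonneg (hα : 0 < α) (hα1 : α < 1) (μ : ℝ) {γ : ℝ} (hγ : 0 < γ) (t : ℝ) :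
    0 ≤ relaxKernel α μ (α + γ) t := by
  rcases lt_or_ge 0 t with ht | ht
  · rw [← (cconv_rlKernel_relaxKernel hα hα hγ μ ht).2, cconv]
    exact intervalIntegral.integral_nonneg ht.le fun s _ =>
      mul_nonneg (rlKernel_nonneg hγ _) (relaxKernel_nonneg hα hα1 μ s)
  · rw [relaxKernel_of_nonpos ht]

theorem relaxKernel_one_nonneg (hα : 0 < α) (hα1 : α < 1) (μ t : ℝ) :
    0 ≤ relaxKernel α μ 1 t := by
  have := relaxKernel_add_nonneg hα hα1 μ (sub_pos.2 hα1) t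
  rwa [add_sub_cancel] at this

theorem relaxKernel_le_rlKernel (hα : 0 < α) (hα1 : α < 1) (hμ : 0 ≤ μ) (t : ℝ) :
    relaxKernel α μ α t ≤ rlKernel α t := by
  rw [relaxKernel_eq_sub hα hα]
  have := relaxKernel_add_nonneg hα hα1 μ hα t
  nlinarith

theorem relaxKernel_add_one_le (hα : 0 < α) (hα1 : α < 1) (hμ : 0 ≤ μ) (t : ℝ) :
    relaxKernel α μ (α + 1) t ≤ rlKernel (α + 1) t := by
  rw [relaxKernel_eq_sub hα (by linarith), add_assoc]
  have := relaxKernel_add_nonneg hα hα1 μ (γ := 1 + α) (by linarith) t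
  nlinarith

theorem mul_relaxKernel_add_one_le (hα : 0 < α) (hα1 : α < 1) (μ t : ℝ) :
    μ * relaxKernel α μ (α + 1) t ≤ 1 := by
  rcases lt_or_ge 0 t with ht | ht
  · have := relaxKernel_one_add hα μ ht
    linarith [relaxKernel_one_nonneg hα hα1 μ t]
  · rw [relaxKernel_of_nonpos ht]; simp

theorem relaxKernel_one_le (hα : 0 < α) (hα1 : α < 1) (hμ : 0 ≤ μ) (t : ℝ) :
    relaxKernel α μ 1 t ≤ 1 := by
  rcases lt_or_ge 0 t with ht | ht
  · have := relaxKernel_one_add hα μ ht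
    nlinarith [relaxKernel_add_nonneg hα hα1 μ one_pos t]
  · rw [relaxKernel_of_nonpos ht]; simp

theorem relaxKernel_one_antitone (hα : 0 < α) (hα1 : α < 1) (hμ : 0 ≤ μ) {s t : ℝ} (hs : 0 < s)
    (hst : s ≤ t) : relaxKernel α μ 1 t ≤ relaxKernel α μ 1 s := by
  have hanti : AntitoneOn (relaxKernel α μ 1) (Ioi 0) := by
    refine antitoneOn_of_deriv_nonpos (convex_Ioi 0)
      (fun x hx => (hasDerivAt_relaxKernel_one hα μ hx).continuousAt.continuousWithinAt) ?_ ?_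
    · intro x hx
      rw [interior_Ioi] at hx
      exact (hasDerivAt_relaxKernel_one hα μ hx).differentiableAt.differentiableWithinAt
    · intro x hx
      rw [interior_Ioi] at hx
      rw [(hasDerivAt_relaxKernel_one hα μ hx).deriv]
      have := relaxKernel_nonneg hα hα1 μ x
      nlinarith
  exact hanti hs (lt_of_lt_of_le hs hst) hst

/-- `E_{α,1}(-μ t^α) (1 + μ t^α / Γ(α+1)) ≤ 1`, in the form in which it is used: convolve the
decreasing function `e` with `κ_α` in `e + μ κ_α * e = 1`. -/
theorem mul_relaxKernel_one_le (hα : 0 < α) (hα1 : α < 1) (hμ : 0 ≤ μ) {t : ℝ} (ht : 0 < t) :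
    μ * relaxKernel α μ 1 t * rlKernel (α + 1) t ≤ 1 := by
  have hc := cconv_rlKernel_relaxKernel hα one_pos hα μ ht
  have hk := cconv_rlKernel_rlKernel hα one_pos ht
  have hle : relaxKernel α μ 1 t * rlKernel (α + 1) t ≤ relaxKernel α μ (α + 1) t := by
    rw [add_comm α 1, ← hc.2, add_comm 1 α]
    rw [add_comm] at hk
    rw [← hk, cconv, cconv, ← intervalIntegral.integral_const_mul]
    refine intervalIntegral.integral_mono_on_of_le_Ioo ht.le ?_ ?_ ?_
    · exact ((intervalIntegrable_iff_integrableOn_Ioc_of_le ht.le).2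
        (integrableOn_rlKernel_mul hα one_pos ht)).const_mul _
    · exact (intervalIntegrable_iff_integrableOn_Ioc_of_le ht.le).2 hc.1
    · intro s hs
      rw [rlKernel_one hs.1, mul_one, mul_comm]
      exact mul_le_mul_of_nonneg_left (relaxKernel_one_antitone hα hα1 hμ hs.1 hs.2.le)
        (rlKernel_nonneg hα _)
  have h2 := mul_relaxKernel_add_one_le hα hα1 μ t
  nlinarith

/-- `t f(t) ≤ α / μ` for `f(t) = t^(α-1) E_{α,α}(-μ t^α)`: the function `y(t) = t f(t)` solves
`y + μ κ_α * y = α g` with `g = ∫₀ᵗ f ≤ 1 / μ`, and `κ_α * y` is nonnegative. -/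
theorem mul_mul_relaxKernel_le (hα : 0 < α) (hα1 : α < 1) (hμ : 0 ≤ μ) {t : ℝ} (ht : 0 < t) :
    μ * (t * relaxKernel α μ α t) ≤ α := by
  set f := relaxKernel α μ α with hf
  have c1 := cconv_rlKernel_relaxKernel hα hα hα μ ht
  have c2 := cconv_rlKernel_relaxKernel hα hα (γ := α + 1) (by linarith) μ ht
  have i1 := (intervalIntegrable_iff_integrableOn_Ioc_of_le ht.le).2 c1.1
  have i2 := (intervalIntegrable_iff_integrableOn_Ioc_of_le ht.le).2 c2.1
  have hconv : ∫ s in (0 : ℝ)..t, rlKernel α (t - s) * (s * f s) =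
      t * relaxKernel α μ (α + α) t - α * relaxKernel α μ (α + (α + 1)) t := by
    rw [← c1.2, ← c2.2, cconv, cconv, ← intervalIntegral.integral_const_mul,
      ← intervalIntegral.integral_const_mul, ← intervalIntegral.integral_sub (i1.const_mul _)
        (i2.const_mul _)]
    refine intervalIntegral.integral_congr fun s _ => ?_
    have := mul_rlKernel hα (t - s)
    linear_combination (- f s) * this
  have hnn : 0 ≤ ∫ s in (0 : ℝ)..t, rlKernel α (t - s) * (s * f s) :=
    intervalIntegral.integral_nonneg ht.le fun s hs => mul_nonneg (rlKernel_nonneg hα _)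
      (mul_nonneg hs.1 (relaxKernel_nonneg hα hα1 μ s))
  have e1 := relaxKernel_eq_sub hα hα μ t
  have e2 := relaxKernel_eq_sub hα (show 0 < α + 1 by linarith) μ t
  rw [show α + 1 + α = α + (α + 1) by ring] at e2
  have e3 := mul_rlKernel hα t
  have hid : t * f t + μ * (∫ s in (0 : ℝ)..t, rlKernel α (t - s) * (s * f s)) =
      α * relaxKernel α μ (α + 1) t := by
    rw [hconv]
    linear_combination t * e1 - α * e2 + e3
  have h4 := mul_relaxKernel_add_one_le hα hα1 μ t
  have h5 : t * f t ≤ α * relaxKernel α μ (α + 1) t := by nlinarith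
  calc μ * (t * f t) ≤ μ * (α * relaxKernel α μ (α + 1) t) := by gcongr
    _ = α * (μ * relaxKernel α μ (α + 1) t) := by ring
    _ ≤ α * 1 := by gcongr
    _ = α := mul_one _

end bounds

/-! ### Associativity of the convolution on `(0, T)` -/

section assoc

open scoped Convolution

theorem convolution_eq_cconv {h k H K : ℝ → ℝ} {t : ℝ} (ht : 0 ≤ t)
    (hH : ∀ s ∈ Ioo 0 t, H s = h s) (hK : ∀ s ∈ Ioo 0 t, K s = k s)
    (hH0 : ∀ s ≤ 0, H s = 0) (hK0 : ∀ s ≤ 0, K s = 0) :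
    (H ⋆[ContinuousLinearMap.mul ℝ ℝ, volume] K) t = cconv k h t := by
  rw [cconv, intervalIntegral.integral_of_le ht, integral_Ioc_eq_integral_Ioo,
    ← integral_indicator measurableSet_Ioo, convolution]
  refine integral_congr_ae (ae_of_all _ fun s => ?_)
  simp only [ContinuousLinearMap.mul_apply']
  by_cases hs : s ∈ Ioo 0 t
  · rw [indicator_of_mem hs, hH s hs, hK (t - s) ⟨by linarith [hs.2], by linarith [hs.1]⟩, mul_comm]
  · rw [indicator_of_notMem hs]
    rcases le_or_gt s 0 with h0 | h0
    · rw [hH0 s h0, zero_mul]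
    · have : t ≤ s := by
        by_contra! h1
        exact hs ⟨h0, h1⟩
      rw [hK0 (t - s) (by linarith), mul_zero]

theorem convolution_eq_zero {H K : ℝ → ℝ} {t : ℝ} (ht : t ≤ 0)
    (hH0 : ∀ s ≤ 0, H s = 0) (hK0 : ∀ s ≤ 0, K s = 0) :
    (H ⋆[ContinuousLinearMap.mul ℝ ℝ, volume] K) t = 0 := by
  rw [convolution]
  refine integral_eq_zero_of_ae (ae_of_all _ fun s => ?_)
  simp only [ContinuousLinearMap.mul_apply', Pi.zero_apply]
  rcases le_or_gt s 0 with h0 | h0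
  · rw [hH0 s h0, zero_mul]
  · rw [hK0 (t - s) (by linarith), mul_zero]

theorem indicator_Ioo_of_nonpos {E : Type*} [Zero E] (T : ℝ) (h : ℝ → E) :
    ∀ s ≤ 0, (Ioo 0 T).indicator h s = 0 :=
  fun _ hs => indicator_of_notMem (fun hs' => absurd hs'.1 (not_lt.2 hs)) _

theorem indicator_Ioo_of_mem {E : Type*} [Zero E] {T t : ℝ} (ht : t ≤ T) (h : ℝ → E) :
    ∀ s ∈ Ioo 0 t, (Ioo 0 T).indicator h s = h s :=
  fun s hs => indicator_of_mem (show s ∈ Ioo 0 T from ⟨hs.1, hs.2.trans_le ht⟩) h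

/-- Associativity of `cconv`, from that of the convolution on `ℝ` after extending all functions by zero
outside `(0, T)`. -/
theorem cconv_assoc_of_convolutionExistsAt {T t : ℝ} (ht : t ∈ Ioc 0 T) {k₁ k₂ h : ℝ → ℝ}
    (hk₁ : IntegrableOn k₁ (Ioo 0 T)) (hk₂ : IntegrableOn k₂ (Ioo 0 T))
    (hh : IntegrableOn h (Ioo 0 T))
    (hex : ConvolutionExistsAt (fun s => ‖(Ioo 0 T).indicator h s‖)
      ((fun s => ‖(Ioo 0 T).indicator k₂ s‖) ⋆[ContinuousLinearMap.mul ℝ ℝ, volume]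
        fun s => ‖(Ioo 0 T).indicator k₁ s‖) t (ContinuousLinearMap.mul ℝ ℝ)) :
    cconv k₁ (cconv k₂ h) t = cconv (cconv k₁ k₂) h t := by
  have i1 := hk₁.integrable_indicator measurableSet_Ioo
  have i2 := hk₂.integrable_indicator measurableSet_Ioo
  have ih := hh.integrable_indicator measurableSet_Ioo
  have key := convolution_assoc (ContinuousLinearMap.mul ℝ ℝ) (ContinuousLinearMap.mul ℝ ℝ)
    (ContinuousLinearMap.mul ℝ ℝ) (ContinuousLinearMap.mul ℝ ℝ) (fun x y z => by simp [mul_assoc])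
    ih.1 i2.1 i1.1 (ih.ae_convolution_exists _ i2) (i2.norm.ae_convolution_exists _ i1.norm) hex
  rw [← convolution_eq_cconv ht.1.le (k := k₁) (h := cconv k₂ h)
      (H := (Ioo 0 T).indicator h ⋆[ContinuousLinearMap.mul ℝ ℝ, volume] (Ioo 0 T).indicator k₂)
      (K := (Ioo 0 T).indicator k₁), key]
  · refine convolution_eq_cconv ht.1.le (indicator_Ioo_of_mem ht.2 h) ?_
      (indicator_Ioo_of_nonpos T h) ?_
    · intro s hs
      exact convolution_eq_cconv hs.1.le (indicator_Ioo_of_mem (hs.2.le.trans ht.2) _)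
        (indicator_Ioo_of_mem (hs.2.le.trans ht.2) _) (indicator_Ioo_of_nonpos T _)
        (indicator_Ioo_of_nonpos T _)
    · intro s hs
      exact convolution_eq_zero hs (indicator_Ioo_of_nonpos T _) (indicator_Ioo_of_nonpos T _)
  · intro s hs
    exact convolution_eq_cconv hs.1.le (indicator_Ioo_of_mem (hs.2.le.trans ht.2) _)
      (indicator_Ioo_of_mem (hs.2.le.trans ht.2) _) (indicator_Ioo_of_nonpos T _)
      (indicator_Ioo_of_nonpos T _)
  · exact indicator_Ioo_of_mem ht.2 _
  · intro s hs
    exact convolution_eq_zero hs (indicator_Ioo_of_nonpos T _) (indicator_Ioo_of_nonpos T _)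
  · exact indicator_Ioo_of_nonpos T _

theorem ae_cconv_assoc {T : ℝ} {k₁ k₂ h : ℝ → ℝ}
    (hk₁ : IntegrableOn k₁ (Ioo 0 T)) (hk₂ : IntegrableOn k₂ (Ioo 0 T))
    (hh : IntegrableOn h (Ioo 0 T)) :
    ∀ᵐ t ∂(volume.restrict (Ioo 0 T)), cconv k₁ (cconv k₂ h) t = cconv (cconv k₁ k₂) h t := by
  have i1 := hk₁.integrable_indicator measurableSet_Ioo
  have i2 := hk₂.integrable_indicator measurableSet_Ioo
  have ih := hh.integrable_indicator measurableSet_Ioo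
  have := ih.norm.ae_convolution_exists (ContinuousLinearMap.mul ℝ ℝ)
    (i2.norm.integrable_convolution (ContinuousLinearMap.mul ℝ ℝ) i1.norm)
  filter_upwards [ae_restrict_of_ae this, ae_restrict_mem measurableSet_Ioo] with t h1 h2
  exact cconv_assoc_of_convolutionExistsAt ⟨h2.1, h2.2.le⟩ hk₁ hk₂ hh h1

/-- Associativity at every time, not only almost every time, when one of the two kernels is bounded. -/
theorem cconv_assoc_of_bounded {T t B : ℝ} (ht : t ∈ Ioc 0 T) {k₁ k₂ h : ℝ → ℝ}
    (hk₁ : IntegrableOn k₁ (Ioo 0 T)) (hk₂ : IntegrableOn k₂ (Ioo 0 T))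
    (hh : IntegrableOn h (Ioo 0 T))
    (hB : (∀ s ∈ Ioo 0 T, |k₁ s| ≤ B) ∨ (∀ s ∈ Ioo 0 T, |k₂ s| ≤ B)) :
    cconv k₁ (cconv k₂ h) t = cconv (cconv k₁ k₂) h t := by
  refine cconv_assoc_of_convolutionExistsAt ht hk₁ hk₂ hh ?_
  have i1 := (hk₁.integrable_indicator measurableSet_Ioo).norm
  have i2 := (hk₂.integrable_indicator measurableSet_Ioo).norm
  have ih := (hh.integrable_indicator measurableSet_Ioo).norm
  have hT : 0 < T := ht.1.trans_le ht.2
  have hB0 : 0 ≤ B := by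
    have hmem : T / 2 ∈ Ioo 0 T := ⟨by linarith, by linarith⟩
    rcases hB with hB | hB <;> exact (abs_nonneg _).trans (hB _ hmem)
  have hind : ∀ k : ℝ → ℝ, (∀ s ∈ Ioo 0 T, |k s| ≤ B) → ∀ s, ‖(Ioo 0 T).indicator k s‖ ≤ B := by
    intro k hk s
    by_cases hs : s ∈ Ioo 0 T
    · rw [indicator_of_mem hs]; exact hk s hs
    · rw [indicator_of_notMem hs, norm_zero]; exact hB0
  set W := (fun s => ‖(Ioo 0 T).indicator k₂ s‖) ⋆[ContinuousLinearMap.mul ℝ ℝ, volume]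
        (fun s => ‖(Ioo 0 T).indicator k₁ s‖) with hW
  have hWm := (i2.integrable_convolution (ContinuousLinearMap.mul ℝ ℝ) i1).1
  obtain ⟨D, hD⟩ : ∃ D, ∀ x, ‖W x‖ ≤ D := by
    rcases hB with hB | hB
    · refine ⟨∫ s, ‖(Ioo 0 T).indicator k₂ s‖ * B, fun x => ?_⟩
      refine norm_integral_le_of_norm_le (i2.mul_const B) (ae_of_all _ fun s => ?_)
      simp only [ContinuousLinearMap.mul_apply', norm_mul, norm_norm]
      gcongr
      exact hind _ hB _
    · refine ⟨∫ s, B * ‖(Ioo 0 T).indicator k₁ s‖, fun x => ?_⟩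
      rw [← integral_sub_left_eq_self _ _ x]
      refine norm_integral_le_of_norm_le ((i1.comp_sub_left x).const_mul B) (ae_of_all _ fun s => ?_)
      simp only [ContinuousLinearMap.mul_apply', norm_mul, norm_norm]
      gcongr
      exact hind _ hB _
  unfold ConvolutionExistsAt
  simp only [ContinuousLinearMap.mul_apply']
  refine ih.mul_bdd (c := D) ?_ (ae_of_all _ fun s => hD _)
  exact hWm.comp_quasiMeasurePreserving
    (quasiMeasurePreserving_sub_left_of_right_invariant volume t)

end assoc

theorem cconv_congr {k k' h h' : ℝ → ℝ} {T t : ℝ} (ht : t ∈ Icc 0 T)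
    (hk : ∀ s ∈ Ioo 0 T, k s = k' s) (hh : h =ᵐ[volume.restrict (Ioo 0 T)] h') :
    cconv k h t = cconv k' h' t := by
  rw [cconv, cconv, intervalIntegral.integral_of_le ht.1, intervalIntegral.integral_of_le ht.1,
    integral_Ioc_eq_integral_Ioo, integral_Ioc_eq_integral_Ioo]
  refine integral_congr_ae ?_
  have h1 := ae_restrict_of_ae_restrict_of_subset (Ioo_subset_Ioo_right ht.2) hh
  filter_upwards [h1, ae_restrict_mem measurableSet_Ioo] with s h2 hs
  rw [h2, hk (t - s) ⟨by linarith [hs.2], by linarith [hs.1, ht.2]⟩]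

/-! ### The space `W^{1,1}(0,T;X)` -/

section weakderiv

variable {X : Type*} [NormedAddCommGroup X] [NormedSpace ℝ X] {T : ℝ}

theorem continuousOn_primitive {g' : ℝ → X} (hg' : IntegrableOn g' (Ioo 0 T)) :
    ContinuousOn (fun t => ∫ s in (0 : ℝ)..t, g' s) (Icc 0 T) := by
  rcases le_or_gt 0 T with hT | hT
  · have := intervalIntegral.continuousOn_primitive_interval' (a := (0 : ℝ)) (b₁ := 0) (b₂ := T)
      ((intervalIntegrable_iff_integrableOn_Ioo_of_le hT).2 hg') left_mem_uIcc
    rwa [uIcc_of_le hT] at this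
  · simp [Icc_eq_empty (not_le.2 hT)]

theorem integrableOn_primitive {g' : ℝ → X} (hg' : IntegrableOn g' (Ioo 0 T)) :
    IntegrableOn (fun t => ∫ s in (0 : ℝ)..t, g' s) (Ioo 0 T) :=
  ((continuousOn_primitive hg').integrableOn_compact isCompact_Icc).mono_set Ioo_subset_Icc_self

variable [CompleteSpace X]

/-- Integration by parts for the primitive of an integrable function against a test function. -/
theorem integral_deriv_smul_primitive {g' : ℝ → X} (hg' : IntegrableOn g' (Ioo 0 T))
    {ψ : ℝ → ℝ} (hψ : ContDiff ℝ ∞ ψ) (hc : HasCompactSupport ψ) (hs : tsupport ψ ⊆ Ioo 0 T) :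
    ∫ t in Ioo 0 T, deriv ψ t • (∫ s in (0 : ℝ)..t, g' s) = - ∫ t in Ioo 0 T, ψ t • g' t := by
  rcases le_or_gt T 0 with hT | hT
  · simp [Ioo_eq_empty (not_lt.2 hT)]
  have hψ' : Continuous (deriv ψ) := hψ.continuous_deriv (by simp)
  have hdi : Integrable (deriv ψ) (volume.restrict (Ioo 0 T)) :=
    (hψ'.integrable_of_hasCompactSupport hc.deriv).integrableOn
  set D : Set (ℝ × ℝ) := {p | p.2 < p.1} with hD
  have hDm : MeasurableSet D := measurableSet_lt measurable_snd measurable_fst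
  have hint : Integrable (Function.uncurry fun t s => D.indicator
      (fun p : ℝ × ℝ => deriv ψ p.1 • g' p.2) (t, s))
      ((volume.restrict (Ioo 0 T)).prod (volume.restrict (Ioo 0 T))) :=
    (Integrable.smul_prod hdi hg').indicator hDm
  have hswap := integral_integral_swap hint
  have hL : ∀ t ∈ Ioo 0 T, ∫ s in Ioo 0 T, D.indicator (fun p : ℝ × ℝ => deriv ψ p.1 • g' p.2) (t, s) =
      deriv ψ t • (∫ s in (0 : ℝ)..t, g' s) := by
    intro t ht
    rw [intervalIntegral.integral_of_le ht.1.le, integral_Ioc_eq_integral_Ioo, ← integral_smul]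
    have : ∀ s, D.indicator (fun p : ℝ × ℝ => deriv ψ p.1 • g' p.2) (t, s) =
        (Iio t).indicator (fun s => deriv ψ t • g' s) s := fun s => by
      by_cases h : s < t <;> simp [D, h]
    simp_rw [this]
    rw [integral_indicator measurableSet_Iio, Measure.restrict_restrict measurableSet_Iio]
    congr 2
    ext s; simp only [mem_inter_iff, mem_Iio, mem_Ioo]
    constructor
    · rintro ⟨h1, h2, h3⟩; exact ⟨h2, h1⟩
    · rintro ⟨h1, h2⟩; exact ⟨h2, h1, h2.trans ht.2⟩
  have hψT : ψ T = 0 := by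
    refine image_eq_zero_of_notMem_tsupport fun h => ?_
    exact lt_irrefl _ (hs h).2
  have hR : ∀ s ∈ Ioo 0 T, ∫ t in Ioo 0 T, D.indicator (fun p : ℝ × ℝ => deriv ψ p.1 • g' p.2) (t, s) =
      -(ψ s • g' s) := by
    intro s hs'
    have h1 : ∀ t, D.indicator (fun p : ℝ × ℝ => deriv ψ p.1 • g' p.2) (t, s) =
        (Ioi s).indicator (fun t => deriv ψ t • g' s) t := fun t => by
      by_cases h : s < t <;> simp [D, h]
    simp_rw [h1]
    rw [integral_indicator measurableSet_Ioi, Measure.restrict_restrict measurableSet_Ioi]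
    have h2 : Ioi s ∩ Ioo 0 T = Ioo s T := by
      ext t; simp only [mem_inter_iff, mem_Ioi, mem_Ioo]
      constructor
      · rintro ⟨h1, h2, h3⟩; exact ⟨h1, h3⟩
      · rintro ⟨h1, h2⟩; exact ⟨h1, hs'.1.trans h1, h2⟩
    rw [h2, integral_smul_const, ← integral_Ioc_eq_integral_Ioo,
      ← intervalIntegral.integral_of_le hs'.2.le,
      intervalIntegral.integral_deriv_eq_sub (fun x _ => (hψ.differentiable (by simp)) x)
        (hψ'.intervalIntegrable _ _), hψT, zero_sub, neg_smul]
  rw [← integral_neg, ← setIntegral_congr_fun measurableSet_Ioo hL,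
    ← setIntegral_congr_fun measurableSet_Ioo hR]
  exact hswap

theorem isW11_of_ae_eq_primitive {g g' : ℝ → X} {c : X} (hg' : IntegrableOn g' (Ioo 0 T))
    (h : g =ᵐ[volume.restrict (Ioo 0 T)] fun t => c + ∫ s in (0 : ℝ)..t, g' s) : IsW11 T g g' := by
  have hp := integrableOn_primitive hg'
  have hconst : IntegrableOn (fun _ : ℝ => c) (Ioo 0 T) := integrableOn_const (by simp)
  refine ⟨(hconst.add hp).congr h.symm, hg', fun ψ hψ hc hs => ?_⟩
  have hψ' : Continuous (deriv ψ) := hψ.continuous_deriv (by simp)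
  have h1 : ∫ t in Ioo 0 T, deriv ψ t • g t =
      ∫ t in Ioo 0 T, (deriv ψ t • c + deriv ψ t • ∫ s in (0 : ℝ)..t, g' s) := by
    refine integral_congr_ae ?_
    filter_upwards [h] with t ht
    rw [ht, smul_add]
  have hdi : Integrable (deriv ψ) := hψ'.integrable_of_hasCompactSupport hc.deriv
  obtain ⟨B, hB⟩ := hψ'.bounded_above_of_compact_support hc.deriv
  have i2 : Integrable (fun t => deriv ψ t • ∫ s in (0 : ℝ)..t, g' s) (volume.restrict (Ioo 0 T)) :=
    hp.bdd_smul B hψ'.aestronglyMeasurable (ae_of_all _ hB)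
  have hzero : ∫ t in Ioo 0 T, deriv ψ t = 0 := by
    rcases le_or_gt T 0 with hT | hT
    · simp [Ioo_eq_empty (not_lt.2 hT)]
    rw [← integral_Ioc_eq_integral_Ioo, ← intervalIntegral.integral_of_le hT.le,
      intervalIntegral.integral_deriv_eq_sub (fun x _ => (hψ.differentiable (by simp)) x)
        (hψ'.intervalIntegrable _ _),
      image_eq_zero_of_notMem_tsupport (fun h => lt_irrefl _ (hs h).2),
      image_eq_zero_of_notMem_tsupport (fun h => lt_irrefl _ (hs h).1), sub_zero]
  rw [h1, integral_add (hdi.integrableOn.smul_const c) i2, integral_smul_const, hzero, zero_smul,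
    zero_add]
  exact integral_deriv_smul_primitive hg' hψ hc hs

/-- A smooth function with mean zero and compact support in `(0,T)` is the derivative of a test
function. -/
theorem exists_test_primitive {ζ : ℝ → ℝ} (hζ : ContDiff ℝ ∞ ζ) (hc : HasCompactSupport ζ)
    (hs : tsupport ζ ⊆ Ioo 0 T) (h0 : ∫ t, ζ t = 0) :
    ∃ ψ : ℝ → ℝ, ContDiff ℝ ∞ ψ ∧ HasCompactSupport ψ ∧ tsupport ψ ⊆ Ioo 0 T ∧ deriv ψ = ζ := by
  rcases (tsupport ζ).eq_empty_or_nonempty with he | hne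
  · refine ⟨ζ, hζ, hc, hs, ?_⟩
    rw [tsupport_eq_empty_iff.1 he]; funext t; simp
  have hcomp : IsCompact (tsupport ζ) := hc
  obtain ⟨a, ha, hamin⟩ := hcomp.exists_isLeast hne
  obtain ⟨b, hb, hbmax⟩ := hcomp.exists_isGreatest hne
  have hz : ∀ t, t ∉ Icc a b → ζ t = 0 := fun t ht =>
    image_eq_zero_of_notMem_tsupport fun h => ht ⟨hamin h, hbmax h⟩
  have hcont := hζ.continuous
  set ψ : ℝ → ℝ := fun t => ∫ s in a..t, ζ s with hψ
  have hd : ∀ t, HasDerivAt ψ (ζ t) t := fun t =>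
    intervalIntegral.integral_hasDerivAt_right (hcont.intervalIntegrable _ _)
      hcont.stronglyMeasurable.stronglyMeasurableAtFilter hcont.continuousAt
  have hderiv : deriv ψ = ζ := funext fun t => (hd t).deriv
  have hsupp : ∀ t, t ∉ Icc a b → ψ t = 0 := by
    intro t ht
    rcases lt_or_ge t a with h1 | h1
    · simp only [hψ]
      rw [intervalIntegral.integral_of_ge h1.le, integral_Ioc_eq_integral_Ioo,
        setIntegral_eq_zero_of_forall_eq_zero, neg_zero]
      intro s hs'
      exact hz s fun h => absurd h.1 (not_le.2 hs'.2)
    · have h2 : b < t := by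
        by_contra! h2
        exact ht ⟨h1, h2⟩
      have : ψ t = ∫ s, ζ s := by
        simp only [hψ]
        rw [intervalIntegral.integral_of_le h1, ← integral_Icc_eq_integral_Ioc]
        refine setIntegral_eq_integral_of_forall_compl_eq_zero fun s hs' => ?_
        exact hz s fun h => hs' ⟨h.1, h.2.trans h2.le⟩
      rw [this, h0]
  have hts : tsupport ψ ⊆ Icc a b := by
    refine closure_minimal (fun t ht => ?_) isClosed_Icc
    by_contra h
    exact ht (hsupp t h)
  refine ⟨ψ, ?_, ?_, ?_, hderiv⟩
  · rw [contDiff_infty_iff_deriv]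
    exact ⟨fun t => (hd t).differentiableAt, by rw [hderiv]; exact hζ⟩
  · exact isCompact_Icc.of_isClosed_subset (isClosed_tsupport _) hts
  · exact hts.trans fun t ht => ⟨(hs ha).1.trans_le ht.1, ht.2.trans_lt (hs hb).2⟩

/-- A function in `W^{1,1}(0,T;X)` agrees almost everywhere with a primitive of its derivative
(du Bois-Reymond). -/
theorem IsW11.ae_eq_primitive (hT : 0 < T) {g g' : ℝ → X} (h : IsW11 T g g') :
    ∃ c : X, g =ᵐ[volume.restrict (Ioo 0 T)] fun t => c + ∫ s in (0 : ℝ)..t, g' s := by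
  set d : ℝ → X := fun t => g t - ∫ s in (0 : ℝ)..t, g' s with hd
  have hp := integrableOn_primitive h.integrable_deriv
  have hdi : IntegrableOn d (Ioo 0 T) := h.integrable.sub hp
  have hsm : ∀ (F : ℝ → X), IntegrableOn F (Ioo 0 T) → ∀ ζ : ℝ → ℝ, ContDiff ℝ ∞ ζ →
      HasCompactSupport ζ → Integrable (fun t => ζ t • F t) (volume.restrict (Ioo 0 T)) := by
    intro F hF ζ hζ hc
    obtain ⟨B, hB⟩ := hζ.continuous.bounded_above_of_compact_support hc
    exact Integrable.bdd_smul hF B hζ.continuous.aestronglyMeasurable (ae_of_all _ hB)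
  have hmean : ∀ ζ : ℝ → ℝ, ContDiff ℝ ∞ ζ → HasCompactSupport ζ → tsupport ζ ⊆ Ioo 0 T →
      ∫ t, ζ t = 0 → ∫ t in Ioo 0 T, ζ t • d t = 0 := by
    intro ζ hζ hc hs h0
    obtain ⟨ψ, h1, h2, h3, h4⟩ := exists_test_primitive hζ hc hs h0
    have e1 := h.weak ψ h1 h2 h3
    have e2 := integral_deriv_smul_primitive h.integrable_deriv h1 h2 h3
    rw [h4] at e1 e2
    simp only [hd, smul_sub]
    rw [integral_sub (hsm _ h.integrable ζ hζ hc) (hsm _ hp ζ hζ hc), e1, e2, sub_self]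
  -- a fixed test function of mean one
  let b : ContDiffBump (T / 2) := ⟨T / 8, T / 4, by positivity, by linarith⟩
  set χ := b.normed (volume : Measure ℝ) with hχ
  have χs : ContDiff ℝ ∞ χ := b.contDiff_normed
  have χc : HasCompactSupport χ := b.hasCompactSupport_normed
  have χt : tsupport χ ⊆ Ioo 0 T := by
    rw [hχ, b.tsupport_normed_eq]
    intro t ht
    rw [Metric.mem_closedBall, Real.dist_eq, abs_le] at ht
    simp only [b] at ht
    constructor <;> linarith [ht.1, ht.2]
  have χi : ∫ t, χ t = 1 := b.integral_normed
  set c := ∫ t in Ioo 0 T, χ t • d t with hc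
  refine ⟨c, ?_⟩
  have hcc : IntegrableOn (fun _ : ℝ => c) (Ioo 0 T) := integrableOn_const (by simp)
  have hae : ∀ᵐ t ∂(volume : Measure ℝ), t ∈ Ioo 0 T → d t - c = 0 := by
    refine isOpen_Ioo.ae_eq_zero_of_integral_contDiff_smul_eq_zero
      (hdi.sub hcc).locallyIntegrableOn fun η hη hηc hηs => ?_
    have hηi : Integrable η := hη.continuous.integrable_of_hasCompactSupport hηc
    have hχint : Integrable χ := χs.continuous.integrable_of_hasCompactSupport χc
    set m := ∫ t, η t with hm
    have hζs : ContDiff ℝ ∞ (fun t => η t - m * χ t) := hη.sub (contDiff_const.mul χs)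
    have hζc : HasCompactSupport (fun t => η t - m * χ t) := hηc.sub χc.mul_left
    have hζt : tsupport (fun t => η t - m * χ t) ⊆ Ioo 0 T :=
      (tsupport_sub _ _).trans (union_subset hηs
        ((tsupport_mul_subset_right (f := fun _ => m) (g := χ)).trans χt))
    have hζ0 : ∫ t, (η t - m * χ t) = 0 := by
      rw [integral_sub hηi (hχint.const_mul m), integral_const_mul, χi, ← hm]; ring
    have key := hmean _ hζs hζc hζt hζ0
    simp only [sub_smul, mul_smul] at key
    rw [integral_sub (hsm d hdi η hη hηc) ((hsm d hdi χ χs χc).fun_smul m), integral_smul, ← hc,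
      sub_eq_zero] at key
    have hηm : ∫ t in Ioo 0 T, η t = m :=
      setIntegral_eq_integral_of_forall_compl_eq_zero fun t ht =>
        image_eq_zero_of_notMem_tsupport fun h' => ht (hηs h')
    have hset : ∫ t, η t • (d t - c) = ∫ t in Ioo 0 T, η t • (d t - c) := by
      refine (setIntegral_eq_integral_of_forall_compl_eq_zero fun t ht => ?_).symm
      rw [image_eq_zero_of_notMem_tsupport fun h' => ht (hηs h'), zero_smul]
    rw [hset]
    simp only [smul_sub]
    rw [integral_sub (hsm d hdi η hη hηc) (hsm _ hcc η hη hηc), key, integral_smul_const, hηm,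
      sub_self]
  rw [Filter.EventuallyEq, ae_restrict_iff' measurableSet_Ioo]
  filter_upwards [hae] with t ht ht'
  have := ht ht'
  simp only [hd] at this
  rw [sub_sub, sub_eq_zero] at this
  rw [this, add_comm]

end weakderiv

/-! ### Diagonal operators on `ℓ²` and their convolutions -/

/-- The real sequence space `ℓ²`. -/
abbrev Ell2 : Type := lp (fun _ : ℕ => ℝ) 2

theorem two_toReal_pos : 0 < (2 : ENNReal).toReal := by norm_num

theorem Ell2.hasSum_sq (x : Ell2) : HasSum (fun j => x j ^ 2) (‖x‖ ^ 2) := by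
  have := lp.hasSum_norm two_toReal_pos x
  simpa using this

theorem Ell2.norm_le {x : Ell2} {C : ℝ} (hC : 0 ≤ C) (h : ∀ s : Finset ℕ, ∑ j ∈ s, x j ^ 2 ≤ C ^ 2) :
    ‖x‖ ≤ C := by
  refine lp.norm_le_of_forall_sum_le two_toReal_pos hC fun s => ?_
  simpa using h s

theorem memℓp_of_sum_sq_le {c : ℕ → ℝ} {C : ℝ} (h : ∀ s : Finset ℕ, ∑ j ∈ s, c j ^ 2 ≤ C) :
    Memℓp c 2 := by
  refine memℓp_gen' (C := C) fun s => ?_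
  simpa using h s

theorem Ell2.sum_sq_le (x : Ell2) (s : Finset ℕ) : ∑ j ∈ s, x j ^ 2 ≤ ‖x‖ ^ 2 :=
  sum_le_hasSum s (fun _ _ => sq_nonneg _) x.hasSum_sq

theorem sum_sq_mul_le {m : ℕ → ℝ} {B : ℝ} (hm : ∀ j, |m j| ≤ B) (x : Ell2) (s : Finset ℕ) :
    ∑ j ∈ s, (m j * x j) ^ 2 ≤ (B * ‖x‖) ^ 2 := by
  calc ∑ j ∈ s, (m j * x j) ^ 2 ≤ ∑ j ∈ s, B ^ 2 * x j ^ 2 := by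
        refine Finset.sum_le_sum fun j _ => ?_
        rw [mul_pow]
        have : m j ^ 2 ≤ B ^ 2 := sq_le_sq' (neg_le_of_abs_le (hm j)) (le_of_abs_le (hm j))
        gcongr
    _ = B ^ 2 * ∑ j ∈ s, x j ^ 2 := by rw [Finset.mul_sum]
    _ ≤ B ^ 2 * ‖x‖ ^ 2 := by gcongr; exact x.sum_sq_le s
    _ = _ := by ring

open Classical in
/-- The diagonal operator `x ↦ (mⱼ xⱼ)` on `ℓ²`, defined to be zero when `m` is unbounded. -/
noncomputable def diagOp (m : ℕ → ℝ) : Ell2 →L[ℝ] Ell2 :=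
  if h : ∃ B, ∀ j, |m j| ≤ B then
    LinearMap.mkContinuousOfExistsBound
      { toFun := fun x => ⟨fun j => m j * x j, memℓp_of_sum_sq_le (sum_sq_mul_le h.choose_spec x)⟩
        map_add' := fun x y => by ext j; exact mul_add _ _ _
        map_smul' := fun c x => by ext j; exact mul_left_comm _ _ _ }
      ⟨h.choose, fun x => Ell2.norm_le
        (mul_nonneg ((abs_nonneg _).trans (h.choose_spec 0)) (norm_nonneg _))
        (sum_sq_mul_le h.choose_spec x)⟩
  else 0

theorem diagOp_apply {m : ℕ → ℝ} {B : ℝ} (hm : ∀ j, |m j| ≤ B) (x : Ell2) (j : ℕ) :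
    diagOp m x j = m j * x j := by
  unfold diagOp
  rw [dif_pos ⟨B, hm⟩]
  rfl

theorem norm_diagOp_le {m : ℕ → ℝ} {B : ℝ} (hm : ∀ j, |m j| ≤ B) (x : Ell2) :
    ‖diagOp m x‖ ≤ B * ‖x‖ := by
  refine Ell2.norm_le (mul_nonneg ((abs_nonneg _).trans (hm 0)) (norm_nonneg _)) fun s => ?_
  simp_rw [diagOp_apply hm]
  exact sum_sq_mul_le hm x s

theorem diagOp_const (r : ℝ) (x : Ell2) : diagOp (fun _ => r) x = r • x := by
  ext j
  rw [diagOp_apply (B := |r|) fun _ => le_rfl]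
  rfl

/-- The coordinate functionals of `ℓ²`. -/
noncomputable abbrev Ell2.coord (j : ℕ) : Ell2 →L[ℝ] ℝ := lp.evalCLM ℝ (fun _ : ℕ => ℝ) 2 j

/-- Measurability of an `ℓ²`-valued function may be checked on coordinates. -/
theorem Ell2.aestronglyMeasurable {S : Type*} [MeasurableSpace S] {ν : Measure S} {f : S → Ell2}
    (h : ∀ j, AEStronglyMeasurable (fun a => f a j) ν) : AEStronglyMeasurable f ν := by
  refine aestronglyMeasurable_of_tendsto_ae atTop
    (f := fun n a => ∑ j ∈ Finset.range n, lp.single (E := fun _ : ℕ => ℝ) 2 j (f a j)) (fun n => ?_)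
    (ae_of_all _ fun a => (lp.hasSum_single (by norm_num) (f a)).tendsto_sum_nat)
  refine Finset.aestronglyMeasurable_fun_sum _ fun j _ => ?_
  exact (lp.singleContinuousLinearMap ℝ (fun _ : ℕ => ℝ) 2 j).continuous.comp_aestronglyMeasurable (h j)

theorem Ell2.intervalIntegral_apply {f : ℝ → Ell2} {a b : ℝ}
    (h : IntervalIntegrable f volume a b) (j : ℕ) : (∫ s in a..b, f s) j = ∫ s in a..b, f s j :=
  ((Ell2.coord j).intervalIntegral_comp_comm h).symm

theorem integrableOn_Ell2_apply {f : ℝ → Ell2} {S : Set ℝ} (h : IntegrableOn f S) (j : ℕ) :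
    IntegrableOn (fun s => f s j) S :=
  (Ell2.coord j).integrable_comp h

section lconv

variable {m : ℕ → ℝ → ℝ} {ρ : ℝ → ℝ} {z : ℝ → Ell2} {T : ℝ}

/-- The convolution `∫₀ᵗ m(t-s) z(s) ds` of a time dependent diagonal operator and an `ℓ²`-valued
function. -/
noncomputable def lconv (m : ℕ → ℝ → ℝ) (z : ℝ → Ell2) (t : ℝ) : Ell2 :=
  ∫ s in (0 : ℝ)..t, diagOp (fun j => m j (t - s)) (z s)

/-- Here `ρ` is a common majorant of the diagonal entries. -/
theorem intervalIntegrable_diagOp (hm : ∀ j, Measurable (m j))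
    (hρ : ∀ j, ∀ τ ∈ Ioo 0 T, |m j τ| ≤ ρ τ) (hz : IntegrableOn z (Ioo 0 T)) {t : ℝ}
    (ht : t ∈ Ioc 0 T) (hint : IntegrableOn (fun s => ρ (t - s) * ‖z s‖) (Ioo 0 t)) :
    IntervalIntegrable (fun s => diagOp (fun j => m j (t - s)) (z s)) volume 0 t := by
  rw [intervalIntegrable_iff_integrableOn_Ioo_of_le ht.1.le]
  have hmem : ∀ s ∈ Ioo 0 t, t - s ∈ Ioo 0 T := fun s hs =>
    ⟨by linarith [hs.2], by linarith [hs.1, ht.2]⟩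
  refine Integrable.mono' hint (Ell2.aestronglyMeasurable fun j => ?_) ?_
  · have h1 : AEStronglyMeasurable (fun s => m j (t - s) * z s j) (volume.restrict (Ioo 0 t)) :=
      ((hm j).comp (measurable_const.sub measurable_id)).aestronglyMeasurable.mul
        (integrableOn_Ell2_apply (hz.mono_set (Ioo_subset_Ioo_right ht.2)) j).1
    refine h1.congr ?_
    filter_upwards [ae_restrict_mem measurableSet_Ioo] with s hs
    rw [diagOp_apply fun j => hρ j _ (hmem s hs)]
  · filter_upwards [ae_restrict_mem measurableSet_Ioo] with s hs
    exact norm_diagOp_le (fun j => hρ j _ (hmem s hs)) _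

theorem lconv_apply (hρ : ∀ j, ∀ τ ∈ Ioo 0 T, |m j τ| ≤ ρ τ) {t : ℝ} (ht : t ∈ Ioc 0 T)
    (hint : IntervalIntegrable (fun s => diagOp (fun j => m j (t - s)) (z s)) volume 0 t) (j : ℕ) :
    lconv m z t j = cconv (m j) (fun s => z s j) t := by
  rw [lconv, Ell2.intervalIntegral_apply hint, cconv, intervalIntegral.integral_of_le ht.1.le,
    intervalIntegral.integral_of_le ht.1.le, integral_Ioc_eq_integral_Ioo,
    integral_Ioc_eq_integral_Ioo]
  refine setIntegral_congr_fun measurableSet_Ioo fun s hs => ?_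
  exact diagOp_apply (fun j => hρ j _ ⟨by linarith [hs.2], by linarith [hs.1, ht.2]⟩) _ _

theorem integrableOn_mul_norm_of_bounded {B : ℝ} (hz : IntegrableOn z (Ioo 0 T)) {t : ℝ}
    (ht : t ∈ Ioc 0 T) : IntegrableOn (fun s => B * ‖z s‖) (Ioo 0 t) :=
  (hz.mono_set (Ioo_subset_Ioo_right ht.2)).norm.const_mul B

open scoped Convolution in
/-- Young's inequality for `lconv`: the convolution exists for almost every time and is integrable
with the expected bound. -/
theorem lconv_young (hm : ∀ j, Measurable (m j)) (hρ : ∀ j, ∀ τ ∈ Ioo 0 T, |m j τ| ≤ ρ τ)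
    (hρi : IntegrableOn ρ (Ioo 0 T)) (hz : IntegrableOn z (Ioo 0 T)) :
    (∀ᵐ t ∂(volume.restrict (Ioo 0 T)),
      IntervalIntegrable (fun s => diagOp (fun j => m j (t - s)) (z s)) volume 0 t) ∧
    IntegrableOn (lconv m z) (Ioo 0 T) ∧
    ∫ t in Ioo 0 T, ‖lconv m z t‖ ≤ (∫ t in Ioo 0 T, ρ t) * ∫ t in Ioo 0 T, ‖z t‖ := by
  rcases le_or_gt T 0 with hT | hT
  · simp [Ioo_eq_empty (not_lt.2 hT)]
  have hρ0 : ∀ τ ∈ Ioo 0 T, 0 ≤ ρ τ := fun τ hτ => (abs_nonneg _).trans (hρ 0 τ hτ)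
  set P : ℝ → ℝ := (Ioo 0 T).indicator ρ with hP
  set N : ℝ → ℝ := (Ioo 0 T).indicator (fun s => ‖z s‖) with hN
  have hPi : Integrable P := hρi.integrable_indicator measurableSet_Ioo
  have hNi : Integrable N := IntegrableOn.integrable_indicator hz.norm measurableSet_Ioo
  have hconv := hNi.convolution_integrand (ContinuousLinearMap.mul ℝ ℝ) hPi
  simp only [ContinuousLinearMap.mul_apply'] at hconv
  -- the integrand on the triangle `0 < s < t < T`, dominated by a convolution integrand
  set D : Set (ℝ × ℝ) := {p | 0 < p.2 ∧ p.2 < p.1 ∧ p.1 < T} with hD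
  have hDm : MeasurableSet D :=
    (measurableSet_lt measurable_const measurable_snd).inter
      ((measurableSet_lt measurable_snd measurable_fst).inter
        (measurableSet_lt measurable_fst measurable_const))
  set Φ : ℝ × ℝ → Ell2 := D.indicator fun p => diagOp (fun j => m j (p.1 - p.2)) (z p.2) with hΦ
  have hmemD : ∀ p ∈ D, p.1 - p.2 ∈ Ioo 0 T := fun p hp =>
    ⟨by linarith [hp.2.1], by linarith [hp.1, hp.2.2]⟩
  have hmemD2 : ∀ p ∈ D, p.2 ∈ Ioo 0 T := fun p hp => ⟨hp.1, hp.2.1.trans hp.2.2⟩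
  have hΦm : AEStronglyMeasurable Φ (volume.prod volume) := by
    refine Ell2.aestronglyMeasurable fun j => ?_
    have hzj : AEStronglyMeasurable ((Ioo 0 T).indicator fun s => z s j) volume :=
      ((integrableOn_Ell2_apply hz j).integrable_indicator measurableSet_Ioo).1
    have h1 : AEStronglyMeasurable (D.indicator fun p : ℝ × ℝ =>
        m j (p.1 - p.2) * (Ioo 0 T).indicator (fun s => z s j) p.2) (volume.prod volume) :=
      ((((hm j).comp (measurable_fst.sub measurable_snd)).aestronglyMeasurable).mul
        hzj.comp_snd).indicator hDm
    refine h1.congr (ae_of_all _ fun p => ?_)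
    by_cases hp : p ∈ D
    · simp only [hΦ, indicator_of_mem hp]
      rw [indicator_of_mem (hmemD2 p hp), diagOp_apply fun j => hρ j _ (hmemD p hp)]
    · simp only [hΦ, indicator_of_notMem hp]
      rfl
  have hΦle : ∀ p, ‖Φ p‖ ≤ N p.2 * P (p.1 - p.2) := by
    intro p
    by_cases hp : p ∈ D
    · simp only [hΦ, indicator_of_mem hp]
      rw [hN, hP, indicator_of_mem (hmemD2 p hp), indicator_of_mem (hmemD p hp), mul_comm]
      exact norm_diagOp_le (fun j => hρ j _ (hmemD p hp)) _
    · simp only [hΦ, indicator_of_notMem hp, norm_zero]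
      exact mul_nonneg (indicator_nonneg (fun _ _ => norm_nonneg _) _) (indicator_nonneg hρ0 _)
  have hΦi : Integrable Φ (volume.prod volume) := hconv.mono' hΦm (ae_of_all _ hΦle)
  have hslice : ∀ t ∈ Ioo 0 T, (fun s => Φ (t, s)) =
      (Ioo 0 t).indicator fun s => diagOp (fun j => m j (t - s)) (z s) := by
    intro t ht
    funext s
    by_cases hs : s ∈ Ioo 0 t
    · rw [indicator_of_mem hs, hΦ, indicator_of_mem (show (t, s) ∈ D from ⟨hs.1, hs.2, ht.2⟩)]
    · rw [indicator_of_notMem hs, hΦ, indicator_of_notMem fun h : (t, s) ∈ D => hs ⟨h.1, h.2.1⟩]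
  have hlc : ∀ t ∈ Ioo 0 T, ∫ s, Φ (t, s) = lconv m z t := by
    intro t ht
    rw [hslice t ht, integral_indicator measurableSet_Ioo, lconv,
      intervalIntegral.integral_of_le ht.1.le, integral_Ioc_eq_integral_Ioo]
  refine ⟨?_, ?_, ?_⟩
  · filter_upwards [ae_restrict_of_ae hΦi.prod_right_ae, ae_restrict_mem measurableSet_Ioo] with t h1 ht
    rw [hslice t ht, integrable_indicator_iff measurableSet_Ioo] at h1
    exact (intervalIntegrable_iff_integrableOn_Ioo_of_le ht.1.le).2 h1
  · exact hΦi.integral_prod_left.integrableOn.congr_fun hlc measurableSet_Ioo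
  · have hcint := hNi.integrable_convolution (ContinuousLinearMap.mul ℝ ℝ) hPi
    have hcval := integral_convolution (ContinuousLinearMap.mul ℝ ℝ) (μ := volume) (ν := volume) hNi hPi
    have hc0 : ∀ t, 0 ≤ (N ⋆[ContinuousLinearMap.mul ℝ ℝ, volume] P) t := fun t =>
      integral_nonneg fun s => mul_nonneg (indicator_nonneg (fun _ _ => norm_nonneg _) _)
        (indicator_nonneg hρ0 _)
    have h1 : ∫ t in Ioo 0 T, ‖lconv m z t‖ ≤
        ∫ t in Ioo 0 T, (N ⋆[ContinuousLinearMap.mul ℝ ℝ, volume] P) t := by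
      refine integral_mono_ae ?_ hcint.integrableOn ?_
      · exact (hΦi.integral_prod_left.integrableOn.congr_fun hlc measurableSet_Ioo).norm
      · filter_upwards [ae_restrict_of_ae hconv.prod_right_ae, ae_restrict_mem measurableSet_Ioo]
          with t h2 ht
        rw [← hlc t ht]
        exact norm_integral_le_of_norm_le h2 (ae_of_all _ fun s => hΦle (t, s))
    refine h1.trans ((setIntegral_le_integral hcint (ae_of_all _ hc0)).trans ?_)
    rw [hcval, ContinuousLinearMap.mul_apply', hN, hP, integral_indicator measurableSet_Ioo,
      integral_indicator measurableSet_Ioo, mul_comm]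

end lconv

/-! ### Test functions -/

section testfunctions

variable {Ω : Set Plane} {φ ψ : Plane → ℝ}

theorem IsTest.pderiv (hφ : IsTest Ω φ) (i : Fin 2) : IsTest Ω (pderiv i φ) := by
  have hs : tsupport (FracBiharmonic.pderiv i φ) ⊆ tsupport φ :=
    tsupport_fderiv_apply_subset ℝ (EuclideanSpace.single i (1 : ℝ))
  exact ⟨pderiv_smooth hφ.smooth i, hφ.compact.of_isClosed_subset (isClosed_tsupport _) hs,
    hs.trans hφ.supp⟩

theorem IsTest.jetFun (hφ : IsTest Ω φ) (m : JetIndex) : IsTest Ω (jetFun φ m) := by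
  rcases m with _ | i | ij
  · exact hφ
  · exact hφ.pderiv i
  · exact (hφ.pderiv ij.2).pderiv ij.1

theorem IsTest.continuous (hφ : IsTest Ω φ) : Continuous φ := hφ.smooth.continuous

theorem IsTest.memLp (hφ : IsTest Ω φ) : MemLp φ 2 (volume.restrict Ω) :=
  (hφ.continuous.memLp_of_hasCompactSupport hφ.compact).restrict Ω

/-- The class of a test function in `L²(Ω)`. -/
noncomputable def IsTest.toLp (hφ : IsTest Ω φ) : L2 Ω := hφ.memLp.toLp φ

theorem IsTest.coeFn_toLp (hφ : IsTest Ω φ) : (hφ.toLp : Plane → ℝ) =ᵐ[volume.restrict Ω] φ :=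
  MemLp.coeFn_toLp _

theorem inner_eq_setIntegral {f g : L2 Ω} (hf : (f : Plane → ℝ) =ᵐ[volume.restrict Ω] φ)
    (hg : (g : Plane → ℝ) =ᵐ[volume.restrict Ω] ψ) : inner ℝ f g = ∫ x in Ω, φ x * ψ x := by
  rw [L2.inner_def]
  refine integral_congr_ae ?_
  filter_upwards [hf, hg] with x h1 h2
  rw [h1, h2]
  simp [mul_comm]

theorem inner_eq_integral_of_isTest {f g : L2 Ω} (hφ : IsTest Ω φ)
    (hf : (f : Plane → ℝ) =ᵐ[volume.restrict Ω] φ)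
    (hg : (g : Plane → ℝ) =ᵐ[volume.restrict Ω] ψ) : inner ℝ f g = ∫ x, φ x * ψ x := by
  rw [inner_eq_setIntegral hf hg]
  refine setIntegral_eq_integral_of_forall_compl_eq_zero fun x hx => ?_
  rw [image_eq_zero_of_notMem_tsupport fun h => hx (hφ.supp h), zero_mul]

/-- Integration by parts for test functions. -/
theorem integral_mul_pderiv (hφ : IsTest Ω φ) (hψ : IsTest Ω ψ) (i : Fin 2) :
    ∫ x, φ x * pderiv i ψ x = - ∫ x, pderiv i φ x * ψ x := by
  have hi : ∀ {f g : Plane → ℝ}, IsTest Ω f → IsTest Ω g → Integrable fun x => f x * g x :=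
    fun hf hg => (hf.continuous.mul hg.continuous).integrable_of_hasCompactSupport hf.compact.mul_right
  exact integral_mul_fderiv_eq_neg_fderiv_mul_of_integrable (hi (hφ.pderiv i) hψ)
    (hi hφ (hψ.pderiv i)) (hi hφ hψ) (fun x _ => hφ.smooth.differentiable (by simp) x)
    (fun x _ => hψ.smooth.differentiable (by simp) x)

/-- The jet of a test function, as an element of `V`. -/
noncomputable def IsTest.toV (hφ : IsTest Ω φ) : V Ω :=
  ⟨WithLp.toLp 2 fun m => (hφ.jetFun m).toLp, by
    refine Submodule.le_topologicalClosure _ ?_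
    exact ⟨φ, hφ, fun m => (hφ.jetFun m).coeFn_toLp⟩⟩

/-- A closed condition on jets holds on `H²₀(Ω)` as soon as it holds for jets of test functions. -/
theorem toJet_mem_of_isClosed {S : Set (Jet Ω)} (hS : IsClosed S)
    (h : ∀ (φ : Plane → ℝ), IsTest Ω φ → ∀ w : Jet Ω,
      (∀ m, (w m : Plane → ℝ) =ᵐ[volume.restrict Ω] FracBiharmonic.jetFun φ m) → w ∈ S) (v : V Ω) :
    toJet Ω v ∈ S := by
  have hv : toJet Ω v ∈ closure (testJets Ω : Set (Jet Ω)) := v.2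
  refine closure_minimal ?_ hS hv
  rintro w ⟨φ, hφ, hw⟩
  exact h φ hφ w hw

end testfunctions

/-! ### Norms and embeddings of `H²₀(Ω)` -/

section spaceV

variable {Ω : Set Plane}

instance : CompleteSpace (V Ω) :=
  (Submodule.isClosed_topologicalClosure (testJets Ω)).completeSpace_coe

theorem norm_sq_eq_sum_jet (v : V Ω) : ‖v‖ ^ 2 = ∑ m, ‖toJet Ω v m‖ ^ 2 := by
  have : ‖v‖ = ‖toJet Ω v‖ := rfl
  rw [this, PiLp.norm_sq_eq_of_L2]

theorem bform_self (v : V Ω) : bform v v = ∑ i : Fin 2, ∑ j : Fin 2, ‖hess v i j‖ ^ 2 := by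
  simp [bform]

theorem bform_self_nonneg (v : V Ω) : 0 ≤ bform v v := by
  rw [bform_self]; positivity

theorem norm_sq_eq (v : V Ω) :
    ‖v‖ ^ 2 = ‖toL2 Ω v‖ ^ 2 + (∑ i : Fin 2, ‖toJet Ω v (Sum.inr (Sum.inl i))‖ ^ 2) + bform v v := by
  rw [norm_sq_eq_sum_jet, bform_self, Fintype.sum_sum_type, Fintype.sum_sum_type,
    Fintype.sum_prod_type]
  simp only [Finset.univ_unique, Finset.sum_singleton, add_assoc]
  rfl

theorem norm_toL2_sq_add_bform_le (v : V Ω) : ‖toL2 Ω v‖ ^ 2 + bform v v ≤ ‖v‖ ^ 2 := by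
  rw [norm_sq_eq]
  have : 0 ≤ ∑ i : Fin 2, ‖toJet Ω v (Sum.inr (Sum.inl i))‖ ^ 2 := by positivity
  linarith

/-- `‖∂ᵢv‖² = -(v, ∂ᵢ∂ᵢv)`. -/
theorem inner_grad_self (v : V Ω) (i : Fin 2) :
    inner ℝ (toJet Ω v (Sum.inr (Sum.inl i))) (toJet Ω v (Sum.inr (Sum.inl i))) =
      - inner ℝ (toJet Ω v (Sum.inl ())) (toJet Ω v (Sum.inr (Sum.inr (i, i)))) := by
  have hc : ∀ m : JetIndex, Continuous fun w : Jet Ω => w m := fun m => by fun_prop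
  refine toJet_mem_of_isClosed (S := {w : Jet Ω | inner ℝ (w (Sum.inr (Sum.inl i)))
    (w (Sum.inr (Sum.inl i))) = - inner ℝ (w (Sum.inl ())) (w (Sum.inr (Sum.inr (i, i))))})
    (isClosed_eq ((hc _).inner (hc _)) ((hc _).inner (hc _)).neg) ?_ v
  intro φ hφ w hw
  rw [mem_ofPred_eq, inner_eq_integral_of_isTest (hφ.jetFun _) (hw _) (hw _),
    inner_eq_integral_of_isTest (hφ.jetFun _) (hw _) (hw _)]
  have := integral_mul_pderiv hφ (hφ.pderiv i) i
  simp only [jetFun]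
  rw [this, neg_neg]

/-- On `H²₀(Ω)` the full `H²` norm is controlled by the function and its second derivatives, with a
constant that does not depend on `Ω`. -/
theorem norm_sq_le (v : V Ω) : ‖v‖ ^ 2 ≤ 2 * (‖toL2 Ω v‖ ^ 2 + bform v v) := by
  rw [norm_sq_eq]
  have hi : ∀ i : Fin 2, ‖toJet Ω v (Sum.inr (Sum.inl i))‖ ^ 2 ≤
      (‖toL2 Ω v‖ ^ 2 + ‖hess v i i‖ ^ 2) / 2 := by
    intro i
    rw [← real_inner_self_eq_norm_sq, inner_grad_self]
    have h1 := neg_le_of_abs_le (abs_real_inner_le_norm (toJet Ω v (Sum.inl ()))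
      (toJet Ω v (Sum.inr (Sum.inr (i, i)))))
    have h2 : toL2 Ω v = toJet Ω v (Sum.inl ()) := rfl
    have h3 : hess v i i = toJet Ω v (Sum.inr (Sum.inr (i, i))) := rfl
    rw [h2, h3]
    nlinarith [sq_nonneg (‖toJet Ω v (Sum.inl ())‖ - ‖toJet Ω v (Sum.inr (Sum.inr (i, i)))‖)]
  have h0 := hi 0
  have h1 := hi 1
  rw [bform_self]
  simp only [Fin.sum_univ_two]
  nlinarith [sq_nonneg ‖hess v 0 1‖, sq_nonneg ‖hess v 1 0‖, sq_nonneg ‖hess v 0 0‖,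
    sq_nonneg ‖hess v 1 1‖]

/-- The second derivatives of `v ∈ H²₀(Ω)` are weak derivatives. -/
theorem inner_hess_test (v : V Ω) (i j : Fin 2) {ψ : Plane → ℝ} (hψ : IsTest Ω ψ) :
    inner ℝ (hess v i j) hψ.toLp = inner ℝ (toL2 Ω v) ((hψ.pderiv i).pderiv j).toLp := by
  have hc : ∀ m : JetIndex, Continuous fun w : Jet Ω => w m := fun m => by fun_prop
  refine toJet_mem_of_isClosed (S := {w : Jet Ω | inner ℝ (w (Sum.inr (Sum.inr (i, j)))) hψ.toLp =
    inner ℝ (w (Sum.inl ())) ((hψ.pderiv i).pderiv j).toLp})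
    (isClosed_eq ((hc _).inner continuous_const) ((hc _).inner continuous_const)) ?_ v
  intro φ hφ w hw
  rw [mem_ofPred_eq, inner_eq_integral_of_isTest (hφ.jetFun _) (hw _) hψ.coeFn_toLp,
    inner_eq_integral_of_isTest (hφ.jetFun _) (hw _) ((hψ.pderiv i).pderiv j).coeFn_toLp]
  have h1 := integral_mul_pderiv (hφ.pderiv j) hψ i
  have h2 := integral_mul_pderiv hφ (hψ.pderiv i) j
  simp only [jetFun]
  rw [h2, ← neg_eq_iff_eq_neg.2 h1]

/-- The fundamental lemma of the calculus of variations. -/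
theorem eq_zero_of_inner_test (hΩ : IsOpen Ω) {g : L2 Ω}
    (h : ∀ ψ (hψ : IsTest Ω ψ), inner ℝ g hψ.toLp = 0) : g = 0 := by
  have hloc : LocallyIntegrableOn (g : Plane → ℝ) Ω volume := by
    rw [locallyIntegrableOn_iff hΩ.isLocallyClosed]
    intro K hK hKc
    have hK2 : MemLp (g : Plane → ℝ) 2 (volume.restrict K) := by
      have h1 := (Lp.memLp g).restrict K
      rwa [Measure.restrict_restrict_of_subset hK] at h1
    have : IsFiniteMeasure (volume.restrict K) := ⟨by simpa using hKc.measure_lt_top⟩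
    exact hK2.integrable (by norm_num)
  have hae := hΩ.ae_eq_zero_of_integral_contDiff_smul_eq_zero hloc fun ψ h1 h2 h3 => by
    have hψ : IsTest Ω ψ := ⟨h1, h2, h3⟩
    have := h ψ hψ
    rw [real_inner_comm, inner_eq_integral_of_isTest hψ hψ.coeFn_toLp
      (EventuallyEq.refl _ (g : Plane → ℝ))] at this
    simpa using this
  rw [Lp.eq_zero_iff_ae_eq_zero, Filter.EventuallyEq, ae_restrict_iff' hΩ.measurableSet]
  filter_upwards [hae] with x hx hx' using hx hx'

/-- The range of `V → L²(Ω)` is dense. -/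
theorem eq_zero_of_inner_toL2 (hΩ : IsOpen Ω) {g : L2 Ω}
    (h : ∀ v : V Ω, inner ℝ g (toL2 Ω v) = 0) : g = 0 :=
  eq_zero_of_inner_test hΩ fun _ hψ => h hψ.toV

/-- The weak second derivatives of `v` vanish with `v`, and together they control the norm. -/
theorem toL2_injective (hΩ : IsOpen Ω) {v : V Ω} (h : toL2 Ω v = 0) : v = 0 := by
  have hh : ∀ i j, hess v i j = 0 := fun i j => eq_zero_of_inner_test hΩ fun ψ hψ => by
    rw [inner_hess_test, h, inner_zero_left]
  have h1 := norm_sq_le v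
  rw [bform_self] at h1
  simp only [hh, h, norm_zero] at h1
  simpa using h1

/-- A test function is bounded by the `L¹` norm of its mixed second derivative. -/
theorem IsTest.enorm_le_lintegral {φ : Plane → ℝ} (hφ : IsTest Ω φ) (x : Plane) :
    ‖φ x‖ₑ ≤ ∫⁻ y, ‖FracBiharmonic.pderiv 1 (FracBiharmonic.pderiv 0 φ) y‖ₑ := by
  have hline : ∀ (χ : Plane → ℝ), IsTest Ω χ → ∀ (i : Fin 2) (y : Plane),
      ‖χ y‖ₑ ≤ ∫⁻ s : ℝ, ‖FracBiharmonic.pderiv i χ (y + s • EuclideanSpace.single i 1)‖ₑ := by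
    intro χ hχ i y
    set e : Plane := EuclideanSpace.single i 1 with he
    have hdiff : ContDiff ℝ ∞ fun s : ℝ => y + s • e :=
      contDiff_const.add (contDiff_id.smul contDiff_const)
    have hemb : Topology.IsClosedEmbedding fun s : ℝ => y + s • e := by
      have h1 : Topology.IsClosedEmbedding fun s : ℝ => s • e :=
        isClosedEmbedding_smul_left (by simp [he])
      exact (Homeomorph.addLeft y).isClosedEmbedding.comp h1
    have hcs : HasCompactSupport fun s : ℝ => χ (y + s • e) :=
      hχ.compact.comp_isClosedEmbedding hemb
    have hderiv : ∀ s : ℝ, deriv (fun s : ℝ => χ (y + s • e)) s =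
        FracBiharmonic.pderiv i χ (y + s • e) := by
      intro s
      have h1 : HasDerivAt (fun s : ℝ => y + s • e) e s := by
        simpa using ((hasDerivAt_id s).smul_const e).const_add y
      have h2 := ((hχ.smooth.differentiable (by simp)) (y + s • e)).hasFDerivAt
      exact (h2.comp_hasDerivAt s h1).deriv
    have := HasCompactSupport.enorm_le_lintegral_Ici_deriv
      ((hχ.smooth.comp hdiff).of_le (by simp)) hcs 0
    simp only [Function.comp_apply, zero_smul, add_zero] at this
    refine this.trans ((setLIntegral_le_lintegral _ _).trans (le_of_eq ?_))
    exact lintegral_congr fun s => by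
      have := hderiv s
      simp only [Function.comp_def]
      rw [this]
  set w : Plane → ENNReal := fun y =>
    ‖FracBiharmonic.pderiv 1 (FracBiharmonic.pderiv 0 φ) y‖ₑ with hw
  have hwm : Measurable w := ((hφ.pderiv 0).pderiv 1).continuous.measurable.enorm
  set L : ℝ × ℝ → Plane := fun p =>
    (MeasurableEquiv.toLp 2 (Fin 2 → ℝ)) (MeasurableEquiv.finTwoArrow.symm p) with hL
  have hmp : MeasurePreserving L volume volume :=
    (EuclideanSpace.volume_preserving_symm_measurableEquiv_toLp (Fin 2)).symm.comp
      (volume_preserving_finTwoArrow ℝ).symm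
  have hmpx : MeasurePreserving (fun p => x + L p) volume volume :=
    (measurePreserving_add_left volume x).comp hmp
  have hLs : ∀ s r : ℝ, x + s • EuclideanSpace.single 0 1 + r • EuclideanSpace.single 1 1 =
      x + L (s, r) := by
    intro s r
    rw [add_assoc]
    congr 1
    ext k
    fin_cases k <;> simp [hL]
  calc ‖φ x‖ₑ ≤ ∫⁻ s : ℝ, ‖FracBiharmonic.pderiv 0 φ (x + s • EuclideanSpace.single 0 1)‖ₑ :=
        hline φ hφ 0 x
    _ ≤ ∫⁻ s : ℝ, ∫⁻ r : ℝ, w (x + s • EuclideanSpace.single 0 1 + r • EuclideanSpace.single 1 1) :=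
        lintegral_mono fun s => hline _ (hφ.pderiv 0) 1 _
    _ = ∫⁻ s : ℝ, ∫⁻ r : ℝ, w (x + L (s, r)) := by simp_rw [hLs]
    _ = ∫⁻ p : ℝ × ℝ, w (x + L p) := by
        rw [Measure.volume_eq_prod, lintegral_prod _ (by
          exact (hwm.comp hmpx.measurable).aemeasurable)]
    _ = ∫⁻ y, w y := hmpx.lintegral_comp hwm

/-- The embedding of `H²₀(Ω)` into `L^∞(Ω)` for bounded `Ω`. -/
theorem exists_forall_ae_abs_le (hΩ : IsOpen Ω) (hΩb : Bornology.IsBounded Ω) : ∃ M : ℝ, 0 ≤ M ∧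
    ∀ v : V Ω, ∀ᵐ x ∂(volume.restrict Ω), |toL2 Ω v x| ≤ M * √(bform v v) := by
  have hfin : IsFiniteMeasure (volume.restrict Ω) := ⟨by simpa using hΩb.measure_lt_top⟩
  set M := √((volume.restrict Ω).real univ) with hM
  have hM2 : M * M = (volume.restrict Ω).real univ := Real.mul_self_sqrt measureReal_nonneg
  refine ⟨M, Real.sqrt_nonneg _, ?_⟩
  -- the bound for test functions, by Cauchy–Schwarz
  have htest : ∀ (φ : Plane → ℝ), IsTest Ω φ → ∀ w : Jet Ω,
      (∀ m, (w m : Plane → ℝ) =ᵐ[volume.restrict Ω] jetFun φ m) →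
      ∀ x, |φ x| ≤ M * ‖w (Sum.inr (Sum.inr (1, 0)))‖ := by
    intro φ hφ w hw x
    set χ := pderiv 1 (pderiv 0 φ) with hχ
    have hχt : IsTest Ω χ := (hφ.pderiv 0).pderiv 1
    have hsupp : ∫⁻ y, ‖χ y‖ₑ = eLpNorm χ 1 (volume.restrict Ω) := by
      rw [eLpNorm_one_eq_lintegral_enorm]
      refine le_antisymm ?_ (setLIntegral_le_lintegral _ _)
      rw [← lintegral_add_compl _ hΩ.measurableSet]
      have : ∫⁻ y in Ωᶜ, ‖χ y‖ₑ = 0 := by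
        refine (setLIntegral_congr_fun hΩ.measurableSet.compl (g := fun _ => 0) fun y hy => ?_).trans
          (by simp)
        simp only
        rw [image_eq_zero_of_notMem_tsupport fun h => hy (hχt.supp h), enorm_zero]
      rw [this, add_zero]
    have hcs : eLpNorm χ 1 (volume.restrict Ω) ≤
        eLpNorm χ 2 (volume.restrict Ω) * (volume.restrict Ω) univ ^ (1 / 2 : ℝ) := by
      have := eLpNorm_le_eLpNorm_mul_rpow_measure_univ (μ := volume.restrict Ω) (f := χ) (p := 1)
        (q := 2) (by norm_num) hχt.continuous.aestronglyMeasurable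
      norm_num at this
      norm_num
      exact this
    have hle := (hφ.enorm_le_lintegral x).trans (hsupp.le.trans hcs)
    have htop : eLpNorm χ 2 (volume.restrict Ω) * (volume.restrict Ω) univ ^ (1 / 2 : ℝ) ≠ ⊤ :=
      ENNReal.mul_ne_top hχt.memLp.2.ne
        (ENNReal.rpow_ne_top_of_nonneg (by norm_num) (measure_ne_top _ _))
    have h3 := ENNReal.toReal_mono htop hle
    rw [toReal_enorm, Real.norm_eq_abs, ENNReal.toReal_mul, ← ENNReal.toReal_rpow] at h3
    have h4 : ‖w (Sum.inr (Sum.inr (1, 0)))‖ = (eLpNorm χ 2 (volume.restrict Ω)).toReal := by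
      rw [Lp.norm_def, eLpNorm_congr_ae (hw (Sum.inr (Sum.inr (1, 0))))]
      rfl
    rw [h4, hM, Real.sqrt_eq_rpow, mul_comm]
    exact h3
  have hclosed : IsClosed {w : Jet Ω | ∀ᵐ x ∂(volume.restrict Ω),
      |w (Sum.inl ()) x| ≤ M * ‖w (Sum.inr (Sum.inr (1, 0)))‖} := by
    refine IsSeqClosed.isClosed fun w w₀ hw hlim => ?_
    have hc : ∀ m : JetIndex, Continuous fun w : Jet Ω => w m := fun m => by fun_prop
    have h0 : Tendsto (fun n => w n (Sum.inl ())) atTop (𝓝 (w₀ (Sum.inl ()))) :=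
      ((hc _).tendsto _).comp hlim
    have h1 : Tendsto (fun n => M * ‖w n (Sum.inr (Sum.inr (1, 0)))‖) atTop
        (𝓝 (M * ‖w₀ (Sum.inr (Sum.inr (1, 0)))‖)) :=
      (((hc _).norm.tendsto _).comp hlim).const_mul M
    obtain ⟨ns, hns, hae⟩ := (tendstoInMeasure_of_tendsto_Lp h0).exists_seq_tendsto_ae
    have hall : ∀ᵐ x ∂(volume.restrict Ω), ∀ n,
        |w n (Sum.inl ()) x| ≤ M * ‖w n (Sum.inr (Sum.inr (1, 0)))‖ := ae_all_iff.2 hw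
    rw [mem_ofPred_eq]
    filter_upwards [hae, hall] with x hx1 hx2
    exact le_of_tendsto_of_tendsto' hx1.abs (h1.comp hns.tendsto_atTop) fun n => hx2 (ns n)
  intro v
  have hv := toJet_mem_of_isClosed hclosed (fun φ hφ w hw => by
    rw [mem_ofPred_eq]
    filter_upwards [hw (Sum.inl ())] with x hx
    rw [hx]
    exact htest φ hφ w hw x) v
  rw [mem_ofPred_eq] at hv
  have hle : ‖hess v 1 0‖ ≤ √(bform v v) := by
    refine Real.le_sqrt_of_sq_le ?_
    rw [bform_self]
    simp only [Fin.sum_univ_two]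
    nlinarith [sq_nonneg ‖hess v 0 1‖, sq_nonneg ‖hess v 0 0‖, sq_nonneg ‖hess v 1 1‖]
  filter_upwards [hv] with x hx
  exact hx.trans (mul_le_mul_of_nonneg_left hle (Real.sqrt_nonneg _))

end spaceV

/-! ### Hilbert–Schmidt operators and the eigenfunctions -/

/-- A finite family in `L²` whose linear combinations are bounded pointwise by `B` times the
euclidean norm of the coefficients: at almost every point, choosing the values of the family at that
point as coefficients gives `∑ gᵢ(x)² ≤ B²`. -/
theorem sum_norm_sq_le_of_ae_abs_le {X : Type*} [MeasurableSpace X] {ν : Measure X}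
    [IsFiniteMeasure ν] {ι : Type*} [Fintype ι] {g : ι → Lp ℝ 2 ν} {B : ℝ}
    (h : ∀ c : ι → ℝ, ∀ᵐ x ∂ν, |(∑ i, c i • g i : Lp ℝ 2 ν) x| ≤ B * √(∑ i, c i ^ 2)) :
    ∑ i, ‖g i‖ ^ 2 ≤ B ^ 2 * ν.real univ := by
  have hsum : ∀ c : ι → ℝ, ∀ᵐ x ∂ν, (∑ i, c i • g i : Lp ℝ 2 ν) x = ∑ i, c i * g i x := by
    intro c
    have h2 : ∀ᵐ x ∂ν, ∀ i, (c i • g i : Lp ℝ 2 ν) x = c i * g i x := ae_all_iff.2 fun i => by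
      filter_upwards [Lp.coeFn_smul (c i) (g i)] with x hx
      rw [hx]; rfl
    filter_upwards [Lp.coeFn_finsetSum Finset.univ fun i => c i • g i, h2] with x h3 h4
    rw [h3, Finset.sum_apply]
    exact Finset.sum_congr rfl fun i _ => h4 i
  have hdense : ∀ᵐ x ∂ν, ∀ n : ℕ, |∑ i, TopologicalSpace.denseSeq (ι → ℝ) n i * g i x| ≤
      B * √(∑ i, TopologicalSpace.denseSeq (ι → ℝ) n i ^ 2) := ae_all_iff.2 fun n => by
    filter_upwards [h (TopologicalSpace.denseSeq (ι → ℝ) n), hsum (TopologicalSpace.denseSeq (ι → ℝ) n)]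
      with x h1 h2
    rwa [h2] at h1
  have hpt : ∀ᵐ x ∂ν, ∑ i, g i x ^ 2 ≤ B ^ 2 := by
    filter_upwards [hdense] with x hx
    have hcl : IsClosed {c : ι → ℝ | |∑ i, c i * g i x| ≤ B * √(∑ i, c i ^ 2)} :=
      isClosed_le (by fun_prop) (by fun_prop)
    have hall : ∀ c : ι → ℝ, |∑ i, c i * g i x| ≤ B * √(∑ i, c i ^ 2) := by
      intro c
      have : c ∈ closure (range (TopologicalSpace.denseSeq (ι → ℝ))) :=
        TopologicalSpace.denseRange_denseSeq (ι → ℝ) c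
      refine closure_minimal ?_ hcl this
      rintro _ ⟨n, rfl⟩
      exact hx n
    have h1 := hall fun i => g i x
    set q := ∑ i, g i x ^ 2 with hq
    have hq0 : 0 ≤ q := by positivity
    have h2 : ∑ i, g i x * g i x = q := Finset.sum_congr rfl fun i _ => (sq _).symm
    rw [h2, abs_of_nonneg hq0] at h1
    rcases hq0.eq_or_lt with h0 | h0
    · rw [← h0]; positivity
    · have hs := Real.sqrt_pos.2 h0
      have h3 : √q * √q = q := Real.mul_self_sqrt hq0
      have h4 : √q ≤ B := by
        by_contra! h5
        nlinarith
      nlinarith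
  have hint : ∀ i, Integrable (fun x => g i x ^ 2) ν := fun i => (Lp.memLp (g i)).integrable_sq
  have hn : ∀ i, ‖g i‖ ^ 2 = ∫ x, g i x ^ 2 ∂ν := fun i => by
    rw [← real_inner_self_eq_norm_sq, L2.inner_def]
    refine integral_congr_ae (ae_of_all _ fun x => ?_)
    simp [sq]
  simp_rw [hn]
  rw [← integral_finsetSum _ fun i _ => hint i]
  calc ∫ x, ∑ i, g i x ^ 2 ∂ν ≤ ∫ _, B ^ 2 ∂ν :=
        integral_mono_ae (integrable_finsetSum _ fun i _ => hint i) (integrable_const _) hpt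
    _ = B ^ 2 * ν.real univ := by rw [integral_const, smul_eq_mul, mul_comm]

/-- A bounded operator whose values on a Hilbert basis are square summable is compact. -/
theorem isCompactOperator_of_sum_sq_le {H H' : Type*} [NormedAddCommGroup H]
    [InnerProductSpace ℝ H] [CompleteSpace H] [NormedAddCommGroup H'] [InnerProductSpace ℝ H']
    [CompleteSpace H'] (T : H →L[ℝ] H') {ι : Type*} (b : HilbertBasis ι ℝ H) {C : ℝ}
    (h : ∀ s : Finset ι, ∑ i ∈ s, ‖T (b i)‖ ^ 2 ≤ C) : IsCompactOperator T := by
  classical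
  set F : Finset ι → H →L[ℝ] H' := fun s => ∑ i ∈ s, (innerSL ℝ (b i)).smulRight (T (b i)) with hF
  have hFapp : ∀ s x, F s x = ∑ i ∈ s, inner ℝ (b i) x • T (b i) := fun s x => by
    simp [hF]
  have hFc : ∀ s, IsCompactOperator (F s) := by
    intro s
    refine Submodule.sum_mem (compactOperator (RingHom.id ℝ) H H') fun i _ => ?_
    change IsCompactOperator ((innerSL ℝ (b i)).smulRight (T (b i)))
    have h1 : IsCompactOperator (innerSL ℝ (b i)) := isCompactOperator_of_locallyCompactSpace_dom _
    exact h1.clm_comp ((ContinuousLinearMap.id ℝ ℝ).smulRight (T (b i)))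
  refine isCompactOperator_of_tendsto (l := atTop) (F := F) ?_ (Eventually.of_forall hFc)
  have hsum : Summable fun i => ‖T (b i)‖ ^ 2 := summable_of_sum_le (fun i => sq_nonneg _) h
  rw [Metric.tendsto_atTop]
  intro ε hε
  obtain ⟨s₀, hs₀⟩ := summable_iff_vanishing_norm.1 hsum ((ε / 2) ^ 2) (by positivity)
  refine ⟨s₀, fun s hs => ?_⟩
  rw [dist_comm, dist_eq_norm]
  refine lt_of_le_of_lt (ContinuousLinearMap.opNorm_le_bound _ (half_pos hε).le fun x => ?_)
    (half_lt_self hε)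
  have hx : HasSum (fun i => inner ℝ (b i) x • T (b i)) (T x) := by
    have := T.hasSum (b.hasSum_repr x)
    simpa [b.repr_apply_apply] using this
  have hlim : Tendsto (fun t => F t x) atTop (𝓝 (T x)) := by
    simp only [hFapp]
    rw [HasSum, SummationFilter.unconditional_filter] at hx
    exact hx
  have hlim2 : Tendsto (fun t => ‖F t x - F s x‖) atTop (𝓝 ‖T x - F s x‖) :=
    (hlim.sub_const _).norm
  rw [_root_.sub_apply]
  refine le_of_tendsto hlim2 ?_
  filter_upwards [eventually_ge_atTop s] with t ht
  rw [hFapp, hFapp, ← Finset.sum_sdiff ht, add_sub_cancel_right]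
  have hdisj : Disjoint (t \ s) s₀ := Finset.sdiff_disjoint.mono_right hs
  have htail := hs₀ _ hdisj
  rw [Real.norm_of_nonneg (by positivity)] at htail
  have hcs := Finset.sum_mul_sq_le_sq_mul_sq (t \ s) (fun i => |inner ℝ (b i) x|) fun i => ‖T (b i)‖
  have hbes : ∑ i ∈ t \ s, |inner ℝ (b i) x| ^ 2 ≤ ‖x‖ ^ 2 :=
    b.orthonormal.sum_inner_products_le x
  have hle : ‖∑ i ∈ t \ s, inner ℝ (b i) x • T (b i)‖ ≤
      ∑ i ∈ t \ s, |inner ℝ (b i) x| * ‖T (b i)‖ := by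
    refine (norm_sum_le _ _).trans (Finset.sum_le_sum fun i _ => ?_)
    rw [norm_smul, Real.norm_eq_abs]
  refine hle.trans (abs_le_of_sq_le_sq' ?_ (by positivity)).2
  calc (∑ i ∈ t \ s, |inner ℝ (b i) x| * ‖T (b i)‖) ^ 2
      ≤ (∑ i ∈ t \ s, |inner ℝ (b i) x| ^ 2) * ∑ i ∈ t \ s, ‖T (b i)‖ ^ 2 := hcs
    _ ≤ ‖x‖ ^ 2 * (ε / 2) ^ 2 := by gcongr
    _ = (ε / 2 * ‖x‖) ^ 2 := by ring

/-- A function on an infinite type with finite sublevel sets can be enumerated in increasing order: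
pick a minimum among the indices not used so far. -/
theorem exists_monotone_enumeration {ι : Type*} [Infinite ι] (f : ι → ℝ)
    (hf : ∀ R, {i | f i ≤ R}.Finite) :
    ∃ e : ℕ → ι, Function.Bijective e ∧ Monotone (f ∘ e) ∧ Tendsto (f ∘ e) atTop atTop := by
  classical
  have hpick : ∀ s : Finset ι, ∃ i, i ∉ s ∧ ∀ k, k ∉ s → f i ≤ f k := by
    intro s
    obtain ⟨i₀, hi₀⟩ := Infinite.exists_notMem_finset s
    have hfin : ({i | f i ≤ f i₀} ∩ (s : Set ι)ᶜ).Finite := (hf _).inter_of_left _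
    obtain ⟨i, hi, hmin⟩ := hfin.exists_minimalFor f _ ⟨i₀, le_refl (f i₀), hi₀⟩
    refine ⟨i, hi.2, fun k hk => ?_⟩
    rcases le_or_gt (f k) (f i₀) with h1 | h1
    · by_contra! h2
      exact absurd (hmin ⟨h1, hk⟩ h2.le) (not_le.2 h2)
    · exact hi.1.trans h1.le
  choose pick hp1 hp2 using hpick
  let F : ℕ → Finset ι := fun n => Nat.rec ∅ (fun _ s => insert (pick s) s) n
  have hF : ∀ n, F (n + 1) = insert (pick (F n)) (F n) := fun n => rfl
  have hFm : Monotone F := monotone_nat_of_le_succ fun n => by rw [hF]; exact Finset.subset_insert _ _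
  set e : ℕ → ι := fun n => pick (F n) with he
  have heF : ∀ m n, m < n → e m ∈ F n := fun m n hmn =>
    hFm (Nat.succ_le_of_lt hmn) (by rw [Nat.succ_eq_add_one, hF]; exact Finset.mem_insert_self _ _)
  have hFe : ∀ n i, i ∈ F n → ∃ m, e m = i := by
    intro n
    induction n with
    | zero => intro i hi; exact absurd hi (Finset.notMem_empty i)
    | succ n ih =>
      intro i hi
      rw [hF, Finset.mem_insert] at hi
      rcases hi with rfl | hi
      · exact ⟨n, rfl⟩
      · exact ih i hi
  have hinj : Function.Injective e := by
    intro m n hmn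
    rcases lt_trichotomy m n with h | h | h
    · have h1 := heF m n h
      rw [hmn] at h1
      exact absurd h1 (hp1 (F n))
    · exact h
    · have h1 := heF n m h
      rw [← hmn] at h1
      exact absurd h1 (hp1 (F m))
  have hmono : Monotone (f ∘ e) := monotone_nat_of_le_succ fun n =>
    hp2 (F n) _ fun h => hp1 (F (n + 1)) (hFm n.le_succ h)
  have hfin : ∀ R, {n | f (e n) ≤ R}.Finite := fun R => (hf R).preimage hinj.injOn
  refine ⟨e, ⟨hinj, fun i => ?_⟩, hmono, ?_⟩
  · by_contra! hi
    have : {n | f (e n) ≤ f i} = univ := eq_univ_of_forall fun n =>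
      hp2 (F n) i fun h => by
        obtain ⟨m, hm⟩ := hFe n i h
        exact hi m hm
    have h2 := hfin (f i)
    rw [this] at h2
    exact infinite_univ h2
  · rw [tendsto_atTop]
    intro R
    have h1 : ∀ᶠ n in cofinite, ¬ f (e n) ≤ R := (hfin R).compl_mem_cofinite
    rw [Nat.cofinite_eq_atTop] at h1
    filter_upwards [h1] with n hn using (not_le.1 hn).le

section eigen

variable {Ω : Set Plane}

theorem volume_restrict_finite (hΩb : Bornology.IsBounded Ω) :
    IsFiniteMeasure (volume.restrict Ω) := ⟨by simpa using hΩb.measure_lt_top⟩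

theorem not_finiteDimensional_L2 (hΩ : IsOpen Ω) (hne : Ω.Nonempty) :
    ¬ FiniteDimensional ℝ (L2 Ω) := by
  intro hfd
  obtain ⟨x, hx⟩ := hne
  obtain ⟨r, hr, hball⟩ := Metric.isOpen_iff.1 hΩ x hx
  -- indicators of disjoint annuli are linearly independent
  set A : ℕ → Set Plane := fun n => {y | r / (n + 2) < dist y x ∧ dist y x < r / (n + 1)} with hA
  have hAo : ∀ n, IsOpen (A n) := fun n => by
    have h1 : IsOpen {y : Plane | r / ((n : ℝ) + 2) < dist y x} :=
      isOpen_lt continuous_const (by fun_prop)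
    have h2 : IsOpen {y : Plane | dist y x < r / ((n : ℝ) + 1)} :=
      isOpen_lt (by fun_prop) continuous_const
    exact h1.inter h2
  have hAsub : ∀ n, A n ⊆ Ω := fun n y hy => hball <| by
    rw [Metric.mem_ball]
    refine hy.2.trans_le (div_le_self hr.le ?_)
    have : (0 : ℝ) ≤ n := n.cast_nonneg
    linarith
  have hAne : ∀ n, (A n).Nonempty := by
    intro n
    have hn : (0 : ℝ) ≤ n := n.cast_nonneg
    obtain ⟨c, hc1, hc2⟩ := exists_between (show r / ((n : ℝ) + 2) < r / (n + 1) by gcongr; norm_num)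
    have hc0 : 0 < c := lt_of_le_of_lt (by positivity) hc1
    refine ⟨x + c • EuclideanSpace.single 0 1, ?_⟩
    have : dist (x + c • (EuclideanSpace.single 0 1 : Plane)) x = c := by
      rw [dist_eq_norm, add_sub_cancel_left, norm_smul, Real.norm_of_nonneg hc0.le]
      simp
    exact ⟨this.symm ▸ hc1, this.symm ▸ hc2⟩
  have hdisj : ∀ m n, m < n → Disjoint (A m) (A n) := by
    intro m n hmn
    rw [Set.disjoint_left]
    intro y hm hn
    have hmn' : (m : ℝ) + 2 ≤ n + 1 := by
      have : (m : ℝ) + 1 ≤ n := by exact_mod_cast hmn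
      linarith
    have : r / ((n : ℝ) + 1) ≤ r / (m + 2) := by gcongr
    linarith [hm.1, hn.2]
  have hfin : ∀ n, (volume.restrict Ω) (A n) ≠ ⊤ := by
    intro n
    refine ((Measure.restrict_apply_le _ _).trans_lt (lt_of_le_of_lt (measure_mono (t := Metric.ball x r) ?_)
      measure_ball_lt_top)).ne
    intro y hy
    rw [Metric.mem_ball]
    refine hy.2.trans_le (div_le_self hr.le ?_)
    have : (0 : ℝ) ≤ n := n.cast_nonneg
    linarith
  set g : ℕ → L2 Ω := fun n => indicatorConstLp 2 (hAo n).measurableSet (hfin n) (1 : ℝ) with hg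
  have hinner : ∀ m n, inner ℝ (g m) (g n) = (volume.restrict Ω).real (A n ∩ A m) := by
    intro m n
    rw [hg, L2.inner_indicatorConstLp_one, setIntegral_indicatorConstLp (hAo m).measurableSet]
    simp
  have hpos : ∀ n, g n ≠ 0 := by
    intro n h0
    have := hinner n n
    rw [h0, inner_zero_left, inter_self] at this
    have hp : 0 < (volume.restrict Ω) (A n) := by
      rw [Measure.restrict_apply (hAo n).measurableSet, inter_eq_left.2 (hAsub n)]
      exact (hAo n).measure_pos _ (hAne n)
    exact (ENNReal.toReal_pos hp.ne' (hfin n)).ne' this.symm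
  have hli : LinearIndependent ℝ g := by
    refine linearIndependent_of_ne_zero_of_inner_eq_zero hpos fun m n hmn => ?_
    change inner ℝ (g m) (g n) = 0
    rw [hinner]
    have : A n ∩ A m = ∅ := by
      rcases lt_or_gt_of_ne hmn with h | h
      · rw [inter_comm]; exact (hdisj m n h).inter_eq
      · exact (hdisj n m h).inter_eq
    rw [this]; simp
  exact not_finite_iff_infinite.2 (inferInstance : Infinite ℕ) hli.finite

/-- The weak second derivative as a continuous linear map. -/
noncomputable def hessL (i j : Fin 2) : V Ω →L[ℝ] L2 Ω :=
  (PiLp.proj (𝕜 := ℝ) 2 (fun _ : JetIndex => L2 Ω) (Sum.inr (Sum.inr (i, j)))).comp (toJet Ω)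

/-- The form `a` as a continuous bilinear map. -/
noncomputable def bformL (Ω : Set Plane) : V Ω →L[ℝ] V Ω →L[ℝ] ℝ :=
  ∑ i : Fin 2, ∑ j : Fin 2, (innerSL ℝ).bilinearComp (hessL i j) (hessL i j)

theorem bformL_apply (v w : V Ω) : bformL Ω v w = bform v w := by
  simp [bformL, bform, hessL, hess]

theorem bform_comm (v w : V Ω) : bform v w = bform w v := by
  simp only [bform]
  exact Finset.sum_congr rfl fun i _ => Finset.sum_congr rfl fun j _ => real_inner_comm _ _

/-- The Poincaré inequality on a bounded open set, as coercivity of the form. -/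
theorem isCoercive_bformL (hΩ : IsOpen Ω) (hΩb : Bornology.IsBounded Ω) : IsCoercive (bformL Ω) := by
  have := volume_restrict_finite hΩb
  obtain ⟨M, hM0, hM⟩ := exists_forall_ae_abs_le hΩ hΩb
  set m := (volume.restrict Ω).real univ with hm
  have hm0 : 0 ≤ m := measureReal_nonneg
  have hpoin : ∀ v : V Ω, ‖toL2 Ω v‖ ^ 2 ≤ M ^ 2 * m * bform v v := by
    intro v
    have := sum_norm_sq_le_of_ae_abs_le (ι := Unit) (g := fun _ => toL2 Ω v)
      (B := M * √(bform v v)) (fun c => by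
        filter_upwards [hM (c () • v)] with x hx
        have hb : bform (c () • v) (c () • v) = c () ^ 2 * bform v v := by
          rw [← bformL_apply, ← bformL_apply]; simp; ring
        rw [hb, Real.sqrt_mul (sq_nonneg _)] at hx
        simp only [Finset.univ_unique, Finset.sum_singleton]
        rw [map_smul] at hx
        exact hx.trans (le_of_eq (by ring)))
    simp only [Finset.univ_unique, Finset.sum_singleton] at this
    rw [mul_pow, Real.sq_sqrt (bform_self_nonneg v)] at this
    linarith
  refine ⟨(2 * (M ^ 2 * m + 1))⁻¹, by positivity, fun v => ?_⟩
  rw [bformL_apply, mul_assoc, ← sq, inv_mul_le_iff₀ (by positivity)]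
  have h1 := norm_sq_le v
  have h2 := hpoin v
  linarith

/-- The solution operator `T : L²(Ω) → V ⊂ L²(Ω)` of the clamped plate problem is symmetric and injective,
and it is Hilbert–Schmidt because `V` embeds into `L^∞(Ω)`. The spectral theorem gives an orthonormal
basis of eigenvectors; their inverse eigenvalues have finite sublevel sets. -/
theorem exists_isEigenbasis (hΩ : IsOpen Ω) (hΩb : Bornology.IsBounded Ω) (hne : Ω.Nonempty) :
    ∃ (μ : ℕ → ℝ) (φ : ℕ → V Ω), IsEigenbasis Ω μ φ := by
  have hfm := volume_restrict_finite hΩb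
  have hcoer := isCoercive_bformL hΩ hΩb
  -- the solution operator of the clamped plate problem
  let S : L2 Ω →L[ℝ] V Ω :=
    (hcoer.continuousLinearEquivOfBilin.symm : V Ω →L[ℝ] V Ω).comp (ContinuousLinearMap.adjoint (toL2 Ω))
  have hS : ∀ g w, bform (S g) w = inner ℝ g (toL2 Ω w) := by
    intro g w
    rw [← bformL_apply, ← hcoer.continuousLinearEquivOfBilin_apply]
    simp [S, ContinuousLinearMap.adjoint_inner_left]
  let T : L2 Ω →L[ℝ] L2 Ω := (toL2 Ω).comp S
  have hTS : ∀ g, T g = toL2 Ω (S g) := fun g => rfl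
  have hTb : ∀ g h, inner ℝ (T g) h = bform (S g) (S h) := by
    intro g h
    rw [hTS, real_inner_comm, ← hS, bform_comm]
  have hsymm : (T : L2 Ω →ₗ[ℝ] L2 Ω).IsSymmetric := by
    intro g h
    change inner ℝ (T g) h = inner ℝ g (T h)
    rw [hTb, real_inner_comm, hTb, bform_comm]
  have hinj : ∀ g, T g = 0 → g = 0 := by
    intro g hg
    have h1 : S g = 0 := toL2_injective hΩ hg
    refine eq_zero_of_inner_toL2 hΩ fun v => ?_
    rw [← hS, h1, ← bformL_apply]; simp
  -- `T` is Hilbert–Schmidt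
  obtain ⟨M, hM0, hM⟩ := exists_forall_ae_abs_le hΩ hΩb
  obtain ⟨C, hC⟩ : ∃ C, ∀ (ι : Type) (v : ι → L2 Ω), Orthonormal ℝ v → ∀ s : Finset ι,
      ∑ i ∈ s, ‖T (v i)‖ ^ 2 ≤ C := by
    refine ⟨(M * √‖T‖) ^ 2 * (volume.restrict Ω).real univ, fun ι v hv s => ?_⟩
    rw [← Finset.sum_coe_sort s fun i => ‖T (v i)‖ ^ 2]
    refine sum_norm_sq_le_of_ae_abs_le fun c => ?_
    set g := ∑ i : s, c i • v i with hg
    have hTg : (∑ i : s, c i • T (v i)) = toL2 Ω (S g) := by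
      rw [← hTS, hg, map_sum]; simp
    have hgn : ‖g‖ ^ 2 = ∑ i : s, c i ^ 2 := by
      have hvs : Orthonormal ℝ fun i : s => v i := hv.comp _ Subtype.val_injective
      rw [← real_inner_self_eq_norm_sq, hg, hvs.inner_sum]
      simp [sq]
    rw [hTg]
    filter_upwards [hM (S g)] with x hx
    refine hx.trans ?_
    rw [mul_assoc]
    refine mul_le_mul_of_nonneg_left ?_ hM0
    rw [← Real.sqrt_mul (norm_nonneg _)]
    refine Real.sqrt_le_sqrt ?_
    rw [← hTb, ← hgn]
    calc inner ℝ (T g) g ≤ ‖T g‖ * ‖g‖ := real_inner_le_norm _ _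
      _ ≤ ‖T‖ * ‖g‖ * ‖g‖ := by gcongr; exact T.le_opNorm g
      _ = _ := by ring
  have hcomp : IsCompactOperator T := by
    obtain ⟨w, b, _⟩ := exists_hilbertBasis ℝ (L2 Ω)
    exact isCompactOperator_of_sum_sq_le T b (hC _ _ b.orthonormal)
  -- an orthonormal basis of eigenvectors, indexed by the nonzero eigenvalues
  let E : {l : ℝ // l ≠ 0} → Submodule ℝ (L2 Ω) := fun l => Module.End.eigenspace (T : L2 Ω →ₗ[ℝ] L2 Ω) l
  have hfd : ∀ l, FiniteDimensional ℝ (E l) := fun l =>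
    ContinuousLinearMap.finite_dimensional_eigenspace hcomp l.1 l.2
  have hfam : OrthogonalFamily ℝ (fun l => E l) fun l => (E l).subtypeₗᵢ :=
    hsymm.orthogonalFamily_eigenspaces.comp Subtype.val_injective
  let I := Σ l : {l : ℝ // l ≠ 0}, Fin (Module.finrank ℝ (E l))
  let v : I → L2 Ω := fun i => (stdOrthonormalBasis ℝ (E i.1) i.2 : L2 Ω)
  have hv : Orthonormal ℝ v :=
    hfam.orthonormal_sigma_orthonormal (v_family := fun l => stdOrthonormalBasis ℝ (E l))
      fun l => (stdOrthonormalBasis ℝ (E l)).orthonormal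
  have hTv : ∀ i : I, T (v i) = i.1.1 • v i := fun i =>
    Module.End.mem_eigenspace_iff.1 (stdOrthonormalBasis ℝ (E i.1) i.2).2
  have hvperp : (Submodule.span ℝ (range v))ᗮ = ⊥ := by
    rw [Submodule.eq_bot_iff]
    intro x hx
    have h1 : x ∈ (⨆ l, Module.End.eigenspace (T : L2 Ω →ₗ[ℝ] L2 Ω) l)ᗮ := by
      rw [← Submodule.iInf_orthogonal, Submodule.mem_iInf]
      intro l
      rw [Submodule.mem_orthogonal]
      intro u hu
      by_cases hl : l = 0
      · have : T u = 0 := by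
          have := Module.End.mem_eigenspace_iff.1 hu
          rw [hl, zero_smul] at this
          exact this
        rw [hinj u this, inner_zero_left]
      · set bs := stdOrthonormalBasis ℝ (E ⟨l, hl⟩) with hbs
        have h2 := congrArg (Subtype.val : E ⟨l, hl⟩ → L2 Ω) (bs.sum_repr ⟨u, hu⟩)
        simp only [Submodule.coe_sum, Submodule.coe_smul] at h2
        rw [← h2, sum_inner]
        refine Finset.sum_eq_zero fun k _ => ?_
        rw [inner_smul_left]
        have h3 : inner ℝ (bs k : L2 Ω) x = 0 :=
          (Submodule.mem_orthogonal _ _).1 hx _ (Submodule.subset_span ⟨⟨⟨l, hl⟩, k⟩, rfl⟩)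
        rw [h3, mul_zero]
    rw [ContinuousLinearMap.orthogonalComplement_iSup_eigenspaces_eq_bot hcomp hsymm] at h1
    exact (Submodule.mem_bot ℝ).1 h1
  have hlpos : ∀ i : I, 0 < i.1.1 := by
    intro i
    refine lt_of_le_of_ne ?_ i.1.2.symm
    have h1 : inner ℝ (T (v i)) (v i) = i.1.1 := by
      rw [hTv, inner_smul_left, real_inner_self_eq_norm_sq, hv.1 i]; simp
    rw [← h1, hTb]
    exact bform_self_nonneg _
  have hIinf : Infinite I := by
    by_contra hfin
    rw [not_infinite_iff_finite] at hfin
    refine not_finiteDimensional_L2 hΩ hne ?_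
    have h1 : FiniteDimensional ℝ (Submodule.span ℝ (range v)) :=
      FiniteDimensional.span_of_finite ℝ (finite_range v)
    have h2 : Submodule.span ℝ (range v) = ⊤ := by
      rwa [Submodule.orthogonal_eq_bot_iff] at hvperp
    rw [h2] at h1
    exact Module.Finite.equiv (Submodule.topEquiv (R := ℝ) (M := L2 Ω))
  obtain ⟨e, he, hmono, htend⟩ := exists_monotone_enumeration (fun i : I => (i.1.1)⁻¹) (by
    intro R
    by_contra hinf
    rw [← Set.Infinite] at hinf
    -- `n` eigenvalues with `1 / l ≤ R` contribute at least `n / R²` to the Hilbert–Schmidt sum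
    obtain ⟨n, hn⟩ := exists_nat_gt (C * R ^ 2)
    obtain ⟨s, hs, hcard⟩ := hinf.exists_subset_card_eq n
    have h1 : ∀ i ∈ s, 1 ≤ R ^ 2 * ‖T (v i)‖ ^ 2 := by
      intro i hi
      have h2 : (i.1.1)⁻¹ ≤ R := hs hi
      have h3 := hlpos i
      have h4 : ‖T (v i)‖ = i.1.1 := by
        rw [hTv, norm_smul, hv.1 i, mul_one, Real.norm_of_nonneg h3.le]
      rw [h4, ← mul_pow]
      have h5 : 1 ≤ R * i.1.1 := by
        rw [inv_le_iff_one_le_mul₀ h3] at h2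
        exact h2
      nlinarith
    have h2 : (n : ℝ) ≤ R ^ 2 * ∑ i ∈ s, ‖T (v i)‖ ^ 2 := by
      rw [Finset.mul_sum, ← hcard]
      have := Finset.sum_le_sum h1
      simpa using this
    have h3 := hC I v hv s
    have h4 : R ^ 2 * ∑ i ∈ s, ‖T (v i)‖ ^ 2 ≤ R ^ 2 * C := by gcongr
    linarith)
  let φ : ℕ → V Ω := fun n => ((e n).1.1)⁻¹ • S (v (e n))
  have hφ : ∀ n, toL2 Ω (φ n) = v (e n) := by
    intro n
    simp only [φ]
    rw [map_smul, ← hTS, hTv, smul_smul, inv_mul_cancel₀ (e n).1.2, one_smul]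
  have hfun : (fun n => toL2 Ω (φ n)) = v ∘ e := funext hφ
  refine ⟨fun n => ((e n).1.1)⁻¹, φ, ?_, ?_, ?_, ?_, hmono, htend⟩
  · rw [hfun]; exact hv.comp e he.1
  · rw [hfun, he.2.range_comp, Submodule.topologicalClosure_eq_top_iff]
    exact hvperp
  · intro n w
    rw [hφ, ← hS]
    simp only [φ]
    rw [← bformL_apply, ← bformL_apply]; simp
  · intro n
    exact inv_pos.2 (hlpos _)

end eigen

/-! ### Integrability and linearity of convolutions -/

section cconv

variable {T t : ℝ} {k k₁ k₂ h h₁ h₂ : ℝ → ℝ}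

open scoped Convolution in
theorem ae_intervalIntegrable_cconv (hk : IntegrableOn k (Ioo 0 T)) (hh : IntegrableOn h (Ioo 0 T)) :
    ∀ᵐ t ∂(volume.restrict (Ioo 0 T)), IntervalIntegrable (fun s => k (t - s) * h s) volume 0 t := by
  have ik := hk.integrable_indicator measurableSet_Ioo
  have ih := hh.integrable_indicator measurableSet_Ioo
  filter_upwards [ae_restrict_of_ae (ih.ae_convolution_exists (ContinuousLinearMap.mul ℝ ℝ) ik),
    ae_restrict_mem measurableSet_Ioo] with t h1 ht
  rw [intervalIntegrable_iff_integrableOn_Ioo_of_le ht.1.le]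
  refine (Integrable.integrableOn h1 (s := Ioo 0 t)).congr_fun (fun s hs => ?_) measurableSet_Ioo
  have hs1 : s ∈ Ioo 0 T := ⟨hs.1, hs.2.trans ht.2⟩
  have hs2 : t - s ∈ Ioo 0 T := ⟨by linarith [hs.2], by linarith [hs.1, ht.2]⟩
  simp only [ContinuousLinearMap.mul_apply', indicator_of_mem hs1, indicator_of_mem hs2, mul_comm]

open scoped Convolution in
theorem integrableOn_cconv (hk : IntegrableOn k (Ioo 0 T)) (hh : IntegrableOn h (Ioo 0 T)) :
    IntegrableOn (cconv k h) (Ioo 0 T) := by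
  have ik := hk.integrable_indicator measurableSet_Ioo
  have ih := hh.integrable_indicator measurableSet_Ioo
  refine ((ih.integrable_convolution (ContinuousLinearMap.mul ℝ ℝ) ik).integrableOn).congr_fun
    (fun t ht => ?_) measurableSet_Ioo
  exact convolution_eq_cconv ht.1.le (indicator_Ioo_of_mem ht.2.le h) (indicator_Ioo_of_mem ht.2.le k)
    (indicator_Ioo_of_nonpos T h) (indicator_Ioo_of_nonpos T k)

theorem intervalIntegrable_cconv_of_bounded {B : ℝ} (hk : Measurable k)
    (hB : ∀ s ∈ Ioo 0 T, |k s| ≤ B) (hh : IntegrableOn h (Ioo 0 T)) (ht : t ∈ Ioc 0 T) :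
    IntervalIntegrable (fun s => k (t - s) * h s) volume 0 t := by
  rw [intervalIntegrable_iff_integrableOn_Ioo_of_le ht.1.le]
  refine Integrable.bdd_mul (c := B) (hh.mono_set (Ioo_subset_Ioo_right ht.2))
    (hk.comp (measurable_const.sub measurable_id)).aestronglyMeasurable ?_
  filter_upwards [ae_restrict_mem measurableSet_Ioo] with s hs
  exact hB _ ⟨by linarith [hs.2], by linarith [hs.1, ht.2]⟩

theorem cconv_add_right (i₁ : IntervalIntegrable (fun s => k (t - s) * h₁ s) volume 0 t)
    (i₂ : IntervalIntegrable (fun s => k (t - s) * h₂ s) volume 0 t) :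
    cconv k (fun s => h₁ s + h₂ s) t = cconv k h₁ t + cconv k h₂ t := by
  simp only [cconv, mul_add]
  exact intervalIntegral.integral_add i₁ i₂

theorem cconv_add_left (i₁ : IntervalIntegrable (fun s => k₁ (t - s) * h s) volume 0 t)
    (i₂ : IntervalIntegrable (fun s => k₂ (t - s) * h s) volume 0 t) :
    cconv (fun s => k₁ s + k₂ s) h t = cconv k₁ h t + cconv k₂ h t := by
  simp only [cconv, add_mul]
  exact intervalIntegral.integral_add i₁ i₂

theorem cconv_const_mul_right (c : ℝ) : cconv k (fun s => c * h s) t = c * cconv k h t := by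
  simp only [cconv, mul_left_comm _ c]
  exact intervalIntegral.integral_const_mul _ _

theorem cconv_const_mul_left (c : ℝ) : cconv (fun s => c * k s) h t = c * cconv k h t := by
  simp only [cconv, mul_assoc]
  exact intervalIntegral.integral_const_mul _ _

theorem cconv_one_left : cconv (fun _ => 1) h t = ∫ s in (0 : ℝ)..t, h s := by
  simp [cconv]

end cconv

/-! ### The scalar fractional relaxation equation -/

section modal

variable {α μ T t : ℝ}

/-- The solution `E(t) c + ∫₀ᵗ F(t-s) (a + ∫₀ˢ p) ds` of the relaxation equation
`∂ₜ^α y + μ y = a + ∫₀ᵗ p`, `y(0) = c`, after one integration by parts in the convolution. -/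
noncomputable def modal (α μ c a : ℝ) (p : ℝ → ℝ) (t : ℝ) : ℝ :=
  relaxKernel α μ 1 t * c + relaxKernel α μ (α + 1) t * a + cconv (relaxKernel α μ (α + 1)) p t

/-- The derivative of `modal`. -/
noncomputable def modalDeriv (α μ c a : ℝ) (p : ℝ → ℝ) (t : ℝ) : ℝ :=
  (a - μ * c) * relaxKernel α μ α t + cconv (relaxKernel α μ α) p t

theorem integrableOn_relaxKernel_Ioo {β : ℝ} (hα : 0 < α) (hβ : 0 < β) (μ T : ℝ) :
    IntegrableOn (relaxKernel α μ β) (Ioo 0 T) :=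
  (integrableOn_relaxKernel hα hβ μ T).mono_set Ioo_subset_Ioc_self

theorem abs_relaxKernel_one_le (hα : 0 < α) (hα1 : α < 1) (hμ : 0 ≤ μ) (t : ℝ) :
    |relaxKernel α μ 1 t| ≤ 1 := by
  rw [abs_of_nonneg (relaxKernel_one_nonneg hα hα1 μ t)]
  exact relaxKernel_one_le hα hα1 hμ t

theorem abs_relaxKernel_le (hα : 0 < α) (hα1 : α < 1) {m : ℝ} (hm : 0 ≤ m) (t : ℝ) :
    |relaxKernel α m α t| ≤ rlKernel α t := by
  rw [abs_of_nonneg (relaxKernel_nonneg hα hα1 m t)]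
  exact relaxKernel_le_rlKernel hα hα1 hm t

theorem rlKernel_add_one_mono (hα : 0 < α) {s : ℝ} (h0 : 0 < s) (hst : s ≤ t) :
    rlKernel (α + 1) s ≤ rlKernel (α + 1) t := by
  rw [rlKernel_of_pos h0, rlKernel_of_pos (h0.trans_le hst)]
  have := Real.Gamma_pos_of_pos (show 0 < α + 1 by linarith)
  gcongr
  linarith

theorem abs_relaxKernel_add_one_le (hα : 0 < α) (hα1 : α < 1) (hμ : 0 ≤ μ) {s : ℝ}
    (hs : s ∈ Ioc 0 T) : |relaxKernel α μ (α + 1) s| ≤ rlKernel (α + 1) T := by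
  rw [abs_of_nonneg (relaxKernel_add_nonneg hα hα1 μ one_pos s)]
  exact (relaxKernel_add_one_le hα hα1 hμ s).trans (rlKernel_add_one_mono hα hs.1 hs.2)

theorem cconv_one_relaxKernel (hα : 0 < α) (μ : ℝ) (ht : 0 < t) :
    cconv (fun _ => 1) (relaxKernel α μ α) t = relaxKernel α μ (α + 1) t := by
  rw [cconv_one_left, integral_relaxKernel hα hα μ ht]

theorem cconv_one_cconv_relaxKernel (hα : 0 < α) (μ : ℝ) {p : ℝ → ℝ}
    (hp : IntegrableOn p (Ioo 0 T)) (ht : t ∈ Ioc 0 T) :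
    cconv (fun _ => 1) (cconv (relaxKernel α μ α) p) t = cconv (relaxKernel α μ (α + 1)) p t := by
  rw [cconv_assoc_of_bounded (B := 1) ht (integrableOn_const (by simp))
    (integrableOn_relaxKernel_Ioo hα hα μ T) hp (Or.inl fun _ _ => by simp)]
  exact cconv_congr ⟨ht.1.le, ht.2⟩ (fun s hs => cconv_one_relaxKernel hα μ hs.1) EventuallyEq.rfl

theorem cconv_relaxKernel_primitive (hα : 0 < α) (μ : ℝ) {p : ℝ → ℝ}
    (hp : IntegrableOn p (Ioo 0 T)) (ht : t ∈ Ioc 0 T) :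
    cconv (relaxKernel α μ α) (fun s => ∫ r in (0 : ℝ)..s, p r) t =
      cconv (relaxKernel α μ (α + 1)) p t := by
  simp_rw [← cconv_one_left]
  change cconv (relaxKernel α μ α) (cconv (fun _ => 1) p) t = _
  rw [cconv_assoc_of_bounded (B := 1) ht (integrableOn_relaxKernel_Ioo hα hα μ T)
    (integrableOn_const (by simp)) hp (Or.inr fun _ _ => by simp)]
  exact cconv_congr ⟨ht.1.le, ht.2⟩
    (fun s hs => by rw [cconv_comm, cconv_one_relaxKernel hα μ hs.1]) EventuallyEq.rfl

/-- `modal` is the primitive of `modalDeriv` with value `c` at `0`: `∫₀ᵗ f = g(t)` and `e + μ g = 1`. -/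
theorem modal_eq_add_integral (hα : 0 < α) (c a : ℝ) {p : ℝ → ℝ} (hp : IntegrableOn p (Ioo 0 T))
    (ht : t ∈ Ioc 0 T) :
    modal α μ c a p t = c + ∫ s in (0 : ℝ)..t, modalDeriv α μ c a p s := by
  have i0 : IntervalIntegrable (relaxKernel α μ α) volume 0 t :=
    (intervalIntegrable_iff_integrableOn_Ioc_of_le ht.1.le).2 (integrableOn_relaxKernel hα hα μ t)
  have i2 : IntervalIntegrable (cconv (relaxKernel α μ α) p) volume 0 t :=
    (intervalIntegrable_iff_integrableOn_Ioo_of_le ht.1.le).2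
      ((integrableOn_cconv (integrableOn_relaxKernel_Ioo hα hα μ T) hp).mono_set
        (Ioo_subset_Ioo_right ht.2))
  unfold modalDeriv modal
  rw [intervalIntegral.integral_add (i0.const_mul _) i2, intervalIntegral.integral_const_mul,
    integral_relaxKernel hα hα μ ht.1, ← cconv_one_cconv_relaxKernel hα μ hp ht, cconv_one_left]
  linear_combination c * relaxKernel_one_add hα μ ht.1

/-- Integration by parts in the convolution turns `modal` into Duhamel's formula. -/
theorem modal_eq_duhamel (hα : 0 < α) (c a : ℝ) {p : ℝ → ℝ} (hp : IntegrableOn p (Ioo 0 T))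
    (ht : t ∈ Ioc 0 T) :
    modal α μ c a p t = relaxKernel α μ 1 t * c +
      cconv (relaxKernel α μ α) (fun s => a + ∫ r in (0 : ℝ)..s, p r) t := by
  have i0 : IntervalIntegrable (relaxKernel α μ α) volume 0 t :=
    (intervalIntegrable_iff_integrableOn_Ioc_of_le ht.1.le).2 (integrableOn_relaxKernel hα hα μ t)
  have hk := measurable_relaxKernel hα hα μ
  obtain ⟨B, hB⟩ := (isCompact_Icc (a := (0 : ℝ)) (b := T)).exists_bound_of_continuousOn
    (continuousOn_primitive hp)
  have i1 : IntervalIntegrable (fun s => relaxKernel α μ α (t - s)) volume 0 t := by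
    simpa using (i0.comp_sub_left t).symm
  have i2 : IntervalIntegrable (fun s => relaxKernel α μ α (t - s) * ∫ r in (0 : ℝ)..s, p r)
      volume 0 t := by
    rw [intervalIntegrable_iff_integrableOn_Ioo_of_le ht.1.le] at i1 ⊢
    refine Integrable.mul_bdd (c := B) i1
      ((integrableOn_primitive hp).mono_set (Ioo_subset_Ioo_right ht.2)).1 ?_
    filter_upwards [ae_restrict_mem measurableSet_Ioo] with s hs
    exact hB s ⟨hs.1.le, hs.2.le.trans ht.2⟩
  rw [cconv_add_right (h₁ := fun _ => a) (i1.mul_const a) i2, cconv_relaxKernel_primitive hα μ hp ht]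
  have h1 : cconv (relaxKernel α μ α) (fun _ => a) t = relaxKernel α μ (α + 1) t * a := by
    rw [cconv_comm]
    simp only [cconv]
    rw [intervalIntegral.integral_const_mul, integral_relaxKernel hα hα μ ht.1, mul_comm]
  rw [h1, modal, add_assoc]

theorem cconv_rlKernel_relaxKernel_self (hα : 0 < α) (hα1 : α < 1) (μ : ℝ) (ht : 0 < t) :
    cconv (rlKernel (1 - α)) (relaxKernel α μ α) t = relaxKernel α μ 1 t := by
  rw [(cconv_rlKernel_relaxKernel hα hα (sub_pos.2 hα1) μ ht).2, add_sub_cancel]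

/-- The identity `e + μ g = 1` of the kernels, convolved with `p`. -/
theorem cconv_relaxKernel_one_add (hα : 0 < α) (hα1 : α < 1) (hμ : 0 ≤ μ) {p : ℝ → ℝ}
    (hp : IntegrableOn p (Ioo 0 T)) (ht : t ∈ Ioc 0 T) :
    cconv (relaxKernel α μ 1) p t + μ * cconv (relaxKernel α μ (α + 1)) p t =
      ∫ s in (0 : ℝ)..t, p s := by
  rw [← cconv_const_mul_left, ← cconv_add_left, ← cconv_one_left]
  · exact cconv_congr ⟨ht.1.le, ht.2⟩ (fun s hs => relaxKernel_one_add hα μ hs.1) EventuallyEq.rfl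
  · exact intervalIntegrable_cconv_of_bounded (measurable_relaxKernel hα one_pos μ)
      (fun s _ => abs_relaxKernel_one_le hα hα1 hμ s) hp ht
  · have := (intervalIntegrable_cconv_of_bounded (measurable_relaxKernel hα (by linarith) μ)
      (fun s hs => abs_relaxKernel_add_one_le hα hα1 hμ ⟨hs.1, hs.2.le⟩) hp ht).const_mul μ
    simpa only [mul_assoc] using this

/-- `modal` solves the relaxation equation: `κ_{1-α} * f = e`, and `e + μ g = 1`. -/
theorem ae_modal_equation (hα : 0 < α) (hα1 : α < 1) (hμ : 0 ≤ μ) (c a : ℝ) {p : ℝ → ℝ}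
    (hp : IntegrableOn p (Ioo 0 T)) :
    ∀ᵐ t ∂(volume.restrict (Ioo 0 T)),
      cconv (rlKernel (1 - α)) (modalDeriv α μ c a p) t + μ * modal α μ c a p t =
        a + ∫ s in (0 : ℝ)..t, p s := by
  have hκ := integrableOn_rlKernel (sub_pos.2 hα1) T
  have hf := integrableOn_relaxKernel_Ioo hα hα μ T
  filter_upwards [ae_restrict_mem measurableSet_Ioo, ae_cconv_assoc hκ hf hp,
    ae_intervalIntegrable_cconv hκ (integrableOn_cconv hf hp)] with t ht h1 h2
  have ht' : t ∈ Ioc 0 T := ⟨ht.1, ht.2.le⟩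
  have i1 : IntervalIntegrable
      (fun s => rlKernel (1 - α) (t - s) * ((a - μ * c) * relaxKernel α μ α s)) volume 0 t := by
    have := ((intervalIntegrable_iff_integrableOn_Ioc_of_le ht.1.le).2
      (cconv_rlKernel_relaxKernel hα hα (sub_pos.2 hα1) μ ht.1).1).const_mul (a - μ * c)
    simpa only [mul_left_comm] using this
  have h3 : cconv (cconv (rlKernel (1 - α)) (relaxKernel α μ α)) p t =
      cconv (relaxKernel α μ 1) p t :=
    cconv_congr ⟨ht.1.le, ht.2.le⟩
      (fun s hs => cconv_rlKernel_relaxKernel_self hα hα1 μ hs.1) EventuallyEq.rfl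
  have h4 := cconv_relaxKernel_one_add hα hα1 hμ hp ht'
  have h5 := relaxKernel_one_add hα μ ht.1
  have h6 : cconv (rlKernel (1 - α)) (modalDeriv α μ c a p) t =
      (a - μ * c) * relaxKernel α μ 1 t + cconv (relaxKernel α μ 1) p t := by
    unfold modalDeriv
    rw [cconv_add_right i1 h2, cconv_const_mul_right, cconv_rlKernel_relaxKernel_self hα hα1 μ ht.1,
      h1, h3]
  rw [h6, modal]
  linear_combination h4 + a * h5

/-- The homogeneous relaxation equation has only the zero solution: convolve it with
`t^(α-1) E_{α,α}(-μ t^α)`. -/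
theorem ae_eq_zero_of_relaxation (hα : 0 < α) (hα1 : α < 1) (hμ : 0 ≤ μ) {p : ℝ → ℝ}
    (hp : IntegrableOn p (Ioo 0 T))
    (h : ∀ᵐ t ∂(volume.restrict (Ioo 0 T)),
      cconv (rlKernel (1 - α)) p t + μ * ∫ s in (0 : ℝ)..t, p s = 0) :
    ∀ᵐ t ∂(volume.restrict (Ioo 0 T)), ∫ s in (0 : ℝ)..t, p s = 0 := by
  have hκ := integrableOn_rlKernel (sub_pos.2 hα1) T
  have hf := integrableOn_relaxKernel_Ioo hα hα μ T
  filter_upwards [ae_restrict_mem measurableSet_Ioo, ae_cconv_assoc hf hκ hp,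
    ae_intervalIntegrable_cconv hf (integrableOn_cconv hκ hp),
    ae_intervalIntegrable_cconv hf ((integrableOn_primitive hp).const_mul μ)] with t ht h1 h2 h3
  have ht' : t ∈ Ioc 0 T := ⟨ht.1, ht.2.le⟩
  have h4 : cconv (relaxKernel α μ α)
      (fun t => cconv (rlKernel (1 - α)) p t + μ * ∫ s in (0 : ℝ)..t, p s) t =
      cconv (relaxKernel α μ α) (fun _ => 0) t :=
    cconv_congr ⟨ht.1.le, ht.2.le⟩ (fun _ _ => rfl) h
  have h5 : cconv (relaxKernel α μ α) (fun _ => 0) t = 0 := by simp [cconv]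
  have h6 : cconv (cconv (relaxKernel α μ α) (rlKernel (1 - α))) p t = cconv (relaxKernel α μ 1) p t :=
    cconv_congr ⟨ht.1.le, ht.2.le⟩
      (fun s hs => by rw [cconv_comm, cconv_rlKernel_relaxKernel_self hα hα1 μ hs.1]) EventuallyEq.rfl
  rw [cconv_add_right h2 h3, h5, cconv_const_mul_right, h1, h6,
    cconv_relaxKernel_primitive hα μ hp ht', cconv_relaxKernel_one_add hα hα1 hμ hp ht'] at h4
  exact h4

end modal

/-! ### Majorants uniform in the eigenvalue -/

section bounds

variable {α μ T t : ℝ}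

/-- The majorant of `√(1+μ) E_{α,1}(-μ t^α)`, uniform in `μ ≥ 0`. -/
noncomputable def smoothingBound (α t : ℝ) : ℝ := 1 + √(Real.Gamma (α + 1)) * t ^ (-(α / 2))

/-- The majorant of `√μ t^(α-1) E_{α,α}(-μ t^α)`, uniform in `μ ≥ 0`. -/
noncomputable def derivBound (α t : ℝ) : ℝ := √(α / Real.Gamma α) * t ^ (α / 2 - 1)

theorem integrableOn_rpow {r : ℝ} (hr : -1 < r) (T : ℝ) : IntegrableOn (fun t : ℝ => t ^ r) (Ioo 0 T) := by
  rcases le_or_gt T 0 with hT | hT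
  · simp [Ioo_eq_empty (not_lt.2 hT)]
  · exact (intervalIntegrable_iff_integrableOn_Ioo_of_le hT.le).1
      (intervalIntegral.intervalIntegrable_rpow' hr)

theorem integrableOn_smoothingBound (hα1 : α < 1) (T : ℝ) :
    IntegrableOn (smoothingBound α) (Ioo 0 T) :=
  (integrableOn_const (by simp)).add ((integrableOn_rpow (by linarith) T).const_mul _)

theorem integrableOn_derivBound (hα : 0 < α) (T : ℝ) : IntegrableOn (derivBound α) (Ioo 0 T) :=
  (integrableOn_rpow (by linarith) T).const_mul _

/-- From `0 ≤ e ≤ 1` and `μ e κ_{α+1} ≤ 1` one gets `(1+μ) e² ≤ 1 + 1 / κ_{α+1}(t)`. -/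
theorem abs_sqrt_mul_relaxKernel_one_le (hα : 0 < α) (hα1 : α < 1) (hμ : 0 ≤ μ) (ht : 0 < t) :
    |√(1 + μ) * relaxKernel α μ 1 t| ≤ smoothingBound α t := by
  have hΓ := Real.Gamma_pos_of_pos (show 0 < α + 1 by linarith)
  have e0 := relaxKernel_one_nonneg hα hα1 μ t
  have e1 := relaxKernel_one_le hα hα1 hμ t
  have e2 := mul_relaxKernel_one_le hα hα1 hμ ht
  rw [rlKernel_of_pos ht, add_sub_cancel_right] at e2
  set e := relaxKernel α μ 1 t
  set q := √(Real.Gamma (α + 1)) * t ^ (-(α / 2)) with hq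
  have hq0 : 0 ≤ q := by positivity
  have hqq : q ^ 2 * (t ^ α / Real.Gamma (α + 1)) = 1 := by
    rw [hq, mul_pow, Real.sq_sqrt hΓ.le, ← Real.rpow_natCast, ← Real.rpow_mul ht.le]
    have : t ^ (-(α / 2) * (2 : ℕ)) * t ^ α = 1 := by
      rw [← Real.rpow_add ht]
      have : -(α / 2) * (2 : ℕ) + α = 0 := by push_cast; ring
      rw [this, Real.rpow_zero]
    calc Real.Gamma (α + 1) * t ^ (-(α / 2) * (2 : ℕ)) * (t ^ α / Real.Gamma (α + 1))
        = t ^ (-(α / 2) * (2 : ℕ)) * t ^ α * (Real.Gamma (α + 1) / Real.Gamma (α + 1)) := by ring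
      _ = 1 := by rw [this, div_self hΓ.ne', one_mul]
  have hκ : 0 < t ^ α / Real.Gamma (α + 1) := by positivity
  have hμe : μ * e ≤ q ^ 2 := by
    by_contra! hlt
    have := mul_lt_mul_of_pos_right hlt hκ
    linarith
  change _ ≤ 1 + q
  rw [abs_of_nonneg (by positivity)]
  refine (abs_le_of_sq_le_sq' ?_ (by positivity)).2
  rw [mul_pow, Real.sq_sqrt (by positivity)]
  have h1 : e ^ 2 ≤ 1 := by nlinarith
  have h2 : μ * e * e ≤ q ^ 2 * 1 := by gcongr
  nlinarith

theorem abs_mul_relaxKernel_add_one_le (hα : 0 < α) (hα1 : α < 1) (hμ : 0 ≤ μ) (ht : t ∈ Ioc 0 T) :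
    |(1 + μ) * relaxKernel α μ (α + 1) t| ≤ rlKernel (α + 1) T + 1 := by
  have h1 := abs_relaxKernel_add_one_le hα hα1 hμ ht
  have h2 := mul_relaxKernel_add_one_le hα hα1 μ t
  have h0 := relaxKernel_add_nonneg hα hα1 μ one_pos t
  rw [abs_of_nonneg h0] at h1
  rw [abs_of_nonneg (by positivity)]
  linarith

/-- The square of the left-hand side is at most `μ f²`, a product of `μ t f ≤ α` and `f ≤ κ_α`, up to
the factor `1 / t`. -/
theorem abs_div_sqrt_mul_relaxKernel_le (hα : 0 < α) (hα1 : α < 1) (hμ : 0 ≤ μ) (ht : 0 < t) :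
    |μ / √(1 + μ) * relaxKernel α μ α t| ≤ derivBound α t := by
  have hΓ := Real.Gamma_pos_of_pos hα
  have f0 := relaxKernel_nonneg hα hα1 μ t
  have f1 := relaxKernel_le_rlKernel hα hα1 hμ t
  have f2 := mul_mul_relaxKernel_le hα hα1 hμ ht
  rw [rlKernel_of_pos ht] at f1
  set f := relaxKernel α μ α t
  rw [abs_of_nonneg (by positivity)]
  refine (abs_le_of_sq_le_sq' ?_ (by unfold derivBound; positivity)).2
  have h1 : (μ / √(1 + μ) * f) ^ 2 ≤ μ * f ^ 2 := by
    rw [mul_pow, div_pow, Real.sq_sqrt (by positivity)]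
    gcongr
    rw [div_le_iff₀ (by positivity)]
    nlinarith
  have h2 : t * (μ * f ^ 2) ≤ α * (t ^ (α - 1) / Real.Gamma α) := by
    calc t * (μ * f ^ 2) = μ * (t * f) * f := by ring
      _ ≤ α * (t ^ (α - 1) / Real.Gamma α) := by gcongr
  have h3 : derivBound α t ^ 2 * t = α * (t ^ (α - 1) / Real.Gamma α) := by
    rw [derivBound, mul_pow, Real.sq_sqrt (by positivity), ← Real.rpow_natCast, ← Real.rpow_mul ht.le,
      mul_assoc, ← Real.rpow_add_one ht.ne']
    have : (α / 2 - 1) * (2 : ℕ) + 1 = α - 1 := by push_cast; ring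
    rw [this]; ring
  refine h1.trans ?_
  by_contra! hlt
  have := mul_lt_mul_of_pos_right hlt ht
  linarith

end bounds

/-! ### Synthesis and analysis operators of Bessel sequences -/

section bessel

variable {E : Type*} [NormedAddCommGroup E] [NormedSpace ℝ E] {p : ℕ → E} {K : ℝ}

/-- A Bessel sequence with bound `K`: finite combinations satisfy `‖∑ xⱼ pⱼ‖ ≤ K ‖x‖_{ℓ²}`. -/
structure IsBessel (p : ℕ → E) (K : ℝ) : Prop where
  nonneg : 0 ≤ K
  norm_sum_sq_le : ∀ (s : Finset ℕ) (x : ℕ → ℝ),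
    ‖∑ j ∈ s, x j • p j‖ ^ 2 ≤ K ^ 2 * ∑ j ∈ s, x j ^ 2

theorem IsBessel.summable [CompleteSpace E] (hp : IsBessel p K) (x : Ell2) :
    Summable fun j => x j • p j := by
  rw [summable_iff_vanishing_norm]
  intro ε hε
  have hK : 0 < K + 1 := by linarith [hp.nonneg]
  obtain ⟨s, hs⟩ := summable_iff_vanishing_norm.1 x.hasSum_sq.summable ((ε / (K + 1)) ^ 2) (by positivity)
  refine ⟨s, fun t ht => ?_⟩
  have h1 := hs t ht
  rw [Real.norm_of_nonneg (by positivity)] at h1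
  have h2 := hp.norm_sum_sq_le t x
  have h3 : K ^ 2 * ∑ j ∈ t, x j ^ 2 < ε ^ 2 := by
    calc K ^ 2 * ∑ j ∈ t, x j ^ 2 ≤ (K + 1) ^ 2 * ∑ j ∈ t, x j ^ 2 := by
          gcongr
          · exact hp.nonneg
          · linarith
      _ < (K + 1) ^ 2 * (ε / (K + 1)) ^ 2 := by gcongr
      _ = ε ^ 2 := by field_simp
  exact (abs_lt_of_sq_lt_sq' (h2.trans_lt h3) hε.le).2

theorem IsBessel.norm_tsum_le [CompleteSpace E] (hp : IsBessel p K) (x : Ell2) :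
    ‖∑' j, x j • p j‖ ≤ K * ‖x‖ := by
  refine le_of_tendsto ((hp.summable x).hasSum.norm) (Eventually.of_forall fun s => ?_)
  refine (abs_le_of_sq_le_sq' ?_ (mul_nonneg hp.nonneg (norm_nonneg _))).2
  refine (hp.norm_sum_sq_le s x).trans ?_
  rw [mul_pow]
  gcongr
  exact x.sum_sq_le s

open Classical in
/-- The synthesis operator `x ↦ ∑ xⱼ pⱼ` on `ℓ²`, defined to be zero if `p` is not a Bessel
sequence. -/
noncomputable def synthesis [CompleteSpace E] (p : ℕ → E) : Ell2 →L[ℝ] E :=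
  if h : ∃ K, IsBessel p K then
    LinearMap.mkContinuousOfExistsBound
      { toFun := fun x => ∑' j, x j • p j
        map_add' := fun x y => by
          rw [← (h.choose_spec.summable x).tsum_add (h.choose_spec.summable y)]
          exact tsum_congr fun j => add_smul _ _ _
        map_smul' := fun c x => by
          rw [RingHom.id_apply, ← (h.choose_spec.summable x).tsum_const_smul]
          exact tsum_congr fun j => mul_smul _ _ _ }
      ⟨h.choose, h.choose_spec.norm_tsum_le⟩
  else 0

theorem IsBessel.synthesis_apply [CompleteSpace E] (hp : IsBessel p K) (x : Ell2) :
    synthesis p x = ∑' j, x j • p j := by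
  unfold synthesis
  rw [dif_pos ⟨K, hp⟩]
  rfl

theorem IsBessel.hasSum_synthesis [CompleteSpace E] (hp : IsBessel p K) (x : Ell2) :
    HasSum (fun j => x j • p j) (synthesis p x) := by
  rw [hp.synthesis_apply]
  exact (hp.summable x).hasSum

theorem IsBessel.norm_synthesis_le [CompleteSpace E] (hp : IsBessel p K) (x : Ell2) :
    ‖synthesis p x‖ ≤ K * ‖x‖ := by
  rw [hp.synthesis_apply]
  exact hp.norm_tsum_le x

/-- The dual form of the Bessel bound, obtained by testing with `∑ h(pⱼ) pⱼ`. -/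
theorem IsBessel.sum_sq_apply_le (hp : IsBessel p K) (h : StrongDual ℝ E) (s : Finset ℕ) :
    ∑ j ∈ s, h (p j) ^ 2 ≤ (K * ‖h‖) ^ 2 := by
  set q := ∑ j ∈ s, h (p j) ^ 2 with hq
  have hq0 : 0 ≤ q := by positivity
  have h1 := hp.norm_sum_sq_le s fun j => h (p j)
  have h2 : h (∑ j ∈ s, h (p j) • p j) = q := by
    rw [map_sum, hq]
    exact Finset.sum_congr rfl fun j _ => by rw [map_smul, smul_eq_mul, sq]
  have h3 := h.le_opNorm (∑ j ∈ s, h (p j) • p j)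
  rw [h2, Real.norm_of_nonneg hq0] at h3
  have h4 : q ^ 2 ≤ ‖h‖ ^ 2 * (K ^ 2 * q) := by
    calc q ^ 2 ≤ (‖h‖ * ‖∑ j ∈ s, h (p j) • p j‖) ^ 2 := by gcongr
      _ = ‖h‖ ^ 2 * ‖∑ j ∈ s, h (p j) • p j‖ ^ 2 := mul_pow _ _ _
      _ ≤ _ := by gcongr
  rcases hq0.eq_or_lt with h0 | h0
  · rw [← h0]; positivity
  · refine le_of_mul_le_mul_right ?_ h0
    linarith [mul_pow K ‖h‖ 2]

open Classical in
/-- The analysis operator `h ↦ (h(pⱼ))` on the dual, defined to be zero if `p` is not a Bessel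
sequence. -/
noncomputable def analysis (p : ℕ → E) : StrongDual ℝ E →L[ℝ] Ell2 :=
  if h : ∃ K, IsBessel p K then
    LinearMap.mkContinuousOfExistsBound
      { toFun := fun g => ⟨fun j => g (p j), memℓp_of_sum_sq_le (h.choose_spec.sum_sq_apply_le g)⟩
        map_add' := fun _ _ => rfl
        map_smul' := fun _ _ => rfl }
      ⟨h.choose, fun g => Ell2.norm_le (mul_nonneg h.choose_spec.nonneg (norm_nonneg _))
        (h.choose_spec.sum_sq_apply_le g)⟩
  else 0

theorem IsBessel.analysis_apply (hp : IsBessel p K) (h : StrongDual ℝ E) (j : ℕ) :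
    analysis p h j = h (p j) := by
  unfold analysis
  rw [dif_pos ⟨K, hp⟩]
  rfl

theorem IsBessel.norm_analysis_le (hp : IsBessel p K) (h : StrongDual ℝ E) :
    ‖analysis p h‖ ≤ K * ‖h‖ :=
  Ell2.norm_le (mul_nonneg hp.nonneg (norm_nonneg _)) fun s => by
    simp_rw [hp.analysis_apply]
    exact hp.sum_sq_apply_le h s

end bessel

/-! ### Expansions in the eigenfunctions -/

section duality

variable {Ω : Set Plane}

theorem vToDual_apply (v w : V Ω) : vToDual v w = inner ℝ (toL2 Ω v) (toL2 Ω w) := rfl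

theorem toDual_apply (g : L2 Ω) (w : V Ω) : toDual g w = inner ℝ g (toL2 Ω w) := rfl

theorem vToDual_injective {v w : V Ω} (hΩ : IsOpen Ω) (h : vToDual v = vToDual w) : v = w := by
  rw [← sub_eq_zero]
  refine toL2_injective hΩ ?_
  have h1 := congrArg (fun g : VDual Ω => g (v - w)) h
  simp only [vToDual_apply] at h1
  rw [← sub_eq_zero, ← inner_sub_left, ← map_sub] at h1
  exact inner_self_eq_zero.1 h1

end duality

namespace IsEigenbasis

variable {Ω : Set Plane} {μ : ℕ → ℝ} {φ : ℕ → V Ω}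

/-- The eigenfunctions normalized in `V`, up to equivalence of norms. -/
noncomputable def vBasis (μ : ℕ → ℝ) (φ : ℕ → V Ω) (j : ℕ) : V Ω := (√(1 + μ j))⁻¹ • φ j

/-- The eigenfunctions normalized in `V*`, up to equivalence of norms. -/
noncomputable def dBasis (μ : ℕ → ℝ) (φ : ℕ → V Ω) (j : ℕ) : VDual Ω := √(1 + μ j) • vToDual (φ j)

theorem inner_phi (h : IsEigenbasis Ω μ φ) (i j : ℕ) :
    inner ℝ (toL2 Ω (φ i)) (toL2 Ω (φ j)) = if i = j then 1 else 0 :=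
  orthonormal_iff_ite.1 h.orthonormal i j

theorem sqrt_pos (h : IsEigenbasis Ω μ φ) (j : ℕ) : 0 < √(1 + μ j) :=
  Real.sqrt_pos.2 (by linarith [h.pos j])

theorem sq_sqrt (h : IsEigenbasis Ω μ φ) (j : ℕ) : √(1 + μ j) ^ 2 = 1 + μ j :=
  Real.sq_sqrt (by linarith [h.pos j])

theorem toL2_sum (s : Finset ℕ) (c : ℕ → ℝ) :
    toL2 Ω (∑ j ∈ s, c j • φ j) = ∑ j ∈ s, c j • toL2 Ω (φ j) := by
  simp

theorem bform_sum_left (h : IsEigenbasis Ω μ φ) (s : Finset ℕ) (c : ℕ → ℝ) (v : V Ω) :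
    bform (∑ j ∈ s, c j • φ j) v = ∑ j ∈ s, c j * (μ j * inner ℝ (toL2 Ω (φ j)) (toL2 Ω v)) := by
  rw [← bformL_apply, map_sum, _root_.sum_apply]
  refine Finset.sum_congr rfl fun j _ => ?_
  rw [map_smul, _root_.smul_apply, bformL_apply, h.eigen, smul_eq_mul]

theorem inner_sum_phi (h : IsEigenbasis Ω μ φ) {s : Finset ℕ} (c : ℕ → ℝ) {i : ℕ} (hi : i ∈ s) :
    inner ℝ (toL2 Ω (φ i)) (toL2 Ω (∑ j ∈ s, c j • φ j)) = c i := by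
  rw [toL2_sum, h.orthonormal.inner_right_sum c hi]

/-- Parseval's identity for the energy of a finite combination of eigenfunctions. -/
theorem energy_sum (h : IsEigenbasis Ω μ φ) (s : Finset ℕ) (c : ℕ → ℝ) :
    ‖toL2 Ω (∑ j ∈ s, c j • φ j)‖ ^ 2 + bform (∑ j ∈ s, c j • φ j) (∑ j ∈ s, c j • φ j) =
      ∑ j ∈ s, (1 + μ j) * c j ^ 2 := by
  rw [h.bform_sum_left, ← real_inner_self_eq_norm_sq]
  nth_rw 1 [toL2_sum]
  rw [sum_inner, ← Finset.sum_add_distrib]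
  refine Finset.sum_congr rfl fun j hj => ?_
  rw [real_inner_smul_left, h.inner_sum_phi c hj]
  ring

/-- Bessel's inequality for the energy. -/
theorem sum_mul_inner_sq_le (h : IsEigenbasis Ω μ φ) (s : Finset ℕ) (v : V Ω) :
    ∑ j ∈ s, (1 + μ j) * inner ℝ (toL2 Ω (φ j)) (toL2 Ω v) ^ 2 ≤ ‖v‖ ^ 2 := by
  refine le_trans ?_ (norm_toL2_sq_add_bform_le v)
  set c : ℕ → ℝ := fun j => inner ℝ (toL2 Ω (φ j)) (toL2 Ω v) with hc
  set w := ∑ j ∈ s, c j • φ j with hw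
  have h1 : 0 ≤ bform (v - w) (v - w) := bform_self_nonneg _
  have h2 : bform (v - w) (v - w) = bform v v - 2 * bform w v + bform w w := by
    have e1 := bform_comm v w
    simp only [← bformL_apply] at e1 ⊢
    simp only [map_sub, _root_.sub_apply]
    linarith
  have h3 : 0 ≤ ‖toL2 Ω (v - w)‖ ^ 2 := sq_nonneg _
  rw [map_sub, norm_sub_sq_real] at h3
  have h4 : inner ℝ (toL2 Ω v) (toL2 Ω w) = ∑ j ∈ s, c j * c j := by
    rw [real_inner_comm, hw, toL2_sum, sum_inner]
    exact Finset.sum_congr rfl fun j _ => by rw [real_inner_smul_left]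
  have h5 := h.energy_sum s c
  have h6 := h.bform_sum_left s c v
  rw [← hw] at h5 h6
  have h7 : ∑ j ∈ s, (1 + μ j) * c j ^ 2 =
      (∑ j ∈ s, c j * c j) + ∑ j ∈ s, c j * (μ j * inner ℝ (toL2 Ω (φ j)) (toL2 Ω v)) := by
    rw [← Finset.sum_add_distrib]
    refine Finset.sum_congr rfl fun j _ => ?_
    simp only [hc]; ring
  change ∑ j ∈ s, (1 + μ j) * c j ^ 2 ≤ _
  linarith

/-- The eigenfunctions are orthogonal for the energy `(v,w) + a(v,w)`, which is equivalent to the squared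
norm of `V` with a constant independent of `Ω`. -/
theorem isBessel_V (h : IsEigenbasis Ω μ φ) : IsBessel (vBasis μ φ) 2 := by
  refine ⟨zero_le_two, fun s x => ?_⟩
  have h1 : ∑ j ∈ s, x j • vBasis μ φ j = ∑ j ∈ s, (x j * (√(1 + μ j))⁻¹) • φ j :=
    Finset.sum_congr rfl fun j _ => by rw [vBasis, smul_smul]
  have h2 : ∑ j ∈ s, (1 + μ j) * (x j * (√(1 + μ j))⁻¹) ^ 2 = ∑ j ∈ s, x j ^ 2 := by
    refine Finset.sum_congr rfl fun j _ => ?_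
    have := h.pos j
    rw [mul_pow, inv_pow, h.sq_sqrt]
    field_simp
  rw [h1]
  refine (norm_sq_le _).trans ?_
  rw [h.energy_sum, h2]
  have : 0 ≤ ∑ j ∈ s, x j ^ 2 := by positivity
  linarith

/-- By duality this is Bessel's inequality for the energy. -/
theorem isBessel_VDual (h : IsEigenbasis Ω μ φ) : IsBessel (dBasis μ φ) 1 := by
  refine ⟨zero_le_one, fun s x => ?_⟩
  rw [one_pow, one_mul]
  have hS : 0 ≤ ∑ j ∈ s, x j ^ 2 := by positivity
  have h1 : ‖∑ j ∈ s, x j • dBasis μ φ j‖ ≤ √(∑ j ∈ s, x j ^ 2) := by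
    refine ContinuousLinearMap.opNorm_le_bound _ (Real.sqrt_nonneg _) fun v => ?_
    have h2 : (∑ j ∈ s, x j • dBasis μ φ j) v =
        ∑ j ∈ s, x j * (√(1 + μ j) * inner ℝ (toL2 Ω (φ j)) (toL2 Ω v)) := by
      rw [_root_.sum_apply]
      rfl
    have h3 := Finset.sum_mul_sq_le_sq_mul_sq s x
      fun j => √(1 + μ j) * inner ℝ (toL2 Ω (φ j)) (toL2 Ω v)
    simp_rw [mul_pow, h.sq_sqrt] at h3
    rw [h2, Real.norm_eq_abs]
    refine abs_le_of_sq_le_sq ?_ (by positivity)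
    rw [mul_pow, Real.sq_sqrt hS]
    refine h3.trans ?_
    gcongr
    exact h.sum_mul_inner_sq_le s v
  calc _ ≤ √(∑ j ∈ s, x j ^ 2) ^ 2 := by gcongr
    _ = _ := Real.sq_sqrt hS

/-- The eigenfunctions as a Hilbert basis of `L²(Ω)`. -/
noncomputable def hilbertBasis (h : IsEigenbasis Ω μ φ) : HilbertBasis ℕ ℝ (L2 Ω) :=
  HilbertBasis.mk h.orthonormal h.complete.ge

theorem hilbertBasis_apply (h : IsEigenbasis Ω μ φ) (j : ℕ) : h.hilbertBasis j = toL2 Ω (φ j) := by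
  rw [hilbertBasis, HilbertBasis.coe_mk]

theorem repr_apply (h : IsEigenbasis Ω μ φ) (g : L2 Ω) (j : ℕ) :
    h.hilbertBasis.repr g j = inner ℝ (toL2 Ω (φ j)) g := by
  rw [HilbertBasis.repr_apply_apply, hilbertBasis_apply]

/-- Every `v ∈ V` is the sum of its eigenfunction expansion, in `V`. -/
theorem hasSum_expansion (h : IsEigenbasis Ω μ φ) (hΩ : IsOpen Ω) (v : V Ω) :
    HasSum (fun j => inner ℝ (toL2 Ω (φ j)) (toL2 Ω v) • φ j) v := by
  let x : Ell2 := ⟨fun j => √(1 + μ j) * inner ℝ (toL2 Ω (φ j)) (toL2 Ω v),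
    memℓp_of_sum_sq_le (C := ‖v‖ ^ 2) fun s => by
      simp_rw [mul_pow, h.sq_sqrt]
      exact h.sum_mul_inner_sq_le s v⟩
  have h1 : HasSum (fun j => inner ℝ (toL2 Ω (φ j)) (toL2 Ω v) • φ j) (synthesis (vBasis μ φ) x) := by
    refine (h.isBessel_V.hasSum_synthesis x).congr_fun fun j => ?_
    change _ = (√(1 + μ j) * inner ℝ (toL2 Ω (φ j)) (toL2 Ω v)) • (√(1 + μ j))⁻¹ • φ j
    rw [smul_smul, mul_right_comm, mul_inv_cancel₀ (h.sqrt_pos j).ne', one_mul]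
  have h2 : toL2 Ω (synthesis (vBasis μ φ) x) = toL2 Ω v := by
    have h3 := h.hilbertBasis.hasSum_repr (toL2 Ω v)
    have h4 := (toL2 Ω).hasSum h1
    simp only [map_smul] at h4
    simp only [h.repr_apply, h.hilbertBasis_apply] at h3
    exact h4.unique h3
  have h5 : synthesis (vBasis μ φ) x = v := by
    rw [← sub_eq_zero]
    exact toL2_injective hΩ (by rw [map_sub, h2, sub_self])
  rwa [h5] at h1

/-- Elements of `V*` are determined by their values at the eigenfunctions. -/
theorem dual_ext (h : IsEigenbasis Ω μ φ) (hΩ : IsOpen Ω) {g k : VDual Ω}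
    (H : ∀ j, g (φ j) = k (φ j)) : g = k := by
  ext v
  have h1 := g.hasSum (h.hasSum_expansion hΩ v)
  have h2 := k.hasSum (h.hasSum_expansion hΩ v)
  simp only [map_smul, H] at h1 h2
  exact h1.unique h2

theorem synthesis_dBasis_apply (h : IsEigenbasis Ω μ φ) (x : Ell2) (i : ℕ) :
    synthesis (dBasis μ φ) x (φ i) = √(1 + μ i) * x i := by
  have h1 := (ContinuousLinearMap.apply ℝ ℝ (φ i)).hasSum (h.isBessel_VDual.hasSum_synthesis x)
  refine h1.unique ?_
  have h2 : ∀ j, ContinuousLinearMap.apply ℝ ℝ (φ i) (x j • dBasis μ φ j) =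
      if j = i then √(1 + μ i) * x i else 0 := by
    intro j
    change x j * (√(1 + μ j) * inner ℝ (toL2 Ω (φ j)) (toL2 Ω (φ i))) = _
    rw [h.inner_phi]
    split_ifs with hji
    · rw [hji]; ring
    · simp
  simp_rw [h2]
  exact hasSum_ite_eq i _

theorem inner_synthesis_vBasis (h : IsEigenbasis Ω μ φ) (x : Ell2) (i : ℕ) :
    inner ℝ (toL2 Ω (φ i)) (toL2 Ω (synthesis (vBasis μ φ) x)) = (√(1 + μ i))⁻¹ * x i := by
  have h1 := (vToDual (φ i)).hasSum (h.isBessel_V.hasSum_synthesis x)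
  refine h1.unique ?_
  have h2 : ∀ j, vToDual (φ i) (x j • vBasis μ φ j) =
      if j = i then (√(1 + μ i))⁻¹ * x i else 0 := by
    intro j
    rw [vBasis, map_smul, map_smul, vToDual_apply, h.inner_phi]
    split_ifs with h3 h4 h4
    · rw [h3]; simp [mul_comm]
    · exact absurd h3.symm h4
    · exact absurd h4.symm h3
    · simp
  simp_rw [h2]
  exact hasSum_ite_eq i _

theorem analysis_vBasis_apply (h : IsEigenbasis Ω μ φ) (g : VDual Ω) (j : ℕ) :
    analysis (vBasis μ φ) g j = (√(1 + μ j))⁻¹ * g (φ j) := by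
  rw [h.isBessel_V.analysis_apply, vBasis, map_smul, smul_eq_mul]

theorem bform_phi_right (h : IsEigenbasis Ω μ φ) (v : V Ω) (j : ℕ) :
    bform v (φ j) = μ j * inner ℝ (toL2 Ω (φ j)) (toL2 Ω v) := by
  rw [bform_comm, h.eigen]

/-! ### The solution operators -/

variable {α : ℝ}

/-- The operator `E(t)` on `L²(Ω)`. -/
noncomputable def homOp (h : IsEigenbasis Ω μ φ) (α t : ℝ) : L2 Ω →L[ℝ] L2 Ω :=
  (h.hilbertBasis.repr.symm : Ell2 →L[ℝ] L2 Ω) ∘L diagOp (fun j => relaxKernel α (μ j) 1 t) ∘L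
    (h.hilbertBasis.repr : L2 Ω →L[ℝ] Ell2)

/-- The operator `F(t)` on `V*`. -/
noncomputable def duhamelOp (μ : ℕ → ℝ) (φ : ℕ → V Ω) (α t : ℝ) : VDual Ω →L[ℝ] VDual Ω :=
  synthesis (dBasis μ φ) ∘L diagOp (fun j => relaxKernel α (μ j) α t) ∘L analysis (vBasis μ φ)

theorem hasSum_homOp (h : IsEigenbasis Ω μ φ) (hα : 0 < α) (hα1 : α < 1) {t : ℝ} (ht : 0 < t)
    (g : L2 Ω) :
    HasSum (fun j : ℕ => (inner ℝ g (toL2 Ω (φ j)) * mittagLeffler α 1 (-(μ j * t ^ α))) •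
      toL2 Ω (φ j)) (h.homOp α t g) := by
  refine (h.hilbertBasis.hasSum_repr_symm
    (diagOp (fun j => relaxKernel α (μ j) 1 t) (h.hilbertBasis.repr g))).congr_fun fun j => ?_
  rw [diagOp_apply (B := 1) fun j => abs_relaxKernel_one_le hα hα1 (h.pos j).le t, h.repr_apply,
    h.hilbertBasis_apply, relaxKernel_of_pos ht, sub_self, Real.rpow_zero, one_mul, mul_comm,
    real_inner_comm]

theorem hasSum_duhamelOp (h : IsEigenbasis Ω μ φ) (hα : 0 < α) (hα1 : α < 1) {t : ℝ} (ht : 0 < t)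
    (g : VDual Ω) :
    HasSum (fun j : ℕ => (g (φ j) * (t ^ (α - 1) * mittagLeffler α α (-(μ j * t ^ α)))) •
      vToDual (φ j)) (duhamelOp μ φ α t g) := by
  refine (h.isBessel_VDual.hasSum_synthesis
    (diagOp (fun j => relaxKernel α (μ j) α t) (analysis (vBasis μ φ) g))).congr_fun fun j => ?_
  have := (h.sqrt_pos j).ne'
  rw [diagOp_apply fun j => abs_relaxKernel_le hα hα1 (h.pos j).le t, h.analysis_vBasis_apply, dBasis,
    relaxKernel_of_pos ht, smul_smul]
  congr 1
  field_simp

end IsEigenbasis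

/-! ### Diagonal evolutions in `ℓ²` -/

section evol

variable {T t : ℝ} {k₁ k₂ : ℕ → ℝ → ℝ} {ρ₁ ρ₂ : ℝ → ℝ} {c z₀ : Ell2} {z' : ℝ → Ell2}

theorem integrableOn_diagOp_const (hm : ∀ j, Measurable (k₁ j))
    (hρ : ∀ j, ∀ τ ∈ Ioo 0 T, |k₁ j τ| ≤ ρ₁ τ) (hρi : IntegrableOn ρ₁ (Ioo 0 T)) (c : Ell2) :
    IntegrableOn (fun t => diagOp (fun j => k₁ j t) c) (Ioo 0 T) ∧
    ∫ t in Ioo 0 T, ‖diagOp (fun j => k₁ j t) c‖ ≤ (∫ t in Ioo 0 T, ρ₁ t) * ‖c‖ := by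
  have hle : ∀ᵐ t ∂(volume.restrict (Ioo 0 T)), ‖diagOp (fun j => k₁ j t) c‖ ≤ ρ₁ t * ‖c‖ := by
    filter_upwards [ae_restrict_mem measurableSet_Ioo] with t ht
    exact norm_diagOp_le (fun j => hρ j t ht) c
  have hi : IntegrableOn (fun t => diagOp (fun j => k₁ j t) c) (Ioo 0 T) := by
    refine Integrable.mono' (hρi.mul_const ‖c‖) (Ell2.aestronglyMeasurable fun j => ?_) hle
    have h1 : AEStronglyMeasurable (fun t => k₁ j t * c j) (volume.restrict (Ioo 0 T)) :=
      ((hm j).mul_const _).aestronglyMeasurable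
    refine h1.congr ?_
    filter_upwards [ae_restrict_mem measurableSet_Ioo] with t ht
    rw [diagOp_apply fun j => hρ j t ht]
  refine ⟨hi, ?_⟩
  rw [← integral_mul_const]
  exact integral_mono_ae hi.norm (hρi.mul_const _) hle

/-- The function `k₁(t) c + k₂(t) z₀ + ∫₀ᵗ k₂(t-s) z'(s) ds` for families of diagonal operators
`k₁(t)`, `k₂(t)`. -/
noncomputable def evol (k₁ k₂ : ℕ → ℝ → ℝ) (c z₀ : Ell2) (z' : ℝ → Ell2) (t : ℝ) : Ell2 :=
  diagOp (fun j => k₁ j t) c + diagOp (fun j => k₂ j t) z₀ + lconv k₂ z' t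

theorem evol_apply (h₁ : ∀ j, ∀ τ ∈ Ioc 0 T, |k₁ j τ| ≤ ρ₁ τ) (h₂ : ∀ j, ∀ τ ∈ Ioc 0 T, |k₂ j τ| ≤ ρ₂ τ)
    (ht : t ∈ Ioc 0 T)
    (hint : IntervalIntegrable (fun s => diagOp (fun j => k₂ j (t - s)) (z' s)) volume 0 t) (j : ℕ) :
    evol k₁ k₂ c z₀ z' t j = k₁ j t * c j + k₂ j t * z₀ j + cconv (k₂ j) (fun s => z' s j) t := by
  rw [evol, lp.coeFn_add, lp.coeFn_add, Pi.add_apply, Pi.add_apply, diagOp_apply fun j => h₁ j t ht,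
    diagOp_apply fun j => h₂ j t ht, lconv_apply (fun j τ hτ => h₂ j τ ⟨hτ.1, hτ.2.le⟩) ht hint]

/-- Constants contribute through the majorants, the convolution through Young's inequality. -/
theorem integrableOn_evol (hm₁ : ∀ j, Measurable (k₁ j)) (hm₂ : ∀ j, Measurable (k₂ j))
    (h₁ : ∀ j, ∀ τ ∈ Ioc 0 T, |k₁ j τ| ≤ ρ₁ τ) (h₂ : ∀ j, ∀ τ ∈ Ioc 0 T, |k₂ j τ| ≤ ρ₂ τ)
    (hi₁ : IntegrableOn ρ₁ (Ioo 0 T)) (hi₂ : IntegrableOn ρ₂ (Ioo 0 T))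
    (hz : IntegrableOn z' (Ioo 0 T)) :
    IntegrableOn (evol k₁ k₂ c z₀ z') (Ioo 0 T) ∧
    ∫ t in Ioo 0 T, ‖evol k₁ k₂ c z₀ z' t‖ ≤ (∫ t in Ioo 0 T, ρ₁ t) * ‖c‖ +
      (∫ t in Ioo 0 T, ρ₂ t) * (‖z₀‖ + ∫ t in Ioo 0 T, ‖z' t‖) := by
  have h₂' : ∀ j, ∀ τ ∈ Ioo 0 T, |k₂ j τ| ≤ ρ₂ τ := fun j τ hτ => h₂ j τ ⟨hτ.1, hτ.2.le⟩
  obtain ⟨a1, a2⟩ := integrableOn_diagOp_const hm₁ (fun j τ hτ => h₁ j τ ⟨hτ.1, hτ.2.le⟩) hi₁ c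
  obtain ⟨b1, b2⟩ := integrableOn_diagOp_const hm₂ h₂' hi₂ z₀
  obtain ⟨-, d1, d2⟩ := lconv_young hm₂ h₂' hi₂ hz
  refine ⟨(a1.add b1).add d1, ?_⟩
  have hle : ∫ t in Ioo 0 T, ‖evol k₁ k₂ c z₀ z' t‖ ≤ ∫ t in Ioo 0 T,
      (‖diagOp (fun j => k₁ j t) c‖ + ‖diagOp (fun j => k₂ j t) z₀‖ + ‖lconv k₂ z' t‖) :=
    integral_mono_ae ((a1.add b1).add d1).norm ((a1.norm.add b1.norm).add d1.norm)
      (ae_of_all _ fun t => norm_add₃_le)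
  have hsum := (integral_add (a1.norm.add b1.norm) d1.norm).trans
    (congrArg (· + ∫ t in Ioo 0 T, ‖lconv k₂ z' t‖) (integral_add a1.norm b1.norm))
  refine (hle.trans_eq hsum).trans ?_
  rw [mul_add, ← add_assoc]
  exact add_le_add (add_le_add a2 b2) d2

end evol

section kernels

variable {α T t : ℝ} {μ : ℕ → ℝ}

/-- The diagonal kernels of `u` with respect to the basis of `V` normalized by `√(1+μⱼ)`. -/
noncomputable def stateKernel₁ (α : ℝ) (μ : ℕ → ℝ) (j : ℕ) (t : ℝ) : ℝ :=
  √(1 + μ j) * relaxKernel α (μ j) 1 t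

/-- The companion of `stateKernel₁` acting on the source term. -/
noncomputable def stateKernel₂ (α : ℝ) (μ : ℕ → ℝ) (j : ℕ) (t : ℝ) : ℝ :=
  (1 + μ j) * relaxKernel α (μ j) (α + 1) t

/-- The diagonal kernels of `u'` with respect to the basis of `V*` normalized by `√(1+μⱼ)`. -/
noncomputable def rateKernel₁ (α : ℝ) (μ : ℕ → ℝ) (j : ℕ) (t : ℝ) : ℝ :=
  -(μ j / √(1 + μ j) * relaxKernel α (μ j) α t)

/-- The companion of `rateKernel₁` acting on the source term. -/
noncomputable def rateKernel₂ (α : ℝ) (μ : ℕ → ℝ) (j : ℕ) (t : ℝ) : ℝ := relaxKernel α (μ j) α t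

theorem abs_stateKernel₁_le (hα : 0 < α) (hα1 : α < 1) (hμ : ∀ j, 0 ≤ μ j) (T : ℝ) :
    ∀ j, ∀ t ∈ Ioc 0 T, |stateKernel₁ α μ j t| ≤ smoothingBound α t :=
  fun j _ ht => abs_sqrt_mul_relaxKernel_one_le hα hα1 (hμ j) ht.1

theorem abs_stateKernel₂_le (hα : 0 < α) (hα1 : α < 1) (hμ : ∀ j, 0 ≤ μ j) (T : ℝ) :
    ∀ j, ∀ t ∈ Ioc 0 T, |stateKernel₂ α μ j t| ≤ rlKernel (α + 1) T + 1 :=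
  fun j _ ht => abs_mul_relaxKernel_add_one_le hα hα1 (hμ j) ht

theorem abs_rateKernel₁_le (hα : 0 < α) (hα1 : α < 1) (hμ : ∀ j, 0 ≤ μ j) (T : ℝ) :
    ∀ j, ∀ t ∈ Ioc 0 T, |rateKernel₁ α μ j t| ≤ derivBound α t := fun j t ht => by
  rw [rateKernel₁, abs_neg]
  exact abs_div_sqrt_mul_relaxKernel_le hα hα1 (hμ j) ht.1

theorem abs_rateKernel₂_le (hα : 0 < α) (hα1 : α < 1) (hμ : ∀ j, 0 ≤ μ j) (T : ℝ) :
    ∀ j, ∀ t ∈ Ioc 0 T, |rateKernel₂ α μ j t| ≤ rlKernel α t :=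
  fun j t _ => abs_relaxKernel_le hα hα1 (hμ j) t

theorem measurable_stateKernel₁ (hα : 0 < α) (μ : ℕ → ℝ) (j : ℕ) : Measurable (stateKernel₁ α μ j) :=
  (measurable_relaxKernel hα one_pos _).const_mul _

theorem measurable_stateKernel₂ (hα : 0 < α) (μ : ℕ → ℝ) (j : ℕ) : Measurable (stateKernel₂ α μ j) :=
  (measurable_relaxKernel hα (by linarith) _).const_mul _

theorem measurable_rateKernel₁ (hα : 0 < α) (μ : ℕ → ℝ) (j : ℕ) : Measurable (rateKernel₁ α μ j) :=
  ((measurable_relaxKernel hα hα _).const_mul _).neg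

theorem measurable_rateKernel₂ (hα : 0 < α) (μ : ℕ → ℝ) (j : ℕ) : Measurable (rateKernel₂ α μ j) :=
  measurable_relaxKernel hα hα _

/-- The constant of the a priori estimate. -/
noncomputable def estimateConst (α T : ℝ) : ℝ :=
  2 * (∫ t in Ioo 0 T, smoothingBound α t) + (∫ t in Ioo 0 T, derivBound α t) +
    (2 * (∫ _ in Ioo 0 T, rlKernel (α + 1) T + 1) + ∫ t in Ioo 0 T, rlKernel α t) *
      (2 * (T⁻¹ + 2)) + 1

end kernels

/-! ### Functions with values in `V*` -/

section time

variable {Ω : Set Plane} {T t : ℝ} {f' : ℝ → VDual Ω}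

theorem integrableOn_apply (hf' : IntegrableOn f' (Ioo 0 T)) (v : V Ω) :
    IntegrableOn (fun s => f' s v) (Ioo 0 T) :=
  (ContinuousLinearMap.apply ℝ ℝ v).integrable_comp hf'

theorem intervalIntegral_apply {a b : ℝ} (hf' : IntervalIntegrable f' volume a b) (v : V Ω) :
    (∫ s in a..b, f' s) v = ∫ s in a..b, f' s v :=
  ((ContinuousLinearMap.apply ℝ ℝ v).intervalIntegral_comp_comm hf').symm

theorem intervalIntegrable_of_mem {X : Type*} [NormedAddCommGroup X] {g : ℝ → X}
    (hg : IntegrableOn g (Ioo 0 T)) (ht : t ∈ Ioc 0 T) : IntervalIntegrable g volume 0 t :=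
  (intervalIntegrable_iff_integrableOn_Ioo_of_le ht.1.le).2 (hg.mono_set (Ioo_subset_Ioo_right ht.2))

theorem rlIntegral_eq_cconv (β : ℝ) (g : ℝ → ℝ) (ht : 0 ≤ t) :
    rlIntegral β g t = cconv (rlKernel β) g t := by
  rw [rlIntegral, cconv, intervalIntegral.integral_of_le ht, intervalIntegral.integral_of_le ht,
    integral_Ioc_eq_integral_Ioo, integral_Ioc_eq_integral_Ioo]
  refine setIntegral_congr_fun measurableSet_Ioo fun s hs => ?_
  rw [rlKernel_of_pos (sub_pos.2 hs.2)]

theorem tendsto_primitive {g : ℝ → VDual Ω} (hT : 0 < T) (hg : IntegrableOn g (Ioo 0 T)) :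
    Tendsto (fun t => ∫ s in (0 : ℝ)..t, g s) (𝓝[>] 0) (𝓝 0) := by
  have h1 := (continuousOn_primitive hg) 0 (left_mem_Icc.2 hT.le)
  have h2 : Tendsto (fun t => ∫ s in (0 : ℝ)..t, g s) (𝓝[Ioo 0 T] 0) (𝓝 0) := by
    have := h1.tendsto.mono_left (nhdsWithin_mono 0 (Ioo_subset_Icc_self (a := (0 : ℝ)) (b := T)))
    simpa using this
  rwa [nhdsWithin_Ioo_eq_nhdsGT hT] at h2

/-- The initial value is controlled by averaging `c = g(t) - ∫₀ᵗ g'` over `(0, T)`. -/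
theorem norm_initial_le {X : Type*} [NormedAddCommGroup X] [NormedSpace ℝ X] (hT : 0 < T)
    {g g' : ℝ → X} {c : X} (hg : IntegrableOn g (Ioo 0 T)) (hg' : IntegrableOn g' (Ioo 0 T))
    (hgg' : g =ᵐ[volume.restrict (Ioo 0 T)] fun t => c + ∫ s in (0 : ℝ)..t, g' s) :
    ‖c‖ ≤ T⁻¹ * L1norm T g + L1norm T g' := by
  have h1 : ∫ _ in Ioo 0 T, ‖c‖ ≤ ∫ t in Ioo 0 T, (‖g t‖ + L1norm T g') := by
    refine integral_mono_ae (integrableOn_const (by simp)) (hg.norm.add (integrableOn_const (by simp))) ?_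
    filter_upwards [hgg', ae_restrict_mem measurableSet_Ioo] with t h2 ht
    have h3 : c = g t - ∫ s in (0 : ℝ)..t, g' s := by rw [h2, add_sub_cancel_right]
    have h4 : ‖∫ s in (0 : ℝ)..t, g' s‖ ≤ L1norm T g' := by
      refine (intervalIntegral.norm_integral_le_integral_norm ht.1.le).trans ?_
      rw [intervalIntegral.integral_of_le ht.1.le, integral_Ioc_eq_integral_Ioo]
      exact setIntegral_mono_set hg'.norm (ae_of_all _ fun _ => norm_nonneg _)
        (Ioo_subset_Ioo_right ht.2.le).eventuallyLE
    calc ‖c‖ = ‖g t - ∫ s in (0 : ℝ)..t, g' s‖ := by rw [← h3]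
      _ ≤ _ := (norm_sub_le _ _).trans (by gcongr)
  rw [integral_add hg.norm (integrableOn_const (by simp)), setIntegral_const, setIntegral_const,
    smul_eq_mul, smul_eq_mul, Real.volume_real_Ioo_of_le hT.le, sub_zero] at h1
  change T * ‖c‖ ≤ L1norm T g + T * L1norm T g' at h1
  rw [← mul_le_mul_iff_right₀ hT, mul_add, mul_inv_cancel_left₀ hT.ne']
  exact h1

end time

/-! ### The weak solution -/

namespace IsEigenbasis

variable {Ω : Set Plane} {μ : ℕ → ℝ} {φ : ℕ → V Ω} {α T t : ℝ} {u₀ : L2 Ω} {f₀ : VDual Ω}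
  {f f' : ℝ → VDual Ω}

/-- The weak solution for the data `u₀` and `f = f₀ + ∫₀ᵗ f'`. -/
noncomputable def solution (h : IsEigenbasis Ω μ φ) (α : ℝ) (u₀ : L2 Ω) (f₀ : VDual Ω)
    (f' : ℝ → VDual Ω) (t : ℝ) : V Ω :=
  synthesis (vBasis μ φ) (evol (stateKernel₁ α μ) (stateKernel₂ α μ) (h.hilbertBasis.repr u₀)
    (analysis (vBasis μ φ) f₀) (fun s => analysis (vBasis μ φ) (f' s)) t)

/-- The time derivative of `solution`. -/
noncomputable def solutionDeriv (h : IsEigenbasis Ω μ φ) (α : ℝ) (u₀ : L2 Ω) (f₀ : VDual Ω)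
    (f' : ℝ → VDual Ω) (t : ℝ) : VDual Ω :=
  synthesis (dBasis μ φ) (evol (rateKernel₁ α μ) (rateKernel₂ α μ) (h.hilbertBasis.repr u₀)
    (analysis (vBasis μ φ) f₀) (fun s => analysis (vBasis μ φ) (f' s)) t)

theorem nonneg (h : IsEigenbasis Ω μ φ) (j : ℕ) : 0 ≤ μ j := (h.pos j).le

theorem integrableOn_analysis (hf' : IntegrableOn f' (Ioo 0 T)) :
    IntegrableOn (fun s => analysis (vBasis μ φ) (f' s)) (Ioo 0 T) :=
  (analysis (vBasis μ φ)).integrable_comp hf'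

/-- The coefficients of `solution` solve the scalar relaxation equations, at every time. -/
theorem inner_solution (h : IsEigenbasis Ω μ φ) (hα : 0 < α) (hα1 : α < 1)
    (hf' : IntegrableOn f' (Ioo 0 T)) (ht : t ∈ Ioc 0 T) (j : ℕ) :
    inner ℝ (toL2 Ω (φ j)) (toL2 Ω (h.solution α u₀ f₀ f' t)) =
      modal α (μ j) (inner ℝ (toL2 Ω (φ j)) u₀) (f₀ (φ j)) (fun s => f' s (φ j)) t := by
  have hb := abs_stateKernel₂_le hα hα1 h.nonneg T
  have hint := intervalIntegrable_diagOp (measurable_stateKernel₂ hα μ)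
    (fun j τ hτ => hb j τ ⟨hτ.1, hτ.2.le⟩) (integrableOn_analysis (μ := μ) (φ := φ) hf') ht
    (integrableOn_mul_norm_of_bounded (integrableOn_analysis hf') ht)
  rw [solution, h.inner_synthesis_vBasis, evol_apply (ρ₂ := fun _ => rlKernel (α + 1) T + 1)
    (abs_stateKernel₁_le hα hα1 h.nonneg T) hb ht hint, h.repr_apply]
  simp only [h.analysis_vBasis_apply]
  rw [cconv_const_mul_right]
  unfold stateKernel₁ stateKernel₂
  rw [cconv_const_mul_left, modal]
  have h1 := (h.sqrt_pos j).ne'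
  have h2 := h.sq_sqrt j
  generalize √(1 + μ j) = s at h1 h2 ⊢
  rw [← h2]
  field_simp

theorem integrableOn_evol_rate (h : IsEigenbasis Ω μ φ) (hα : 0 < α) (hα1 : α < 1) (c z₀ : Ell2)
    {z' : ℝ → Ell2} (hz : IntegrableOn z' (Ioo 0 T)) :
    IntegrableOn (evol (rateKernel₁ α μ) (rateKernel₂ α μ) c z₀ z') (Ioo 0 T) ∧
    ∫ t in Ioo 0 T, ‖evol (rateKernel₁ α μ) (rateKernel₂ α μ) c z₀ z' t‖ ≤
      (∫ t in Ioo 0 T, derivBound α t) * ‖c‖ +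
        (∫ t in Ioo 0 T, rlKernel α t) * (‖z₀‖ + ∫ t in Ioo 0 T, ‖z' t‖) :=
  integrableOn_evol (measurable_rateKernel₁ hα μ) (measurable_rateKernel₂ hα μ)
    (abs_rateKernel₁_le hα hα1 h.nonneg T) (abs_rateKernel₂_le hα hα1 h.nonneg T)
    (integrableOn_derivBound hα T) (integrableOn_rlKernel hα T) hz

theorem integrableOn_evol_state (h : IsEigenbasis Ω μ φ) (hα : 0 < α) (hα1 : α < 1) (c z₀ : Ell2)
    {z' : ℝ → Ell2} (hz : IntegrableOn z' (Ioo 0 T)) :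
    IntegrableOn (evol (stateKernel₁ α μ) (stateKernel₂ α μ) c z₀ z') (Ioo 0 T) ∧
    ∫ t in Ioo 0 T, ‖evol (stateKernel₁ α μ) (stateKernel₂ α μ) c z₀ z' t‖ ≤
      (∫ t in Ioo 0 T, smoothingBound α t) * ‖c‖ +
        (∫ _ in Ioo 0 T, rlKernel (α + 1) T + 1) * (‖z₀‖ + ∫ t in Ioo 0 T, ‖z' t‖) :=
  integrableOn_evol (ρ₂ := fun _ => rlKernel (α + 1) T + 1)
    (measurable_stateKernel₁ hα μ) (measurable_stateKernel₂ hα μ)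
    (abs_stateKernel₁_le hα hα1 h.nonneg T) (abs_stateKernel₂_le hα hα1 h.nonneg T)
    (integrableOn_smoothingBound hα1 T) (integrableOn_const (by simp)) hz

theorem integrableOn_solution (h : IsEigenbasis Ω μ φ) (hα : 0 < α) (hα1 : α < 1) (u₀ : L2 Ω)
    (f₀ : VDual Ω) (hf' : IntegrableOn f' (Ioo 0 T)) :
    IntegrableOn (h.solution α u₀ f₀ f') (Ioo 0 T) :=
  (synthesis (vBasis μ φ)).integrable_comp
    (h.integrableOn_evol_state hα hα1 _ _ (integrableOn_analysis hf')).1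

theorem integrableOn_solutionDeriv (h : IsEigenbasis Ω μ φ) (hα : 0 < α) (hα1 : α < 1) (u₀ : L2 Ω)
    (f₀ : VDual Ω) (hf' : IntegrableOn f' (Ioo 0 T)) :
    IntegrableOn (h.solutionDeriv α u₀ f₀ f') (Ioo 0 T) :=
  (synthesis (dBasis μ φ)).integrable_comp
    (h.integrableOn_evol_rate hα hα1 _ _ (integrableOn_analysis hf')).1

theorem ae_solutionDeriv_apply (h : IsEigenbasis Ω μ φ) (hα : 0 < α) (hα1 : α < 1) (u₀ : L2 Ω)
    (f₀ : VDual Ω) (hf' : IntegrableOn f' (Ioo 0 T)) (j : ℕ) :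
    (fun t => h.solutionDeriv α u₀ f₀ f' t (φ j)) =ᵐ[volume.restrict (Ioo 0 T)]
      modalDeriv α (μ j) (inner ℝ (toL2 Ω (φ j)) u₀) (f₀ (φ j)) (fun s => f' s (φ j)) := by
  have hb := abs_rateKernel₂_le hα hα1 h.nonneg T
  filter_upwards [ae_restrict_mem measurableSet_Ioo, (lconv_young (measurable_rateKernel₂ hα μ)
    (fun j τ hτ => hb j τ ⟨hτ.1, hτ.2.le⟩) (integrableOn_rlKernel hα T)
    (integrableOn_analysis (μ := μ) (φ := φ) hf')).1] with t ht hint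
  rw [solutionDeriv, h.synthesis_dBasis_apply, evol_apply (abs_rateKernel₁_le hα hα1 h.nonneg T) hb
    ⟨ht.1, ht.2.le⟩ hint, h.repr_apply]
  simp only [h.analysis_vBasis_apply]
  rw [cconv_const_mul_right]
  unfold rateKernel₁ rateKernel₂ modalDeriv
  have h1 := (h.sqrt_pos j).ne'
  field_simp
  ring

/-- `solution` is a primitive of `solutionDeriv` in `V*` with initial value `u₀`, at every time. -/
theorem vToDual_solution (h : IsEigenbasis Ω μ φ) (hΩ : IsOpen Ω) (hα : 0 < α) (hα1 : α < 1)
    (u₀ : L2 Ω) (f₀ : VDual Ω) (hf' : IntegrableOn f' (Ioo 0 T)) (ht : t ∈ Ioc 0 T) :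
    vToDual (h.solution α u₀ f₀ f' t) =
      toDual u₀ + ∫ s in (0 : ℝ)..t, h.solutionDeriv α u₀ f₀ f' s := by
  refine h.dual_ext hΩ fun j => ?_
  have hi := intervalIntegrable_of_mem (h.integrableOn_solutionDeriv hα hα1 u₀ f₀ hf') ht
  rw [vToDual_apply, real_inner_comm (toL2 Ω (φ j)), h.inner_solution hα hα1 hf' ht,
    modal_eq_add_integral hα _ _ (integrableOn_apply hf' _) ht, _root_.add_apply, toDual_apply,
    intervalIntegral_apply hi, real_inner_comm (toL2 Ω (φ j))]
  congr 1
  refine intervalIntegral.integral_congr_ae_restrict ?_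
  rw [uIoc_of_le ht.1.le, ← restrict_Ioo_eq_restrict_Ioc]
  exact EventuallyEq.symm (ae_restrict_of_ae_restrict_of_subset (Ioo_subset_Ioo_right ht.2)
    (h.ae_solutionDeriv_apply hα hα1 u₀ f₀ hf' j))

/-- Duhamel's formula with the operators `E` and `F`. -/
theorem solution_eq_duhamel (h : IsEigenbasis Ω μ φ) (hΩ : IsOpen Ω) (hα : 0 < α) (hα1 : α < 1)
    (u₀ : L2 Ω) (hf : IntegrableOn f (Ioo 0 T)) (hf' : IntegrableOn f' (Ioo 0 T))
    (hff' : f =ᵐ[volume.restrict (Ioo 0 T)] fun t => f₀ + ∫ s in (0 : ℝ)..t, f' s)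
    (ht : t ∈ Ioc 0 T) :
    IntervalIntegrable (fun s => duhamelOp μ φ α (t - s) (f s)) volume 0 t ∧
    vToDual (h.solution α u₀ f₀ f' t) =
      toDual (h.homOp α t u₀) + ∫ s in (0 : ℝ)..t, duhamelOp μ φ α (t - s) (f s) := by
  have hb : ∀ j, ∀ τ ∈ Ioo 0 T, |rateKernel₂ α μ j τ| ≤ rlKernel α τ :=
    fun j τ hτ => abs_rateKernel₂_le hα hα1 h.nonneg T j τ ⟨hτ.1, hτ.2.le⟩
  have hz := integrableOn_analysis (μ := μ) (φ := φ) hf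
  obtain ⟨B, hB⟩ := (isCompact_Icc (a := (0 : ℝ)) (b := T)).exists_bound_of_continuousOn
    (continuousOn_primitive hf')
  have hκ : IntegrableOn (fun s => rlKernel α (t - s)) (Ioo 0 t) := by
    have := ((intervalIntegrable_of_mem (integrableOn_rlKernel hα T) ht).comp_sub_left t).symm
    rw [sub_self, sub_zero] at this
    exact (intervalIntegrable_iff_integrableOn_Ioo_of_le ht.1.le).1 this
  have hint0 : IntegrableOn (fun s => rlKernel α (t - s) * ‖analysis (vBasis μ φ) (f s)‖) (Ioo 0 t) := by
    refine Integrable.mul_bdd (c := 2 * (‖f₀‖ + B)) hκ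
      ((hz.mono_set (Ioo_subset_Ioo_right ht.2)).norm).1 ?_
    filter_upwards [ae_restrict_of_ae_restrict_of_subset (Ioo_subset_Ioo_right ht.2) hff',
      ae_restrict_mem measurableSet_Ioo] with s hs hs2
    rw [norm_norm]
    refine (h.isBessel_V.norm_analysis_le _).trans ?_
    gcongr
    rw [hs]
    exact (norm_add_le _ _).trans (by gcongr; exact hB s ⟨hs2.1.le, hs2.2.le.trans ht.2⟩)
  have hint := intervalIntegrable_diagOp (measurable_rateKernel₂ hα μ) hb hz ht hint0
  have hD : (fun s => duhamelOp μ φ α (t - s) (f s)) = fun s => synthesis (dBasis μ φ)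
    (diagOp (fun j => rateKernel₂ α μ j (t - s)) (analysis (vBasis μ φ) (f s))) := rfl
  have hi2 : IntervalIntegrable (fun s => duhamelOp μ φ α (t - s) (f s)) volume 0 t := by
    rw [hD, intervalIntegrable_iff_integrableOn_Ioo_of_le ht.1.le]
    rw [intervalIntegrable_iff_integrableOn_Ioo_of_le ht.1.le] at hint
    exact (synthesis (dBasis μ φ)).integrable_comp hint
  refine ⟨hi2, h.dual_ext hΩ fun j => ?_⟩
  have hI : ∫ s in (0 : ℝ)..t, duhamelOp μ φ α (t - s) (f s) =
      synthesis (dBasis μ φ) (lconv (rateKernel₂ α μ) (fun s => analysis (vBasis μ φ) (f s)) t) := by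
    rw [hD]
    exact (synthesis (dBasis μ φ)).intervalIntegral_comp_comm hint
  have hH : inner ℝ (toL2 Ω (φ j)) (h.homOp α t u₀) =
      relaxKernel α (μ j) 1 t * inner ℝ (toL2 Ω (φ j)) u₀ := by
    rw [← h.repr_apply, ← h.repr_apply]
    change h.hilbertBasis.repr (h.hilbertBasis.repr.symm _) j = _
    rw [LinearIsometryEquiv.apply_symm_apply]
    exact diagOp_apply (B := 1) (fun j => abs_relaxKernel_one_le hα hα1 (h.nonneg j) t) _ j
  rw [vToDual_apply, real_inner_comm (toL2 Ω (φ j)), h.inner_solution hα hα1 hf' ht,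
    modal_eq_duhamel hα _ _ (integrableOn_apply hf' _) ht, _root_.add_apply, toDual_apply,
    real_inner_comm (toL2 Ω (φ j)), hH, hI, h.synthesis_dBasis_apply, lconv_apply hb ht hint]
  simp only [h.analysis_vBasis_apply]
  rw [cconv_const_mul_right, mul_inv_cancel_left₀ (h.sqrt_pos j).ne']
  congr 1
  refine cconv_congr ⟨ht.1.le, ht.2⟩ (fun s _ => rfl) ?_
  filter_upwards [hff', ae_restrict_mem measurableSet_Ioo] with s hs hs2
  rw [hs, _root_.add_apply, intervalIntegral_apply (intervalIntegrable_of_mem hf' ⟨hs2.1, hs2.2.le⟩)]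

/-- For almost every `t` the equation holds in `V*`, since it holds on all eigenfunctions. -/
theorem solution_equation (h : IsEigenbasis Ω μ φ) (hΩ : IsOpen Ω) (hα : 0 < α) (hα1 : α < 1)
    (u₀ : L2 Ω) (hf' : IntegrableOn f' (Ioo 0 T))
    (hff' : f =ᵐ[volume.restrict (Ioo 0 T)] fun t => f₀ + ∫ s in (0 : ℝ)..t, f' s) :
    ∀ᵐ t ∂(volume.restrict (Ioo 0 T)), ∀ v : V Ω,
      rlIntegral (1 - α) (fun s => h.solutionDeriv α u₀ f₀ f' s v) t +
        bform (h.solution α u₀ f₀ f' t) v = f t v := by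
  have hy := (lconv_young (m := fun _ => rlKernel (1 - α)) (ρ := rlKernel (1 - α))
    (fun _ => measurable_rlKernel _)
    (fun _ τ _ => (abs_of_nonneg (rlKernel_nonneg (sub_pos.2 hα1) τ)).le)
    (integrableOn_rlKernel (sub_pos.2 hα1) T)
    (h.integrableOn_evol_rate hα hα1 (h.hilbertBasis.repr u₀) (analysis (vBasis μ φ) f₀)
      (integrableOn_analysis (μ := μ) (φ := φ) hf')).1).1
  have hmode : ∀ᵐ t ∂(volume.restrict (Ioo 0 T)), ∀ j,
      cconv (rlKernel (1 - α)) (modalDeriv α (μ j) (inner ℝ (toL2 Ω (φ j)) u₀) (f₀ (φ j))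
          fun s => f' s (φ j)) t +
        μ j * modal α (μ j) (inner ℝ (toL2 Ω (φ j)) u₀) (f₀ (φ j)) (fun s => f' s (φ j)) t =
        f₀ (φ j) + ∫ s in (0 : ℝ)..t, f' s (φ j) :=
    ae_all_iff.2 fun j => ae_modal_equation hα hα1 (h.nonneg j) _ _ (integrableOn_apply hf' _)
  filter_upwards [ae_restrict_mem measurableSet_Ioo, hy, hmode, hff'] with t ht h1 h2 h3 v
  have ht' : t ∈ Ioc 0 T := ⟨ht.1, ht.2.le⟩
  simp only [diagOp_const] at h1
  set w := h.solutionDeriv α u₀ f₀ f' with hw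
  have hi : IntervalIntegrable (fun s => rlKernel (1 - α) (t - s) • w s) volume 0 t := by
    rw [intervalIntegrable_iff_integrableOn_Ioo_of_le ht.1.le] at h1 ⊢
    refine ((synthesis (dBasis μ φ)).integrable_comp h1).congr (ae_of_all _ fun s => ?_)
    exact (synthesis (dBasis μ φ)).map_smul _ _
  have hG : ∀ v, (∫ s in (0 : ℝ)..t, rlKernel (1 - α) (t - s) • w s) v =
      cconv (rlKernel (1 - α)) (fun s => w s v) t := fun v => intervalIntegral_apply hi v
  have key : (∫ s in (0 : ℝ)..t, rlKernel (1 - α) (t - s) • w s) +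
      bformL Ω (h.solution α u₀ f₀ f' t) = f t := by
    refine h.dual_ext hΩ fun j => ?_
    rw [_root_.add_apply, hG, bformL_apply, h.bform_phi_right, h.inner_solution hα hα1 hf' ht', h3,
      _root_.add_apply, intervalIntegral_apply (intervalIntegrable_of_mem hf' ht'), ← h2 j]
    congr 1
    exact cconv_congr ⟨ht.1.le, ht.2.le⟩ (fun _ _ => rfl)
      (h.ae_solutionDeriv_apply hα hα1 u₀ f₀ hf' j)
  rw [rlIntegral_eq_cconv _ _ ht.1.le, ← hG, ← bformL_apply, ← _root_.add_apply, key]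

theorem isW11_solution (h : IsEigenbasis Ω μ φ) (hΩ : IsOpen Ω) (hα : 0 < α) (hα1 : α < 1)
    (u₀ : L2 Ω) (f₀ : VDual Ω) (hf' : IntegrableOn f' (Ioo 0 T)) :
    IsW11 T (fun t => vToDual (h.solution α u₀ f₀ f' t)) (h.solutionDeriv α u₀ f₀ f') := by
  refine isW11_of_ae_eq_primitive (c := toDual u₀)
    (h.integrableOn_solutionDeriv hα hα1 u₀ f₀ hf') ?_
  filter_upwards [ae_restrict_mem measurableSet_Ioo] with t ht
  exact h.vToDual_solution hΩ hα hα1 u₀ f₀ hf' ⟨ht.1, ht.2.le⟩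

theorem isWeakSolution_solution (h : IsEigenbasis Ω μ φ) (hΩ : IsOpen Ω) (hα : 0 < α) (hα1 : α < 1)
    (hT : 0 < T) (u₀ : L2 Ω) (hf' : IntegrableOn f' (Ioo 0 T))
    (hff' : f =ᵐ[volume.restrict (Ioo 0 T)] fun t => f₀ + ∫ s in (0 : ℝ)..t, f' s) :
    IsWeakSolution α T u₀ f (h.solution α u₀ f₀ f') := by
  have hd := h.integrableOn_solutionDeriv hα hα1 u₀ f₀ hf'
  refine ⟨h.integrableOn_solution hα hα1 u₀ f₀ hf', ⟨h.solutionDeriv α u₀ f₀ f',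
    h.isW11_solution hΩ hα hα1 u₀ f₀ hf', fun v => ?_⟩,
    fun t => toDual u₀ + ∫ s in (0 : ℝ)..t, h.solutionDeriv α u₀ f₀ f' s, ?_, ?_, ?_⟩
  · filter_upwards [h.solution_equation hΩ hα hα1 u₀ hf' hff'] with t ht using ht v
  · exact continuousOn_const.add ((continuousOn_primitive hd).mono Ioo_subset_Icc_self)
  · filter_upwards [ae_restrict_mem measurableSet_Ioo] with t ht
    exact (h.vToDual_solution hΩ hα hα1 u₀ f₀ hf' ⟨ht.1, ht.2.le⟩).symm
  · simp only [add_sub_cancel_left]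
    simpa using (tendsto_primitive hT hd).norm

/-! ### Uniqueness -/

/-- A weak solution is the primitive of its derivative with initial value `u₀`. -/
theorem _root_.FracBiharmonic.IsWeakSolution.ae_eq_primitive (hT : 0 < T) {w : ℝ → V Ω}
    (hw : IsWeakSolution α T u₀ f w) :
    ∃ w' : ℝ → VDual Ω, IntegrableOn w' (Ioo 0 T) ∧
      ((fun t => vToDual (w t)) =ᵐ[volume.restrict (Ioo 0 T)]
        fun t => toDual u₀ + ∫ s in (0 : ℝ)..t, w' s) ∧
      ∀ v : V Ω, ∀ᵐ t ∂(volume.restrict (Ioo 0 T)),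
        rlIntegral (1 - α) (fun s => w' s v) t + bform (w t) v = f t v := by
  obtain ⟨-, ⟨w', hW, heq⟩, U, hUc, hU, hU0⟩ := hw
  obtain ⟨c, hc⟩ := hW.ae_eq_primitive hT
  have hw' := hW.integrable_deriv
  have hon : EqOn U (fun t => c + ∫ s in (0 : ℝ)..t, w' s) (Ioo 0 T) :=
    Measure.eqOn_open_of_ae_eq (hU.trans hc) isOpen_Ioo hUc
      (continuousOn_const.add ((continuousOn_primitive hw').mono Ioo_subset_Icc_self))
  have h1 : Tendsto U (𝓝[>] 0) (𝓝 c) := by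
    have h2 : Tendsto (fun t => c + ∫ s in (0 : ℝ)..t, w' s) (𝓝[>] 0) (𝓝 c) := by
      simpa using (tendsto_primitive hT hw').const_add c
    refine h2.congr' ?_
    filter_upwards [Ioo_mem_nhdsGT hT] with t ht using (hon ht).symm
  have hc0 : c = toDual u₀ := tendsto_nhds_unique h1 (tendsto_iff_norm_sub_tendsto_zero.2 hU0)
  exact ⟨w', hw', hc0 ▸ hc, heq⟩

/-- The coefficients of the difference of two weak solutions solve homogeneous relaxation equations. -/
theorem weakSolution_unique (h : IsEigenbasis Ω μ φ) (hΩ : IsOpen Ω) (hα : 0 < α) (hα1 : α < 1)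
    (hT : 0 < T) {w u : ℝ → V Ω} (hw : IsWeakSolution α T u₀ f w) (hu : IsWeakSolution α T u₀ f u) :
    w =ᵐ[volume.restrict (Ioo 0 T)] u := by
  obtain ⟨w', hw', hwp, hwe⟩ := hw.ae_eq_primitive hT
  obtain ⟨u', hu', hup, hue⟩ := hu.ae_eq_primitive hT
  have hκ := integrableOn_rlKernel (sub_pos.2 hα1) T
  have hj : ∀ᵐ t ∂(volume.restrict (Ioo 0 T)), ∀ j,
      ∫ s in (0 : ℝ)..t, (w' s (φ j) + (-1) * u' s (φ j)) = 0 := by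
    refine ae_all_iff.2 fun j => ?_
    have iw := integrableOn_apply hw' (φ j)
    have iu := (integrableOn_apply hu' (φ j)).const_mul (-1)
    refine ae_eq_zero_of_relaxation hα hα1 (h.nonneg j) (iw.add iu) ?_
    filter_upwards [ae_restrict_mem measurableSet_Ioo, hwp, hup, hwe (φ j), hue (φ j),
      ae_intervalIntegrable_cconv hκ iw, ae_intervalIntegrable_cconv hκ iu]
      with t ht h1 h2 h3 h4 h5 h6
    have ht' : t ∈ Ioc 0 T := ⟨ht.1, ht.2.le⟩
    have e1 := congrArg (fun g : VDual Ω => g (φ j)) h1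
    have e2 := congrArg (fun g : VDual Ω => g (φ j)) h2
    simp only [_root_.add_apply, intervalIntegral_apply (intervalIntegrable_of_mem hw' ht'),
      intervalIntegral_apply (intervalIntegrable_of_mem hu' ht'), vToDual_apply] at e1 e2
    rw [rlIntegral_eq_cconv _ _ ht.1.le, h.bform_phi_right, real_inner_comm, e1] at h3
    rw [rlIntegral_eq_cconv _ _ ht.1.le, h.bform_phi_right, real_inner_comm, e2] at h4
    rw [cconv_add_right h5 h6, cconv_const_mul_right, intervalIntegral.integral_add
      (intervalIntegrable_of_mem iw ht') (intervalIntegrable_of_mem iu ht'),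
      intervalIntegral.integral_const_mul]
    linear_combination h3 - h4
  filter_upwards [ae_restrict_mem measurableSet_Ioo, hwp, hup, hj] with t ht h1 h2 h3
  have ht' : t ∈ Ioc 0 T := ⟨ht.1, ht.2.le⟩
  refine vToDual_injective hΩ ?_
  rw [h1, h2]
  congr 1
  refine h.dual_ext hΩ fun j => ?_
  have h4 := h3 j
  rw [intervalIntegral.integral_add (intervalIntegrable_of_mem (integrableOn_apply hw' (φ j)) ht')
      (intervalIntegrable_of_mem ((integrableOn_apply hu' (φ j)).const_mul (-1)) ht'),
      intervalIntegral.integral_const_mul] at h4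
  rw [intervalIntegral_apply (intervalIntegrable_of_mem hw' ht'),
    intervalIntegral_apply (intervalIntegrable_of_mem hu' ht')]
  linarith

/-! ### The a priori estimate -/

theorem solution_estimate (h : IsEigenbasis Ω μ φ) (hα : 0 < α) (hα1 : α < 1) (hT : 0 < T)
    (u₀ : L2 Ω) (hf : IntegrableOn f (Ioo 0 T)) (hf' : IntegrableOn f' (Ioo 0 T))
    (hff' : f =ᵐ[volume.restrict (Ioo 0 T)] fun t => f₀ + ∫ s in (0 : ℝ)..t, f' s) :
    L1norm T (h.solution α u₀ f₀ f') + L1norm T (h.solutionDeriv α u₀ f₀ f') ≤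
      estimateConst α T * (‖u₀‖ + (L1norm T f + L1norm T f')) := by
  have hz := integrableOn_analysis (μ := μ) (φ := φ) hf'
  obtain ⟨s1, s2⟩ := h.integrableOn_evol_state hα hα1 (h.hilbertBasis.repr u₀) (analysis (vBasis μ φ) f₀) hz
  obtain ⟨r1, r2⟩ := h.integrableOn_evol_rate hα hα1 (h.hilbertBasis.repr u₀) (analysis (vBasis μ φ) f₀) hz
  have hu : L1norm T (h.solution α u₀ f₀ f') ≤ 2 * ∫ t in Ioo 0 T, ‖evol (stateKernel₁ α μ)
      (stateKernel₂ α μ) (h.hilbertBasis.repr u₀) (analysis (vBasis μ φ) f₀)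
      (fun s => analysis (vBasis μ φ) (f' s)) t‖ := by
    rw [← integral_const_mul]
    exact integral_mono_ae (h.integrableOn_solution hα hα1 u₀ f₀ hf').norm (s1.norm.const_mul 2)
      (ae_of_all _ fun t => h.isBessel_V.norm_synthesis_le _)
  have hd : L1norm T (h.solutionDeriv α u₀ f₀ f') ≤ 1 * ∫ t in Ioo 0 T, ‖evol (rateKernel₁ α μ)
      (rateKernel₂ α μ) (h.hilbertBasis.repr u₀) (analysis (vBasis μ φ) f₀)
      (fun s => analysis (vBasis μ φ) (f' s)) t‖ := by
    rw [← integral_const_mul]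
    exact integral_mono_ae (h.integrableOn_solutionDeriv hα hα1 u₀ f₀ hf').norm (r1.norm.const_mul 1)
      (ae_of_all _ fun t => h.isBessel_VDual.norm_synthesis_le _)
  have hz0 : ‖analysis (vBasis μ φ) f₀‖ ≤ 2 * ‖f₀‖ := h.isBessel_V.norm_analysis_le f₀
  have hz1 : ∫ t in Ioo 0 T, ‖analysis (vBasis μ φ) (f' t)‖ ≤ 2 * L1norm T f' := by
    rw [L1norm, ← integral_const_mul]
    exact integral_mono_ae hz.norm (hf'.norm.const_mul 2)
      (ae_of_all _ fun t => h.isBessel_V.norm_analysis_le _)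
  have hf0 := norm_initial_le hT hf hf' hff'
  rw [LinearIsometryEquiv.norm_map] at s2 r2
  have hA : 0 ≤ ∫ t in Ioo 0 T, smoothingBound α t :=
    setIntegral_nonneg measurableSet_Ioo fun t ht => by
      have := ht.1; unfold smoothingBound; positivity
  have hD : 0 ≤ ∫ t in Ioo 0 T, derivBound α t :=
    setIntegral_nonneg measurableSet_Ioo fun t ht => by
      have := ht.1; unfold derivBound; positivity
  have hB : 0 ≤ ∫ _ in Ioo 0 T, rlKernel (α + 1) T + 1 :=
    setIntegral_nonneg measurableSet_Ioo fun t ht => by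
      have := rlKernel_nonneg (show 0 < α + 1 by linarith) T; positivity
  have hK : 0 ≤ ∫ t in Ioo 0 T, rlKernel α t :=
    setIntegral_nonneg measurableSet_Ioo fun t ht => rlKernel_nonneg hα t
  have hN : 0 ≤ L1norm T f := integral_nonneg fun _ => norm_nonneg _
  have hN' : 0 ≤ L1norm T f' := integral_nonneg fun _ => norm_nonneg _
  have hTi : 0 < T⁻¹ := inv_pos.2 hT
  unfold estimateConst
  set A := ∫ t in Ioo 0 T, smoothingBound α t
  set D := ∫ t in Ioo 0 T, derivBound α t
  set B := ∫ _ in Ioo 0 T, rlKernel (α + 1) T + 1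
  set K := ∫ t in Ioo 0 T, rlKernel α t
  set N := L1norm T f
  set N' := L1norm T f'
  set ζ := ‖analysis (vBasis μ φ) f₀‖ + ∫ t in Ioo 0 T, ‖analysis (vBasis μ φ) (f' t)‖ with hζ
  have hζ1 : ζ ≤ 2 * (T⁻¹ + 2) * (N + N') := by
    have : 0 ≤ T⁻¹ * N' := by positivity
    linarith
  have h1 : (2 * B + K) * ζ ≤ (2 * B + K) * (2 * (T⁻¹ + 2) * (N + N')) := by gcongr
  have h2 : 0 ≤ (2 * A + D) * (N + N') := by positivity
  have h3 : 0 ≤ (2 * B + K) * (2 * (T⁻¹ + 2)) * ‖u₀‖ := by positivity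
  have h4 : 0 ≤ ‖u₀‖ := norm_nonneg _
  linarith

end IsEigenbasis

theorem estimateConst_pos {α T : ℝ} (hα : 0 < α) (hT : 0 < T) : 0 < estimateConst α T := by
  have hA : 0 ≤ ∫ t in Ioo 0 T, smoothingBound α t :=
    setIntegral_nonneg measurableSet_Ioo fun t ht => by
      have := ht.1; unfold smoothingBound; positivity
  have hD : 0 ≤ ∫ t in Ioo 0 T, derivBound α t :=
    setIntegral_nonneg measurableSet_Ioo fun t ht => by
      have := ht.1; unfold derivBound; positivity
  have hB : 0 ≤ ∫ _ in Ioo 0 T, rlKernel (α + 1) T + 1 :=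
    setIntegral_nonneg measurableSet_Ioo fun t ht => by
      have := rlKernel_nonneg (show 0 < α + 1 by linarith) T; positivity
  have hK : 0 ≤ ∫ t in Ioo 0 T, rlKernel α t :=
    setIntegral_nonneg measurableSet_Ioo fun t ht => rlKernel_nonneg hα t
  unfold estimateConst
  positivity

end FracBiharmonic

theorem theorem2p1 (α T : ℝ) (hα₀ : 0 < α) (hα₁ : α < 1) (hT : 0 < T) :
    -- the constant depends on `α` and `T` only
    ∃ C : ℝ, 0 < C ∧
    ∀ Ω : Set FracBiharmonic.Plane, IsOpen Ω → Bornology.IsBounded Ω → Ω.Nonempty →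
      -- eigenpairs exist
      (∃ (μ : ℕ → ℝ) (φ : ℕ → FracBiharmonic.V Ω), FracBiharmonic.IsEigenbasis Ω μ φ) ∧
      -- and for every choice of them
      ∀ (μ : ℕ → ℝ) (φ : ℕ → FracBiharmonic.V Ω), FracBiharmonic.IsEigenbasis Ω μ φ →
        -- the series define bounded operators `E t` on `L²(Ω)` and `F t` on `V*`
        ∃ (E : ℝ → FracBiharmonic.L2 Ω →L[ℝ] FracBiharmonic.L2 Ω)
          (F : ℝ → FracBiharmonic.VDual Ω →L[ℝ] FracBiharmonic.VDual Ω),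
          (∀ t ∈ Set.Ioc 0 T, ∀ g : FracBiharmonic.L2 Ω,
            HasSum (fun j : ℕ =>
              (inner ℝ g (FracBiharmonic.toL2 Ω (φ j)) *
                FracBiharmonic.mittagLeffler α 1 (-(μ j * t ^ α))) •
                FracBiharmonic.toL2 Ω (φ j)) (E t g)) ∧
          (∀ t ∈ Set.Ioc 0 T, ∀ g : FracBiharmonic.VDual Ω,
            HasSum (fun j : ℕ =>
              (g (φ j) * (t ^ (α - 1) * FracBiharmonic.mittagLeffler α α (-(μ j * t ^ α)))) •
                FracBiharmonic.vToDual (φ j)) (F t g)) ∧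
          -- existence, uniqueness, representation and the estimate for all data
          ∀ (u₀ : FracBiharmonic.L2 Ω) (f f' : ℝ → FracBiharmonic.VDual Ω),
            FracBiharmonic.IsW11 T f f' →
            ∃ u : ℝ → FracBiharmonic.V Ω,
              FracBiharmonic.IsWeakSolution α T u₀ f u ∧
              (∀ w : ℝ → FracBiharmonic.V Ω, FracBiharmonic.IsWeakSolution α T u₀ f w →
                w =ᵐ[MeasureTheory.volume.restrict (Set.Ioo 0 T)] u) ∧
              (∀ t ∈ Set.Ioc 0 T,
                IntervalIntegrable (fun s => F (t - s) (f s)) MeasureTheory.volume 0 t ∧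
                FracBiharmonic.vToDual (u t) =
                  FracBiharmonic.toDual (E t u₀) + ∫ s in (0 : ℝ)..t, F (t - s) (f s)) ∧
              ∃ u' : ℝ → FracBiharmonic.VDual Ω,
                FracBiharmonic.IsW11 T (fun t => FracBiharmonic.vToDual (u t)) u' ∧
                FracBiharmonic.L1norm T u + FracBiharmonic.L1norm T u' ≤
                  C * (‖u₀‖ + (FracBiharmonic.L1norm T f + FracBiharmonic.L1norm T f')) := by
  refine ⟨FracBiharmonic.estimateConst α T, FracBiharmonic.estimateConst_pos hα₀ hT,
    fun Ω hΩ hΩb hne => ⟨FracBiharmonic.exists_isEigenbasis hΩ hΩb hne, fun μ φ h => ?_⟩⟩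
  refine ⟨fun t => h.homOp α t, fun t => FracBiharmonic.IsEigenbasis.duhamelOp μ φ α t,
    fun t ht g => h.hasSum_homOp hα₀ hα₁ ht.1 g, fun t ht g => h.hasSum_duhamelOp hα₀ hα₁ ht.1 g,
    fun u₀ f f' hf => ?_⟩
  obtain ⟨f₀, hff'⟩ := hf.ae_eq_primitive hT
  have hf' := hf.integrable_deriv
  have hu := h.isWeakSolution_solution hΩ hα₀ hα₁ hT u₀ hf' hff'
  exact ⟨h.solution α u₀ f₀ f', hu, fun w hw => h.weakSolution_unique hΩ hα₀ hα₁ hT hw hu,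
    fun t ht => h.solution_eq_duhamel hΩ hα₀ hα₁ u₀ hf.integrable hf' hff' ht,
    h.solutionDeriv α u₀ f₀ f', h.isW11_solution hΩ hα₀ hα₁ u₀ f₀ hf',
    h.solution_estimate hα₀ hα₁ hT u₀ hf.integrable hf' hff'⟩
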